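/- Let $\mathbb F_q$ be a finite field, $n\ge 1$, and let $\mathcal A$ be an $\mathbb F_q(x)$-algebra isomorphic to $M_n(\mathbb F_q(x))$, with a fixed $\mathbb F_q(x)$-basis $a_1,\dots,a_{n^2}$ in which elements of $\mathcal A$ are written. For $f,g\in\mathbb F_q[x]$ with $g\neq0$ put $|f/g|=\deg f-\deg g$, with $|0|=-\infty$, and for a vector put $|v|=\max_k|v_k|$. Let $R=\{r\in\mathbb F_q(x):|r|\le 0\}$. Let $\Lambda$ be a maximal $\mathbb F_q[x]$-order in $\mathcal A$ with $\mathbb F_q[x]$-basis $b_1,\dots,b_{n^2}$, let $\Delta$ be a maximal $R$-order in $\mathcal A$ with $R$-basis $u_1,\dots,u_{n^2}$, and let $C=\Lambda\cap\Delta$. For $c\in\mathcal A$ let $|c|$ denote the degree of the coordinate vector of $c$ in the basis $u_1,\dots,u_{n^2}$. An $\mathbb F_q[x]$-basis $c_1,\dots,c_{n^2}$ of $\Lambda$ is called reduced if $\sum_i|c_i|=|\det B|$, where the columns of $B$ are the coordinate vectors of the $c_i$ in the basis $u_1,\dots,u_{n^2}$. (1) For every reduced $\mathbb F_q[x]$-basis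 $c_1,\dots,c_{n^2}$ of $\Lambda$, the elements $x^jc_i$ with $1\le i\le n^2$, $j\in\mathbb Z_{\ge0}$ and $j+|c_i|\le 0$ form an $\mathbb F_q$-basis of $C$. (2) There is a deterministic algorithm, the same for all $q$, $n$, $\mathcal A$, $\Lambda$, $\Delta$ and all bases $a,b,u$, which, given the field $\mathbb F_q=\mathbb F_p[t]/(h)$ (by $p$ in binary and the coefficients of the monic irreducible polynomial $h$) and the coordinates of $b_1,\dots,b_{n^2}$ and $u_1,\dots,u_{n^2}$ in the basis $a_1,\dots,a_{n^2}$ (as fractions of polynomials), computes in time polynomial in the size of this input an $\mathbb F_q$-basis of $C$, written in the basis $a_1,\dots,a_{n^2}$. The basis that it returns consists of exactly the elements $x^jc_i$ with $j+|c_i|\le0$, for some reduced $\mathbb F_q[x]$-basis $c_1,\dots,c_{n^2}$ of $\Lambda$. -/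

import Mathlib

open Polynomial

namespace ExplicitIso

/-! ## The machine model: structured programs on binary trees, with a step count -/

/-- Memory contents: binary trees of cells (S-expressions with the single atom `nil`). -/
inductive Dat : Type
  | nil : Dat
  | cons : Dat → Dat → Dat

namespace Dat

/-- The number of nodes of a tree; this is the size of an input or an output. -/
def size : Dat → ℕ
  | nil => 1
  | cons a b => size a + size b + 1

def head : Dat → Dat
  | nil => nil
  | cons a _ => a

def tail : Dat → Dat
  | nil => nil
  | cons _ b => b

/-- A list of trees, as a tree. -/
def ofList : List Dat → Dat
  | [] => nil
  | d :: l => cons d (ofList l)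

def ofBool : Bool → Dat
  | false => nil
  | true => cons nil nil

/-- A natural number in binary, least significant bit first. -/
def ofNat (n : ℕ) : Dat := ofList ((Nat.bits n).map ofBool)

end Dat

/-- Programs: the variable-free form of the WHILE language on binary trees. Every program
transforms one tree into another one. -/
inductive Prog : Type
  | id : Prog
  | nil : Prog
  | head : Prog
  | tail : Prog
  | pair : Prog → Prog → Prog
  | comp : Prog → Prog → Prog
  | branch : Prog → Prog → Prog → Prog
  | loop : Prog → Prog → Prog

/-- `Run P x y t`: the program `P`, started on `x`, halts with the result `y` after exactly
`t` elementary steps. Elementary steps are the allocation of one cell, taking one of the two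
components of a cell, passing on a reference, and one transfer of control (a `nil` test, a
composition, one round of a loop); no step does arithmetic. Trees are kept in memory as linked
cells, so that each step is a constant-time operation of a pointer machine; running times are
polynomially related to those of Turing machines. -/
inductive Run : Prog → Dat → Dat → ℕ → Prop
  | id (x : Dat) : Run .id x x 1
  | nil (x : Dat) : Run .nil x .nil 1
  | head (x : Dat) : Run .head x x.head 1
  | tail (x : Dat) : Run .tail x x.tail 1
  | pair {f g : Prog} {x y z : Dat} {s t : ℕ} (hf : Run f x y s) (hg : Run g x z t) :
      Run (.pair f g) x (.cons y z) (s + t + 1)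
  | comp {g f : Prog} {x y z : Dat} {s t : ℕ} (hf : Run f x y s) (hg : Run g y z t) :
      Run (.comp g f) x z (s + t + 1)
  | branch_then {c f g : Prog} {x a b y : Dat} {r s : ℕ} (hc : Run c x (.cons a b) r)
      (hf : Run f x y s) : Run (.branch c f g) x y (r + s + 1)
  | branch_else {c f g : Prog} {x y : Dat} {r s : ℕ} (hc : Run c x .nil r)
      (hg : Run g x y s) : Run (.branch c f g) x y (r + s + 1)
  | loop_stop {c f : Prog} {x : Dat} {r : ℕ} (hc : Run c x .nil r) :
      Run (.loop c f) x x (r + 1)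
  | loop_step {c f : Prog} {x a b y z : Dat} {r s t : ℕ} (hc : Run c x (.cons a b) r)
      (hf : Run f x y s) (hl : Run (.loop c f) y z t) : Run (.loop c f) x z (r + s + t + 1)

/-- The model is deterministic: result and number of steps are functions of program and input. -/
theorem Run.deterministic {P : Prog} {x y y' : Dat} {t t' : ℕ} (h : Run P x y t)
    (h' : Run P x y' t') : y = y' ∧ t = t' := by
  induction h generalizing y' t' with
  | id x => cases h'; exact ⟨rfl, rfl⟩
  | nil x => cases h'; exact ⟨rfl, rfl⟩
  | head x => cases h'; exact ⟨rfl, rfl⟩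
  | tail x => cases h'; exact ⟨rfl, rfl⟩
  | pair _ _ ihf ihg =>
    cases h' with
    | pair hf hg =>
      obtain ⟨rfl, rfl⟩ := ihf hf
      obtain ⟨rfl, rfl⟩ := ihg hg
      exact ⟨rfl, rfl⟩
  | comp _ _ ihf ihg =>
    cases h' with
    | comp hf hg =>
      obtain ⟨rfl, rfl⟩ := ihf hf
      obtain ⟨rfl, rfl⟩ := ihg hg
      exact ⟨rfl, rfl⟩
  | branch_then _ _ ihc ihf =>
    cases h' with
    | branch_then hc hf =>
      obtain ⟨-, rfl⟩ := ihc hc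
      obtain ⟨rfl, rfl⟩ := ihf hf
      exact ⟨rfl, rfl⟩
    | branch_else hc hg => exact absurd (ihc hc).1 (by simp)
  | branch_else _ _ ihc ihg =>
    cases h' with
    | branch_then hc hf => exact absurd (ihc hc).1 (by simp)
    | branch_else hc hg =>
      obtain ⟨-, rfl⟩ := ihc hc
      obtain ⟨rfl, rfl⟩ := ihg hg
      exact ⟨rfl, rfl⟩
  | loop_stop _ ihc =>
    cases h' with
    | loop_stop hc =>
      obtain ⟨-, rfl⟩ := ihc hc
      exact ⟨rfl, rfl⟩
    | loop_step hc hf hl => exact absurd (ihc hc).1 (by simp)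
  | loop_step _ _ _ ihc ihf ihl =>
    cases h' with
    | loop_stop hc => exact absurd (ihc hc).1 (by simp)
    | loop_step hc hf hl =>
      obtain ⟨-, rfl⟩ := ihc hc
      obtain ⟨rfl, rfl⟩ := ihf hf
      obtain ⟨rfl, rfl⟩ := ihl hl
      exact ⟨rfl, rfl⟩

/-! ## Degrees, orthogonality defect, reduced bases -/

noncomputable section

open scoped Classical in
/-- The degree `|f/g| = deg f - deg g` of a rational function, with `|0| = -∞`. -/
def ratDeg {K : Type*} [Field K] (r : RatFunc K) : WithBot ℤ :=
  if r = 0 then ⊥ else (r.intDegree : WithBot ℤ)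

/-- The degree of a vector: the maximum of the degrees of its entries. -/
def vecDeg {K : Type*} [Field K] {m : ℕ} (v : Fin m → RatFunc K) : WithBot ℤ :=
  Finset.univ.sup fun i => ratDeg (v i)

/-- The orthogonality defect `∑ |b_i| - |det B|`, where `B` has the columns `b_i`. (It is used
for linearly independent vectors only: all degrees in it are then finite.) -/
def orthogonalityDefect {K : Type*} [Field K] {m : ℕ} (b : Fin m → Fin m → RatFunc K) : ℤ :=
  (∑ i, (vecDeg (b i)).unbotD 0) -
    (ratDeg (Matrix.det (Matrix.of fun i j => b j i))).unbotD 0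

/-- A reduced basis: a basis of orthogonality defect zero. -/
def IsReducedBasis {K : Type*} [Field K] {m : ℕ} (b : Fin m → Fin m → RatFunc K) : Prop :=
  LinearIndependent (RatFunc K) b ∧ orthogonalityDefect b = 0

/-! ## The two base rings, lattices and maximal orders -/

/-- The ring `K[x]` inside `K(x)`. -/
def polySubring (K : Type*) [Field K] : Subring (RatFunc K) :=
  (algebraMap K[X] (RatFunc K)).range

/-- The ring `R` of rational functions of degree at most zero. -/
def degSubring (K : Type*) [Field K] : Subring (RatFunc K) where
  carrier := {r | ratDeg r ≤ 0}
  zero_mem' := by simp [ratDeg]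
  one_mem' := by simp [ratDeg]
  mul_mem' := by
    intro r s hr hs
    by_cases hr0 : r = 0
    · simp [ratDeg, hr0]
    by_cases hs0 : s = 0
    · simp [ratDeg, hs0]
    simp only [ratDeg, Set.mem_ofPred_eq, hr0, hs0, mul_eq_zero, or_self, if_false] at hr hs ⊢
    norm_cast at hr hs ⊢
    rw [RatFunc.intDegree_mul hr0 hs0]
    omega
  add_mem' := by
    intro r s hr hs
    by_cases hr0 : r = 0
    · simpa [hr0] using hs
    by_cases hs0 : s = 0
    · simpa [hs0] using hr
    by_cases hrs : r + s = 0
    · simp [ratDeg, hrs]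
    simp only [ratDeg, Set.mem_ofPred_eq, hr0, hs0, hrs, if_false] at hr hs ⊢
    norm_cast at hr hs ⊢
    exact (RatFunc.intDegree_add_le hs0 hrs).trans (max_le hr hs)
  neg_mem' := by
    intro r hr
    by_cases hr0 : r = 0
    · simp [ratDeg, hr0]
    have hn : -r ≠ 0 := neg_ne_zero.mpr hr0
    simp only [ratDeg, Set.mem_ofPred_eq, hr0, hn, if_false, RatFunc.intDegree_neg] at hr ⊢
    exact hr

/-- The `F`-basis `b` of `A` is an `S`-basis of the full `S`-lattice `M`: the elements of `M` are
exactly the `S`-linear combinations of `b`. -/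
def IsLatticeBasis {F A ι : Type*} [Field F] [Ring A] [Algebra F A] (S : Subring F)
    (b : Module.Basis ι F A) (M : Set A) : Prop :=
  ∀ a : A, a ∈ M ↔ ∀ i, b.repr a i ∈ S

/-- An `S`-order in `A`: a subring with the same identity that is a full `S`-lattice. -/
def IsOrder {F A : Type*} [Field F] [Ring A] [Algebra F A] (S : Subring F)
    (Λ : Subring A) : Prop :=
  ∃ b : Module.Basis (Fin (Module.finrank F A)) F A, IsLatticeBasis S b (Λ : Set A)

/-- A maximal `S`-order: an order maximal with respect to inclusion. -/
def IsMaximalOrder {F A : Type*} [Field F] [Ring A] [Algebra F A] (S : Subring F)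
    (Λ : Subring A) : Prop :=
  IsOrder S Λ ∧ ∀ Γ : Subring A, IsOrder S Γ → Λ ≤ Γ → Γ = Λ

/-- The family `v` is a `K`-basis of the set `M` (which is thereby a `K`-subspace of `A`). -/
def IsBasisOf (K : Type*) {A ι : Type*} [Field K] [AddCommGroup A] [Module K A]
    (v : ι → A) (M : Set A) : Prop :=
  LinearIndependent K v ∧ (Submodule.span K (Set.range v) : Set A) = M

/-! ## Encoding of the data

The field with `q = p ^ e` elements is given as usual: by the prime `p` in binary and a monic
irreducible polynomial of degree `e` over `ZMod p`, the minimal polynomial of a generator. An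
element is given by its `e` coordinates (numbers below `p`, in binary) in the powers of the
generator. -/

/-- The description of the field: `p` and the coefficients of the minimal polynomial. -/
def encField {p : ℕ} {K : Type*} [Field K] [Algebra (ZMod p) K]
    (pb : PowerBasis (ZMod p) K) : Dat :=
  .cons (.ofNat p) (.ofList (List.ofFn fun i : Fin (pb.dim + 1) =>
    .ofNat ((minpoly (ZMod p) pb.gen).coeff i).val))

/-- The description of a field element. -/
def encElem {p : ℕ} {K : Type*} [Field K] [Algebra (ZMod p) K]
    (pb : PowerBasis (ZMod p) K) (k : K) : Dat :=
  .ofList (List.ofFn fun i : Fin pb.dim => .ofNat (pb.basis.repr k i).val)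

/-- `d` is a list of coefficients of the polynomial `f`, constant term first (zeros at the end are
allowed). -/
def RepPoly {p : ℕ} {K : Type*} [Field K] [Algebra (ZMod p) K]
    (pb : PowerBasis (ZMod p) K) (f : K[X]) (d : Dat) : Prop :=
  ∃ l : List K, (∀ i, f.coeff i = l.getD i 0) ∧ d = .ofList (l.map (encElem pb))

/-- `d` is a pair of a numerator and a nonzero denominator of `r` (not necessarily coprime). -/
def RepRat {p : ℕ} {K : Type*} [Field K] [Algebra (ZMod p) K]
    (pb : PowerBasis (ZMod p) K) (r : RatFunc K) (d : Dat) : Prop :=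
  ∃ (f g : K[X]) (df dg : Dat), g ≠ 0 ∧ RepPoly pb f df ∧ RepPoly pb g dg ∧
    r = algebraMap K[X] (RatFunc K) f / algebraMap K[X] (RatFunc K) g ∧ d = .cons df dg

/-- `d` is the list of the entries of the vector `v`. -/
def RepVec {p : ℕ} {K : Type*} [Field K] [Algebra (ZMod p) K]
    (pb : PowerBasis (ZMod p) K) {m : ℕ} (v : Fin m → RatFunc K) (d : Dat) : Prop :=
  ∃ ds : Fin m → Dat, (∀ i, RepRat pb (v i) (ds i)) ∧ d = .ofList (List.ofFn ds)

/-- `d` describes the list `L` of elements of `A` by their coordinate vectors in the basis `a`. -/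
def RepElems {p : ℕ} {K : Type*} [Field K] [Algebra (ZMod p) K]
    (pb : PowerBasis (ZMod p) K) {A : Type*} [Ring A] [Algebra (RatFunc K) A] {m : ℕ}
    (a : Module.Basis (Fin m) (RatFunc K) A) (L : List A) (d : Dat) : Prop :=
  ∃ ds : List Dat, List.Forall₂ (fun y e => RepVec pb (fun i => a.repr y i) e) L ds ∧
    d = .ofList ds

/-- `d` describes the field together with the families `b` and `u` of elements of `A`, written in
the basis `a`. -/
def RepInput {p : ℕ} {K : Type*} [Field K] [Algebra (ZMod p) K]
    (pb : PowerBasis (ZMod p) K) {A : Type*} [Ring A] [Algebra (RatFunc K) A] {m : ℕ}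
    (a : Module.Basis (Fin m) (RatFunc K) A) (b u : Fin m → A) (d : Dat) : Prop :=
  ∃ db du : Dat, RepElems pb a (List.ofFn b) db ∧ RepElems pb a (List.ofFn u) du ∧
    d = .cons (encField pb) (.cons db du)

end

end ExplicitIso

open ExplicitIso

/-!
Write `K` for the finite field, `m = n ^ 2` for the dimension of the algebra, `R` for the ring of
rational functions of degree at most zero.

*The basis of the intersection.* An element `w` of the algebra lies in `Λ ∩ Δ` if and only if its
coordinates `f i` in the basis `c` of `Λ` are polynomials, and its coordinate vector in the basis
`u`, which is the sum of the `f i • c i`, has entries in `R`. If `c` is reduced, the vectors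
`x ^ (-|c i|) • c i` form a matrix over `R` whose determinant has degree zero. By Cramer's rule over
`R` (`mem_degSubring_of_mulVec`) nothing cancels in the sum, and the second condition says that
`|f i| + |c i| ≤ 0` for all `i` (`combination_mem_degSubring_iff`). Hence `w` is a combination of
those `x ^ j • c i` with `j + |c i| ≤ 0` (`isBasisOf_inter`).

*The algorithm.* A vector `v` of `m` polynomials is turned into one polynomial, its image
`∑ r, z ^ r * v r (z ^ m)`. Multiplication of `v` by `x` becomes multiplication by `z ^ m`, and the
degree of the image records the degree of `v` together with the last entry that attains it. If the
degrees of `m` images are incongruent modulo `m`, the leading coefficients of the vectors form a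
matrix that is triangular up to a permutation of the rows, so that the degrees of the vectors add up
to that of their determinant: the vectors are reduced (`isReducedBasis_of_unflat`). If two degrees
are congruent modulo `m`, a product of the shorter vector with a power of `x` cancels the leading
coefficient of the longer image. This is lattice reduction (`reduceList_spec`); the total length of
the images bounds the number of its passes. Every vector is accompanied by a second one, on which
the same operations are performed.

The reduction is used twice. Applied to a vector `b` and to the `m` columns of a nonsingular matrix,
accompanied by the unit vectors, it has to make one of the `m + 1` images vanish, and the vector
that accompanies this image is a linear relation (`solve_spec`). This yields the coordinates of the
basis of `Λ` with respect to the basis of `Δ`, up to a common sign and a common denominator. Applied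
to these coordinate vectors, accompanied by the basis of `Λ` itself, it yields a reduced basis,
written in the basis in which the input is given (`mainPoly_spec`, `mainAlg_spec`).

*The running time.* The algorithm is a function on lists over an arbitrary field. It is computed by
a program that is built from the composition, the pairing and the branching of programs and from
loops that run through a list (`Code.Computes`). All elements of the finite field are given the same
weight, so that the weight of a polynomial depends on the number of its coefficients only. A loop is
polynomial as soon as its states are (`Code.Computes.foldInv`). During the reduction the images do
not become longer, and in each step the accompanying polynomials grow at most by the length of an
image (`StateBd.passStep`). The resulting bound in terms of the weight of the input
(`exists_mainAlg`) becomes one in terms of its size by `FieldData.wt_input_le`.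
-/

namespace ExplicitIso

universe v w

/-! ### Functions computable in polynomial time -/

/-- Types whose elements are stored as trees. The weight `wt` bounds the size of the tree; it is
kept apart from the size so that it may be chosen to be the same for all elements of a fixed finite
field, which makes the weight of a list of field elements a function of its length. -/
class Enc (α : Type*) where
  enc : α → Dat
  wt : α → ℕ
  size_le : ∀ a, (enc a).size ≤ wt a

open Enc

theorem Dat.size_pos (d : Dat) : 0 < d.size := by cases d <;> simp [Dat.size]

theorem wt_pos {α : Type*} [Enc α] (a : α) : 0 < wt a :=
  (Dat.size_pos _).trans_le (size_le a)

/-- A polynomial with natural coefficients is monotone. -/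
theorem eval_mono (T : ℕ[X]) {a b : ℕ} (h : a ≤ b) : T.eval a ≤ T.eval b := by
  rw [eval_eq_sum_range, eval_eq_sum_range]
  exact Finset.sum_le_sum fun i _ => Nat.mul_le_mul_left _ (Nat.pow_le_pow_left h i)

instance : Enc Bool where
  enc := Dat.ofBool
  wt _ := 3
  size_le b := by cases b <;> simp [Dat.ofBool, Dat.size]

/-- A pair is stored as one cell. -/
instance {α β : Type*} [Enc α] [Enc β] : Enc (α × β) where
  enc x := .cons (enc x.1) (enc x.2)
  wt x := wt x.1 + wt x.2 + 1
  size_le x := by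
    have h1 := size_le x.1
    have h2 := size_le x.2
    simp only [Dat.size]
    omega

/-- The weight of a list: every cell and the end of the list count one. -/
def listWt {α : Type*} [Enc α] : List α → ℕ
  | [] => 1
  | a :: l => wt a + listWt l + 1

/-- A list is stored as a chain of cells. -/
instance {α : Type*} [Enc α] : Enc (List α) where
  enc l := Dat.ofList (l.map enc)
  wt := listWt
  size_le l := by
    induction l with
    | nil => simp [Dat.ofList, Dat.size, listWt]
    | cons a l ih =>
      have := size_le a
      simp only [List.map_cons, Dat.ofList, Dat.size, listWt] at *
      omega

/-- A natural number is stored as the list of its binary digits, least significant digit first. -/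
instance : Enc ℕ where
  enc := Dat.ofNat
  wt n := wt n.bits
  size_le n := size_le n.bits

section wt
variable {α β : Type*} [Enc α] [Enc β]

@[simp] theorem wt_pair (x : α × β) : wt x = wt x.1 + wt x.2 + 1 := rfl
@[simp] theorem wt_nil : wt ([] : List α) = 1 := rfl
@[simp] theorem wt_cons (a : α) (l : List α) : wt (a :: l) = wt a + wt l + 1 := rfl
@[simp] theorem wt_bool (b : Bool) : wt b = 3 := rfl
@[simp] theorem wt_zero : wt (0 : ℕ) = 1 := by
  change listWt (Nat.bits 0) = 1
  simp [listWt]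

theorem wt_append (l l' : List α) : wt (l ++ l') + 1 = wt l + wt l' := by
  induction l with
  | nil => simp; omega
  | cons a l ih => simp only [List.cons_append, wt_cons]; omega

theorem length_lt_wt (l : List α) : l.length < wt l := by
  induction l with
  | nil => simp
  | cons a l ih => simp only [List.length_cons, wt_cons]; omega

theorem wt_le_of_mem {l : List α} {a : α} (h : a ∈ l) : wt a < wt l := by
  induction l with
  | nil => simp at h
  | cons b l ih =>
    rcases List.mem_cons.1 h with rfl | h
    · simp only [wt_cons]; omega
    · have := ih h
      simp only [wt_cons]; omega

theorem wt_le_of_forall {l : List α} {B : ℕ} (h : ∀ a ∈ l, wt a ≤ B) :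
    wt l ≤ l.length * (B + 1) + 1 := by
  induction l with
  | nil => simp
  | cons b l ih =>
    have h1 := h b (by simp)
    have h2 := ih fun a ha => h a (by simp [ha])
    simp only [wt_cons, List.length_cons, Nat.add_mul]
    omega

end wt

/-- A program together with a polynomial, which serves as a bound both for the running time and for
the weight of the result. -/
structure Code where
  prog : Prog
  bd : ℕ[X]

/-- The program of `C` computes the function `f` within the bound of `C`. -/
def Code.Computes {α β : Type*} [Enc α] [Enc β] (C : Code) (f : α → β) : Prop :=
  ∀ a, ∃ t, Run C.prog (enc a) (enc (f a)) t ∧ t ≤ C.bd.eval (wt a) ∧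
    wt (f a) ≤ C.bd.eval (wt a)

noncomputable section

namespace Code

/-! The elements of a type are passed to a program as one tree, from which `fst` and `snd` extract
the components; so `id.snd.fst` stands for a variable of a program. -/

def id : Code := ⟨.id, X⟩
def nil : Code := ⟨.nil, 1⟩
def fst (C : Code) : Code := ⟨.comp .head C.prog, C.bd + 2⟩
def snd (C : Code) : Code := ⟨.comp .tail C.prog, C.bd + 2⟩
def pair (C D : Code) : Code := ⟨.pair C.prog D.prog, C.bd + D.bd + 1⟩
def comp (D C : Code) : Code := ⟨.comp D.prog C.prog, C.bd + D.bd.comp C.bd + 1⟩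
def ite (B C D : Code) : Code := ⟨.branch B.prog C.prog D.prog, B.bd + C.bd + D.bd + 1⟩

/-- The same program with a larger bound. This serves for functions whose values are stored as the
same trees as those of another function, but have a larger weight. -/
def weaken (C : Code) (T : ℕ[X]) : Code := ⟨C.prog, C.bd + T⟩

/-- The loop that runs through a list: the memory holds a pair of the parameters and of a pair of
the remaining list and the state, the program `C` updates the state, and `B` bounds the weight of
all states that occur. -/
def fold (C : Code) (B : ℕ[X]) : Code :=
  ⟨.comp (.comp .tail .tail) (.loop (.comp .head .tail)
    (.pair .head (.pair (.comp .tail (.comp .head .tail))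
      (.comp C.prog (.pair .head (.pair (.comp .tail .tail)
        (.comp .head (.comp .head .tail)))))))),
    (X + 1) * (C.bd.comp (X + B + 2) + 32) + 10 + B⟩

end Code

namespace Code.Computes

variable {α β γ δ σ : Type*} [Enc α] [Enc β] [Enc γ] [Enc δ] [Enc σ]

theorem var : Code.id.Computes (fun a : α => a) := fun a =>
  ⟨1, .id _, by simp [Code.id]; exact wt_pos a, by simp [Code.id]⟩

theorem const {b : β} (hb : enc b = Dat.nil) (hw : wt b = 1) : Code.nil.Computes (fun _ : α => b) :=
  fun a => ⟨1, by rw [hb]; exact .nil _, by simp [Code.nil], by simp [Code.nil, hw]⟩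

theorem empty : Code.nil.Computes (fun _ : α => ([] : List β)) := const rfl rfl

theorem natZero : Code.nil.Computes (fun _ : α => (0 : ℕ)) :=
  const (by change Dat.ofNat 0 = _; simp [Dat.ofNat, Dat.ofList]) wt_zero

/-- A program computes every function whose values are stored as the same trees. -/
theorem congr {C : Code} {f : α → β} (h : C.Computes f) (g : α → γ) (T : ℕ[X])
    (he : ∀ a, enc (f a) = enc (g a)) (hw : ∀ a, wt (g a) ≤ wt (f a) + T.eval (wt a)) :
    (C.weaken T).Computes g := fun a => by
  obtain ⟨t, h1, h2, h3⟩ := h a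
  have := hw a
  exact ⟨t, he a ▸ h1, by simp [Code.weaken]; omega, by simp [Code.weaken]; omega⟩

theorem of_eq {C : Code} {f g : α → β} (h : C.Computes f) (hfg : ∀ a, f a = g a) :
    C.Computes g := by
  rwa [← funext hfg]

theorem fst {C : Code} {f : α → β × γ} (h : C.Computes f) :
    C.fst.Computes (fun a => (f a).1) := fun a => by
  obtain ⟨t, h1, h2, h3⟩ := h a
  refine ⟨t + 1 + 1, .comp h1 (.head _), ?_, ?_⟩ <;> simp [Code.fst] at * <;> omega

theorem snd {C : Code} {f : α → β × γ} (h : C.Computes f) :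
    C.snd.Computes (fun a => (f a).2) := fun a => by
  obtain ⟨t, h1, h2, h3⟩ := h a
  refine ⟨t + 1 + 1, .comp h1 (.tail _), ?_, ?_⟩ <;> simp [Code.snd] at * <;> omega

theorem pair {C D : Code} {f : α → β} {g : α → γ} (hf : C.Computes f) (hg : D.Computes g) :
    (C.pair D).Computes (fun a => (f a, g a)) := fun a => by
  obtain ⟨t, h1, h2, h3⟩ := hf a
  obtain ⟨t', h1', h2', h3'⟩ := hg a
  refine ⟨t + t' + 1, .pair h1 h1', ?_, ?_⟩ <;> simp [Code.pair] at * <;> omega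

theorem comp {C D : Code} {g : β → γ} {f : α → β} (hg : D.Computes g) (hf : C.Computes f) :
    (D.comp C).Computes (fun a => g (f a)) := fun a => by
  obtain ⟨t, h1, h2, h3⟩ := hf a
  obtain ⟨t', h1', h2', h3'⟩ := hg (f a)
  have := eval_mono D.bd h3
  refine ⟨t + t' + 1, .comp h1 h1', ?_, ?_⟩ <;> simp [Code.comp] <;> omega

theorem ite {B C D : Code} {b : α → Bool} {f g : α → β} (hb : B.Computes b) (hf : C.Computes f)
    (hg : D.Computes g) : (Code.ite B C D).Computes (fun a => if b a = true then f a else g a) :=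
  fun a => by
  obtain ⟨r, r1, r2, r3⟩ := hb a
  obtain ⟨t, h1, h2, h3⟩ := hf a
  obtain ⟨t', h1', h2', h3'⟩ := hg a
  cases h : b a with
  | true =>
    rw [h] at r1
    have e : (if b a = true then f a else g a) = f a := if_pos h
    simp only [e]
    refine ⟨r + t + 1, .branch_then r1 h1, ?_, ?_⟩ <;> simp [Code.ite] at * <;> omega
  | false =>
    rw [h] at r1
    have e : (if b a = true then f a else g a) = g a := if_neg (by simp [h])
    simp only [e]
    refine ⟨r + t' + 1, .branch_else r1 h1', ?_, ?_⟩ <;> simp [Code.ite] at * <;> omega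

/-- The empty list is stored as the empty tree, whose second component is again empty. -/
theorem tail {C : Code} {f : α → List β} (h : C.Computes f) :
    C.snd.Computes (fun a => (f a).tail) := fun a => by
  obtain ⟨t, h1, h2, h3⟩ := h a
  have he : enc (f a).tail = (enc (f a)).tail := by cases f a <;> rfl
  have hw : wt (f a).tail ≤ wt (f a) := by
    cases f a <;> simp
    omega
  refine ⟨t + 1 + 1, he ▸ .comp h1 (.tail _), ?_, ?_⟩ <;> (simp [Code.snd]; omega)

theorem cons {C D : Code} {f : α → β} {g : α → List β} (hf : C.Computes f) (hg : D.Computes g) :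
    (C.pair D).Computes (fun a => f a :: g a) := fun a => by
  obtain ⟨t, h1, h2, h3⟩ := hf a
  obtain ⟨t', h1', h2', h3'⟩ := hg a
  refine ⟨t + t' + 1, .pair h1 h1', ?_, ?_⟩ <;> simp [Code.pair] at * <;> omega

end Code.Computes

/-- Whether a list is not empty. -/
def isCons {α : Type*} : List α → Bool
  | [] => false
  | _ :: _ => true

namespace Code

/-- `true` if the result of `C` is not the empty tree. -/
def isCons (C : Code) : Code :=
  ⟨.branch C.prog (.pair .nil .nil) .nil, C.bd + 8⟩

/-- The first entry of the list that `C` computes, or the result of `D` if that list is empty. -/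
def headD (C D : Code) : Code := ⟨.branch C.prog (.comp .head C.prog) D.prog, 2 * C.bd + D.bd + 5⟩

end Code

namespace Code.Computes

variable {α β γ δ σ : Type*} [Enc α] [Enc β] [Enc γ] [Enc δ] [Enc σ]

theorem ff : Code.nil.weaken 3 |>.Computes (fun _ : α => false) := fun a =>
  ⟨1, .nil _, by simp [Code.nil, Code.weaken], by simp [Code.nil, Code.weaken]⟩

theorem tt : (Code.pair .nil .nil).Computes (fun _ : α => true) := fun a =>
  ⟨3, .pair (.nil _) (.nil _), by simp [Code.nil, Code.pair], by simp [Code.nil, Code.pair]⟩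

theorem isCons {C : Code} {f : α → List β} (h : C.Computes f) :
    C.isCons.Computes (fun a => ExplicitIso.isCons (f a)) := fun a => by
  obtain ⟨t, h1, h2, h3⟩ := h a
  cases hl : f a with
  | nil =>
    rw [hl] at h1
    simp only [ExplicitIso.isCons, hl]
    refine ⟨t + 1 + 1, .branch_else h1 (.nil _), ?_, ?_⟩ <;> simp [Code.isCons]
    omega
  | cons b l =>
    rw [hl] at h1
    simp only [ExplicitIso.isCons, hl]
    refine ⟨t + 3 + 1, .branch_then h1 (.pair (.nil _) (.nil _)), ?_, ?_⟩ <;> simp [Code.isCons]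
    omega

theorem headD {C D : Code} {f : α → List β} {d : α → β} (h : C.Computes f) (hd : D.Computes d) :
    (C.headD D).Computes (fun a => (f a).headD (d a)) := fun a => by
  obtain ⟨t, h1, h2, h3⟩ := h a
  obtain ⟨t', h1', h2', h3'⟩ := hd a
  cases hl : f a with
  | nil =>
    rw [hl] at h1
    simp only [List.headD_nil, hl]
    refine ⟨t + t' + 1, .branch_else h1 h1', ?_, ?_⟩ <;> simp [Code.headD] at * <;> omega
  | cons b l =>
    rw [hl] at h1 h3
    simp only [List.headD_cons, hl]
    refine ⟨t + (t + 1 + 1) + 1, .branch_then h1 (.comp h1 (.head _)), ?_, ?_⟩ <;>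
      simp [Code.headD] at * <;> omega

/-- A loop through a list is polynomial if the states that occur are bounded. The bound `hB` is
asked for after each initial segment `l` of a list `l ++ l'`, in terms of the weight of the whole
list. -/
theorem fold {C : Code} (B : ℕ[X]) {F : γ × (σ × α) → σ} (hF : C.Computes F)
    (hB : ∀ (c : γ) (l l' : List α) (s : σ), wt (l.foldl (fun s a => F (c, (s, a))) s) ≤
      B.eval (wt c + wt (l ++ l') + wt s)) :
    (C.fold B).Computes
      (fun x : γ × (List α × σ) => x.2.1.foldl (fun s a => F (x.1, (s, a))) x.2.2) := by
  rintro ⟨c, l, s⟩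
  set n := wt (c, (l, s)) with hn
  have hn' : n = wt c + (wt l + wt s + 1) + 1 := rfl
  set W := C.bd.eval (n + B.eval n + 2) with hW
  -- `l'` is the part of the list that has been read, `s'` the state after it
  have key : ∀ l₂ l₁ : List α, l = l₁ ++ l₂ →
      ∃ t, Run (.loop (.comp .head .tail)
        (.pair .head (.pair (.comp .tail (.comp .head .tail))
          (.comp C.prog (.pair .head (.pair (.comp .tail .tail)
            (.comp .head (.comp .head .tail))))))))
        (enc (c, (l₂, l₁.foldl (fun s a => F (c, (s, a))) s)))
        (enc (c, (([] : List α), l.foldl (fun s a => F (c, (s, a))) s))) t ∧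
        t ≤ 4 + l₂.length * (W + 32) := by
    intro l₂
    induction l₂ with
    | nil =>
      intro l₁ h
      obtain rfl : l = l₁ := by simpa using h
      exact ⟨1 + 1 + 1 + 1, by constructor; exact .comp (.tail _) (.head _), by simp⟩
    | cons a l₂ ih =>
      intro l₁ h
      obtain ⟨t, h1, h2⟩ := ih (l₁ ++ [a]) (by simp [h])
      set s' := l₁.foldl (fun s a => F (c, (s, a))) s with hs'
      rw [List.foldl_append, List.foldl_cons, List.foldl_nil, ← hs'] at h1
      obtain ⟨t', h1', h2', h3'⟩ := hF (c, (s', a))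
      have hs : wt s' ≤ B.eval n :=
        (hB c l₁ (a :: l₂) s).trans (eval_mono _ (by rw [← h]; omega))
      have ha : wt a < wt l := wt_le_of_mem (by simp [h])
      have hw : t' ≤ W := h2'.trans (eval_mono _ (by simp only [wt_pair]; omega))
      refine ⟨_, .loop_step (.comp (.tail _) (.head _))
        (.pair (.head _) (.pair (.comp (.comp (.tail _) (.head _)) (.tail _))
          (.comp (.pair (.head _) (.pair (.comp (.tail _) (.tail _))
            (.comp (.comp (.tail _) (.head _)) (.head _)))) h1'))) h1, ?_⟩
      simp only [List.length_cons, Nat.add_mul]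
      omega
  obtain ⟨t, h1, h2⟩ := key l [] rfl
  have hl := length_lt_wt l
  have hfin : wt (l.foldl (fun s a => F (c, (s, a))) s) ≤ B.eval n := by
    have := hB c l [] s
    rw [List.append_nil] at this
    exact this.trans (eval_mono _ (by omega))
  refine ⟨_, .comp h1 (.comp (.tail _) (.tail _)), ?_, ?_⟩
  · have : l.length * (W + 32) ≤ (n + 1) * (W + 32) := Nat.mul_le_mul_right _ (by omega)
    simp only [Code.fold, eval_add, eval_mul, eval_comp, eval_X, eval_one, eval_ofNat, ← hW]
    omega
  · simp only [Code.fold, eval_add, eval_mul, eval_comp, eval_X, eval_one, eval_ofNat, ← hW]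
    omega

end Code.Computes

/-! ### Programs for lists -/

namespace Code

/-- The loop with body `F` and the bound `B` for its states, where `C`, `L` and `S` compute the
parameters, the list and the initial state. -/
def foldAt (F : Code) (B : ℕ[X]) (C L S : Code) : Code := (F.fold B).comp (C.pair (L.pair S))

/-- A loop whose state gains in each round a weight that is bounded, by the polynomial `G`, in
terms of the parameters and of the current entry. -/
def foldAdd (F : Code) (G : ℕ[X]) (C L S : Code) : Code := F.foldAt (X + X * G) C L S

/-! The next programs compute the functions of `List` with the same names, and `mapWith` applies a
function with a parameter to the entries of a list. -/

def reverse (L : Code) : Code :=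
  foldAdd (Code.pair Code.id.snd.snd Code.id.snd.fst) (X + 1) nil L nil

def mapWith (F C L : Code) : Code :=
  reverse (foldAdd (Code.pair (F.comp (Code.id.fst.pair Code.id.snd.snd)) Code.id.snd.fst)
    (F.bd.comp (X + 1) + 1) C L nil)

def append (L M : Code) : Code :=
  foldAdd (Code.pair Code.id.snd.snd Code.id.snd.fst) (X + 1) nil L.reverse M

/-- Removal of as many entries from the list of `L` as the list of `M` has. -/
def dropLength (L M : Code) : Code := foldAdd Code.id.snd.fst.snd 0 nil M L

/-- Whether the list of `L` is at most as long as that of `M`. Lengths are compared without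
computing them. -/
def lengthLe (L M : Code) : Code := ite (isCons (dropLength L M)) (nil.weaken 3) (nil.pair nil)

end Code

/-- The list of pairs of two lists, where the shorter one is filled up by `d` or `e`. -/
def zipPad {α β : Type*} (d : α) (e : β) : List α → List β → List (α × β)
  | [], l' => l'.map (d, ·)
  | a :: l, l' => (a, l'.headD e) :: zipPad d e l l'.tail

namespace Code.Computes

variable {α β γ δ σ : Type*} [Enc α] [Enc β] [Enc γ] [Enc δ] [Enc σ]
  {C D E L M S A : Code}

theorem not {b : α → Bool} (hb : C.Computes b) :
    (Code.ite C (nil.weaken 3) (nil.pair nil)).Computes (fun a => !b a) :=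
  (hb.ite ff tt).of_eq fun a => by cases b a <;> rfl

theorem and {b b' : α → Bool} (hb : C.Computes b) (hb' : D.Computes b') :
    (Code.ite C D (nil.weaken 3)).Computes (fun a => b a && b' a) :=
  (hb.ite hb' ff).of_eq fun a => by cases b a <;> rfl

theorem or {b b' : α → Bool} (hb : C.Computes b) (hb' : D.Computes b') :
    (Code.ite C (nil.pair nil) D).Computes (fun a => b a || b' a) :=
  (hb.ite tt hb').of_eq fun a => by cases b a <;> rfl

theorem xor {b b' : α → Bool} (hb : C.Computes b) (hb' : D.Computes b') :
    (Code.ite C (Code.ite D (nil.weaken 3) (nil.pair nil)) D).Computes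
      (fun a => Bool.xor (b a) (b' a)) :=
  (hb.ite hb'.not hb').of_eq fun a => by cases b a <;> simp

theorem foldAt (B : ℕ[X]) {F : γ × (σ × α) → σ} (hF : C.Computes F)
    {c : β → γ} {l : β → List α} {s : β → σ}
    (hc : D.Computes c) (hl : L.Computes l) (hs : S.Computes s)
    (hB : ∀ (c : γ) (l l' : List α) (s : σ), wt (l.foldl (fun s a => F (c, (s, a))) s) ≤
      B.eval (wt c + wt (l ++ l') + wt s)) :
    (C.foldAt B D L S).Computes
      (fun x => (l x).foldl (fun s a => F (c x, (s, a))) (s x)) :=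
  (fold B hF hB).comp (hc.pair (hl.pair hs))

theorem foldAdd (G : ℕ[X]) {F : γ × (σ × α) → σ} (hF : C.Computes F)
    {c : β → γ} {l : β → List α} {s : β → σ}
    (hc : D.Computes c) (hl : L.Computes l) (hs : S.Computes s)
    (hG : ∀ c s a, wt (F (c, (s, a))) ≤ wt s + G.eval (wt c + wt a)) :
    (C.foldAdd G D L S).Computes
      (fun x => (l x).foldl (fun s a => F (c x, (s, a))) (s x)) := by
  refine foldAt _ hF hc hl hs fun c l l' s => ?_
  set n := wt c + wt (l ++ l') + wt s with hn
  have key : ∀ (l₁ : List α) (s : σ), (∀ a ∈ l₁, wt c + wt a ≤ n) →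
      wt (l₁.foldl (fun s a => F (c, (s, a))) s) ≤ wt s + l₁.length * G.eval n := by
    intro l₁
    induction l₁ with
    | nil => simp
    | cons a l₁ ih =>
      intro s h
      have h1 := ih (F (c, (s, a))) fun b hb => h b (by simp [hb])
      have h2 := hG c s a
      have h3 := eval_mono G (h a (by simp))
      simp only [List.foldl_cons, List.length_cons, Nat.add_mul]
      omega
  have h1 := key l s fun a ha => by
    have := wt_le_of_mem (l := l ++ l') (List.mem_append_left _ ha)
    omega
  have h2 : l.length * G.eval n ≤ n * G.eval n := Nat.mul_le_mul_right _ (by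
    have := length_lt_wt (l ++ l')
    rw [List.length_append] at this
    omega)
  simp only [eval_add, eval_mul, eval_X]
  omega

theorem reverse {l : α → List β} (hl : L.Computes l) :
    (Code.reverse L).Computes (fun x => (l x).reverse) :=
  (foldAdd (F := fun x : List Bool × (List β × β) => x.2.2 :: x.2.1) (X + 1)
    (var.snd.snd.cons var.snd.fst) .empty hl .empty fun c s a => by simp; omega).of_eq
      fun x => by simp

theorem mapWith {F : γ × β → δ} (hF : C.Computes F) {c : α → γ} {l : α → List β}
    (hc : D.Computes c) (hl : L.Computes l) :
    (Code.mapWith C D L).Computes (fun x => (l x).map fun b => F (c x, b)) :=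
  (foldAdd (F := fun x : γ × (List δ × β) => F (x.1, x.2.2) :: x.2.1) (C.bd.comp (X + 1) + 1)
    ((hF.comp (var.fst.pair var.snd.snd)).cons var.snd.fst) hc hl .empty fun c s a => by
      obtain ⟨t, -, -, h⟩ := hF (c, a)
      simp at h ⊢
      omega).reverse.of_eq fun x => by simp

theorem append {l m : α → List β} (hl : L.Computes l) (hm : M.Computes m) :
    (Code.append L M).Computes (fun x => l x ++ m x) :=
  (foldAdd (F := fun x : List Bool × (List β × β) => x.2.2 :: x.2.1) (X + 1)
    (var.snd.snd.cons var.snd.fst) .empty hl.reverse hm fun c s a => by simp; omega).of_eq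
      fun x => by simp

theorem foldl_tail {α β : Type*} (l : List α) (m : List β) :
    m.foldl (fun s _ => s.tail) l = l.drop m.length := by
  induction m generalizing l with
  | nil => simp
  | cons a m ih => simp [ih]

theorem wt_tail_le (l : List α) : wt l.tail ≤ wt l := by
  cases l <;> simp
  omega

theorem dropLength {l : α → List β} {m : α → List δ} (hl : L.Computes l) (hm : M.Computes m) :
    (Code.dropLength L M).Computes (fun x => (l x).drop (m x).length) :=
  (foldAdd (F := fun x : List Bool × (List β × δ) => x.2.1.tail) 0
    var.snd.fst.tail .empty hm hl fun c s a => by simpa using wt_tail_le s).of_eq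
      fun x => foldl_tail _ _

theorem lengthLe {l : α → List β} {m : α → List δ} (hl : L.Computes l) (hm : M.Computes m) :
    (Code.lengthLe L M).Computes (fun x => decide ((l x).length ≤ (m x).length)) :=
  (hl.dropLength hm).isCons.not.of_eq fun x => by
    have h := List.length_drop (i := (m x).length) (l := l x)
    generalize (l x).drop (m x).length = k at h
    rw [Bool.eq_iff_iff, decide_eq_true_iff]
    cases k with
    | nil => simp [ExplicitIso.isCons] at h ⊢; omega
    | cons a k => simp [ExplicitIso.isCons] at h ⊢; omega

end Code.Computes

section zipPad

variable {α β : Type*}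

theorem length_zipPad (d : α) (e : β) (l : List α) (m : List β) :
    (zipPad d e l m).length = max l.length m.length := by
  induction l generalizing m with
  | nil => simp [zipPad]
  | cons a l ih => cases m <;> simp [zipPad, ih]

theorem getD_zipPad (d : α) (e : β) (l : List α) (m : List β) (i : ℕ) :
    (zipPad d e l m).getD i (d, e) = (l.getD i d, m.getD i e) := by
  induction l generalizing m i with
  | nil =>
    simp only [zipPad, List.getD_nil]
    exact List.getD_map (f := (d, ·)) (l := m) (d := e)
  | cons a l ih =>
    cases i with
    | zero => cases m <;> simp [zipPad]
    | succ i =>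
      simp only [zipPad, List.getD_cons_succ, ih]
      cases m <;> simp

theorem zipPad_eq_zip (d : α) (e : β) (l : List α) (m : List β) (h : l.length = m.length) :
    zipPad d e l m = l.zip m := by
  induction l generalizing m with
  | nil =>
    obtain rfl : m = [] := List.length_eq_zero_iff.1 h.symm
    rfl
  | cons a l ih =>
    cases m with
    | nil => simp at h
    | cons b m =>
      simp only [zipPad, List.headD_cons, List.tail_cons, List.zip_cons_cons,
        ih m (by simpa using h)]

/-- The list of pairs by means of two loops: one through the first list, and one through those
entries of the second list that are left over. The result is built in the reverse order. -/
theorem zipPad_eq_foldl (d : α) (e : β) (l : List α) (m : List β) (o : List (α × β)) :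
    let r := l.foldl
      (fun (s : List β × List (α × β)) a => (s.1.tail, (a, s.1.headD e) :: s.2)) (m, o)
    (r.1.foldl (fun s b => (d, b) :: s) r.2).reverse = o.reverse ++ zipPad d e l m := by
  induction l generalizing m o with
  | nil => simp [zipPad]
  | cons a l ih =>
    simp only [List.foldl_cons, zipPad]
    rw [ih]
    simp

end zipPad

namespace Code

/-- The program for `ExplicitIso.zipPad`. -/
def zipPad (D E L M : Code) : Code :=
  let R := foldAdd (Code.pair Code.id.snd.fst.fst.snd
    (Code.pair (Code.pair Code.id.snd.snd (Code.headD Code.id.snd.fst.fst Code.id.fst))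
      Code.id.snd.fst.snd)) (X + 2) E L (M.pair nil)
  reverse (foldAdd (Code.pair (Code.pair Code.id.fst Code.id.snd.snd) Code.id.snd.fst) (X + 3) D
    R.fst R.snd)

theorem Computes.zipPad {α β γ : Type*} [Enc α] [Enc β] [Enc γ] {D E L M : Code}
    {d : γ → α} {e : γ → β} {l : γ → List α} {m : γ → List β}
    (hd : D.Computes d) (he : E.Computes e) (hl : L.Computes l) (hm : M.Computes m) :
    (Code.zipPad D E L M).Computes (fun x => ExplicitIso.zipPad (d x) (e x) (l x) (m x)) := by
  have hR := foldAdd (F := fun x : β × ((List β × List (α × β)) × α) =>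
    (x.2.1.1.tail, (x.2.2, x.2.1.1.headD x.1) :: x.2.1.2)) (X + 2)
    (var.snd.fst.fst.tail.pair ((var.snd.snd.pair (var.snd.fst.fst.headD var.fst)).cons
      var.snd.fst.snd)) he hl (hm.pair .empty) (by
        rintro e ⟨m, o⟩ a
        cases m <;> simp <;> omega)
  exact (foldAdd (F := fun x : α × (List (α × β) × β) => (x.1, x.2.2) :: x.2.1) (X + 3)
    ((var.fst.pair var.snd.snd).cons var.snd.fst) hd hR.fst hR.snd
    (fun c s a => by simp; omega)).reverse.of_eq fun x => by
      simpa using zipPad_eq_foldl (d x) (e x) (l x) (m x) []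

end Code

/-! ### Programs for binary numbers and residue classes -/

/-- The number with the given binary digits, most significant digit first. -/
def ofDigits (l : List Bool) : ℕ := l.foldl (fun n b => Nat.bit b n) 0

theorem foldl_bit (l : List Bool) (n : ℕ) :
    l.foldl (fun n b => Nat.bit b n) n = 2 ^ l.length * n + ofDigits l := by
  induction l generalizing n with
  | nil => simp [ofDigits]
  | cons b l ih =>
    simp only [ofDigits, List.foldl_cons, List.length_cons] at *
    rw [ih, ih (Nat.bit b 0), Nat.bit_val, Nat.bit_val]
    ring

theorem ofDigits_cons (b : Bool) (l : List Bool) :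
    ofDigits (b :: l) = 2 ^ l.length * b.toNat + ofDigits l := by
  simp only [ofDigits, List.foldl_cons]
  rw [foldl_bit, Nat.bit_val]
  simp [ofDigits]

theorem ofDigits_lt (l : List Bool) : ofDigits l < 2 ^ l.length := by
  induction l with
  | nil => simp [ofDigits]
  | cons b l ih =>
    rw [ofDigits_cons, List.length_cons, pow_succ]
    cases b <;> simp <;> omega

/-- The value of a list of binary digits, least significant digit first. -/
def bitsVal (l : List Bool) : ℕ := l.foldr Nat.bit 0

theorem bitsVal_bits (n : ℕ) : bitsVal n.bits = n := by
  induction n using Nat.binaryRec' with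
  | zero => simp [bitsVal]
  | bit b n h ih =>
    rw [Nat.bits_append_bit _ _ h]
    exact congrArg (Nat.bit b) ih

theorem bitsVal_cons (b : Bool) (l : List Bool) : bitsVal (b :: l) = b.toNat + 2 * bitsVal l := by
  simp only [bitsVal, List.foldr_cons, Nat.bit_val]
  omega

/-- The pairs of digits of two numbers determine both numbers. -/
theorem sum_zipPad (l m : List Bool) :
    (zipPad false false l m).foldr (fun x n => (x.1.toNat + 2 * n.1, x.2.toNat + 2 * n.2)) (0, 0)
      = (bitsVal l, bitsVal m) := by
  induction l generalizing m with
  | nil =>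
    simp only [zipPad]
    induction m with
    | nil => rfl
    | cons b m ih => simp only [List.map_cons, List.foldr_cons, ih, bitsVal_cons]; simp [bitsVal]
  | cons a l ih =>
    simp only [zipPad, List.foldr_cons, ih, bitsVal_cons]
    cases m <;> simp [bitsVal_cons]
    simp [bitsVal]

/-- One digit of the schoolbook addition; the state consists of the carry and of the digits found
so far, most significant digit first. -/
def addStep (s : Bool × List Bool) (x : Bool × Bool) : Bool × List Bool :=
  ((x.1 && x.2) || (s.1 && (x.1 || x.2)), Bool.xor s.1 (Bool.xor x.1 x.2) :: s.2)

/-- One digit of the schoolbook subtraction; the state consists of the borrow and of the digits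
found so far, most significant digit first. -/
def subStep (s : Bool × List Bool) (x : Bool × Bool) : Bool × List Bool :=
  ((!x.1 && x.2) || (s.1 && (!x.1 || x.2)), Bool.xor s.1 (Bool.xor x.1 x.2) :: s.2)

/-- The sum of `a` and `b`, computed digit by digit; the last carry is the leading digit. -/
def digitAdd (a b : ℕ) : ℕ :=
  let r := (zipPad false false a.bits b.bits).foldl addStep (false, [])
  r.2.foldl (fun n b => Nat.bit b n) (Nat.bit r.1 0)

/-- The borrow and the digits in the subtraction of `b` from `a`. -/
def digitSub (a b : ℕ) : Bool × ℕ :=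
  let r := (zipPad false false a.bits b.bits).foldl subStep (false, [])
  (r.1, ofDigits r.2)

/-- The invariant of the addition: the digits found so far and the carry have the same value as the
sum of the digits that have been read. -/
theorem addStep_inv (zs : List (Bool × Bool)) (s : Bool × List Bool) :
    let v : ℕ × ℕ := zs.foldr (fun x n => (x.1.toNat + 2 * n.1, x.2.toNat + 2 * n.2)) (0, 0)
    let r := zs.foldl addStep s
    ofDigits r.2 + 2 ^ r.2.length * r.1.toNat =
      ofDigits s.2 + 2 ^ s.2.length * (s.1.toNat + v.1 + v.2) := by
  induction zs generalizing s with
  | nil => simp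
  | cons x zs ih =>
    obtain ⟨c, l⟩ := s
    obtain ⟨a, b⟩ := x
    simp only [List.foldl_cons, List.foldr_cons] at ih ⊢
    rw [ih]
    simp only [addStep, ofDigits_cons, List.length_cons, pow_succ]
    cases a <;> cases b <;> cases c <;> simp <;> ring

/-- The invariant of the subtraction: the digits found so far, minus the borrow, have the same value
as the difference of the digits that have been read. -/
theorem subStep_inv (zs : List (Bool × Bool)) (s : Bool × List Bool) :
    let v : ℕ × ℕ := zs.foldr (fun x n => (x.1.toNat + 2 * n.1, x.2.toNat + 2 * n.2)) (0, 0)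
    let r := zs.foldl subStep s
    (ofDigits r.2 : ℤ) - 2 ^ r.2.length * r.1.toNat =
      ofDigits s.2 + 2 ^ s.2.length * (v.1 - v.2 - s.1.toNat) := by
  induction zs generalizing s with
  | nil => simp; ring
  | cons x zs ih =>
    obtain ⟨c, l⟩ := s
    obtain ⟨a, b⟩ := x
    simp only [List.foldl_cons, List.foldr_cons] at ih ⊢
    rw [ih]
    simp only [subStep, ofDigits_cons, List.length_cons, pow_succ]
    cases a <;> cases b <;> cases c <;> simp <;> ring

theorem digitAdd_eq (a b : ℕ) : digitAdd a b = a + b := by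
  have h := addStep_inv (zipPad false false a.bits b.bits) (false, [])
  simp only [sum_zipPad, bitsVal_bits] at h
  have h0 : ofDigits [] = 0 := rfl
  simp only [digitAdd]
  rw [foldl_bit, Nat.bit_val]
  simp [h0] at h ⊢
  omega

/-- The subtraction also compares the two numbers: there is a borrow if and only if `a < b`. -/
theorem digitSub_eq (a b : ℕ) : (b ≤ a → digitSub a b = (false, a - b)) ∧
    (a < b → (digitSub a b).1 = true) := by
  have h := subStep_inv (zipPad false false a.bits b.bits) (false, [])
  simp only [sum_zipPad, bitsVal_bits] at h
  simp only [digitSub]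
  generalize (zipPad false false a.bits b.bits).foldl subStep (false, []) = r at h
  obtain ⟨c, l⟩ := r
  have hl := ofDigits_lt l
  have hl' : (ofDigits l : ℤ) < 2 ^ l.length := by exact_mod_cast hl
  have h0 : ofDigits [] = 0 := rfl
  cases c <;> simp [h0] at h ⊢ <;> omega

namespace Code.Computes

variable {α β : Type*} [Enc α] [Enc β] {C D : Code}

theorem bits {n : α → ℕ} (h : C.Computes n) : (C.weaken 0).Computes (fun x => (n x).bits) :=
  h.congr _ 0 (fun _ => rfl) fun _ => Nat.le_add_right _ _

end Code.Computes

theorem wt_bit_le (b : Bool) (n : ℕ) : wt (Nat.bit b n) ≤ wt n + 4 := by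
  change wt (Nat.bit b n).bits ≤ wt n.bits + 4
  by_cases h : n = 0 → b = true
  · rw [Nat.bits_append_bit _ _ h]
    simp
    omega
  · obtain ⟨rfl, rfl⟩ : n = 0 ∧ b = false := by simpa using h
    simp

/-- A digit is put in front of a number, except that there are no leading zeros: the number zero has
no digits. -/
theorem exists_bit : ∃ C : Code, C.Computes (fun x : Bool × ℕ => Nat.bit x.1 x.2) :=
  ⟨_, (Code.Computes.var.fst.or Code.Computes.var.snd.bits.isCons).ite
    (Code.Computes.var.fst.cons Code.Computes.var.snd.bits) .empty |>.congr _ 0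
      (fun ⟨b, n⟩ => by
        change _ = enc (Nat.bit b n).bits
        congr 1
        by_cases h : n = 0 → b = true
        · rw [Nat.bits_append_bit _ _ h, if_pos]
          by_cases hn : n = 0
          · simp [h hn]
          · cases hb : n.bits with
            | nil => exact absurd (by rw [← bitsVal_bits n, hb]; rfl) hn
            | cons => simp [isCons]
        · obtain ⟨rfl, rfl⟩ : n = 0 ∧ b = false := by simpa using h
          simp [isCons])
      (fun ⟨b, n⟩ => by
        change wt (Nat.bit b n).bits ≤ _
        by_cases h : n = 0 → b = true
        · rw [Nat.bits_append_bit _ _ h, if_pos]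
          · simp
          by_cases hn : n = 0
          · simp [h hn]
          · cases hb : n.bits with
            | nil => exact absurd (by rw [← bitsVal_bits n, hb]; rfl) hn
            | cons => simp [isCons]
        · obtain ⟨rfl, rfl⟩ : n = 0 ∧ b = false := by simpa using h
          simp [isCons])⟩

open Code.Computes in
theorem exists_natAdd : ∃ C : Code, C.Computes (fun x : ℕ × ℕ => x.1 + x.2) := by
  obtain ⟨Cb, hb⟩ := exists_bit
  have hR := foldAdd (F := fun x : Bool × ((Bool × List Bool) × (Bool × Bool)) =>
      addStep x.2.1 x.2.2) 4
    (((var.snd.snd.fst.and var.snd.snd.snd).or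
      (var.snd.fst.fst.and (var.snd.snd.fst.or var.snd.snd.snd))).pair
      ((var.snd.fst.fst.xor (var.snd.snd.fst.xor var.snd.snd.snd)).cons var.snd.fst.snd))
    ff (Code.Computes.zipPad ff ff (var (α := ℕ × ℕ)).fst.bits var.snd.bits)
    (ff.pair (empty (β := Bool))) (fun c s a => by simp [addStep]; omega)
  exact ⟨_, (foldAdd (F := fun x : Bool × (ℕ × Bool) => Nat.bit x.2.2 x.2.1) 4
    (hb.comp (var.snd.snd.pair var.snd.fst)) ff hR.snd (hb.comp (hR.fst.pair natZero))
    (fun c s a => by simpa using wt_bit_le a s)).of_eq fun x => digitAdd_eq x.1 x.2⟩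

open Code.Computes in
theorem exists_digitSub : ∃ C : Code, C.Computes (fun x : ℕ × ℕ => digitSub x.1 x.2) := by
  obtain ⟨Cb, hb⟩ := exists_bit
  have hR := foldAdd (F := fun x : Bool × ((Bool × List Bool) × (Bool × Bool)) =>
      subStep x.2.1 x.2.2) 4
    (((var.snd.snd.fst.not.and var.snd.snd.snd).or
      (var.snd.fst.fst.and (var.snd.snd.fst.not.or var.snd.snd.snd))).pair
      ((var.snd.fst.fst.xor (var.snd.snd.fst.xor var.snd.snd.snd)).cons var.snd.fst.snd))
    ff (Code.Computes.zipPad ff ff (var (α := ℕ × ℕ)).fst.bits var.snd.bits)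
    (ff.pair (empty (β := Bool))) (fun c s a => by simp [subStep]; omega)
  exact ⟨_, hR.fst.pair (foldAdd (F := fun x : Bool × (ℕ × Bool) => Nat.bit x.2.2 x.2.1) 4
    (hb.comp (var.snd.snd.pair var.snd.fst)) ff hR.snd natZero
    (fun c s a => by simpa using wt_bit_le a s))⟩

/-! ### The prime field -/

/-- A one-element type that stands for the number `p` in binary. -/
inductive PrimeTag (p : ℕ) : Type
  | mk

instance (p : ℕ) : Enc (PrimeTag p) where
  enc _ := enc p
  wt _ := wt p
  size_le _ := size_le p

theorem wt_nat (n : ℕ) : wt n = 4 * n.size + 1 := by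
  change wt n.bits = _
  rw [← Nat.size_eq_bits_len]
  induction n.bits with
  | nil => rfl
  | cons b l ih => simp only [wt_cons, wt_bool, List.length_cons, ih]; omega

theorem wt_nat_mono {m n : ℕ} (h : m ≤ n) : wt m ≤ wt n := by
  rw [wt_nat, wt_nat]
  have := Nat.size_le_size h
  omega

/-- A residue class is stored as its least residue; all residue classes have the weight of `p`. -/
instance (p : ℕ) [NeZero p] : Enc (ZMod p) where
  enc x := enc x.val
  wt _ := wt p
  size_le x := (size_le x.val).trans (wt_nat_mono x.val_le)

@[simp] theorem wt_primeTag {p : ℕ} (x : PrimeTag p) : wt x = wt p := rfl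

theorem val_eq_of {p : ℕ} {a : ZMod p} {n : ℕ} (h : (n : ZMod p) = a) (hn : n < p) : a.val = n := by
  rw [← h, ZMod.val_cast_of_lt hn]

section ZMod

variable {p : ℕ} [NeZero p]

@[simp] theorem wt_zmod (x : ZMod p) : wt x = wt p := rfl

theorem Code.Computes.val {α : Type*} [Enc α] {C : Code} {f : α → ZMod p} (h : C.Computes f) :
    (C.weaken 0).Computes (fun a => (f a).val) :=
  h.congr _ 0 (fun _ => rfl) fun a => (wt_nat_mono (f a).val_le).trans (Nat.le_add_right _ _)

/-- The tag contains the modulus, which a program may thus use. -/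
theorem Code.Computes.prime {p : ℕ} {α : Type*} [Enc α] {C : Code} {f : α → PrimeTag p}
    (h : C.Computes f) : (C.weaken 0).Computes (fun _ : α => p) :=
  h.congr _ 0 (fun _ => rfl) fun _ => Nat.le_add_right _ _

/-- A program that finds the least residue `g a` of `f a` computes `f`, provided that the modulus
occurs in its input. -/
theorem Code.Computes.zmod {α : Type*} [Enc α] {C : Code} {g : α → ℕ} (h : C.Computes g)
    {f : α → ZMod p} (hf : ∀ a, (f a).val = g a) (hp : ∀ a : α, wt p ≤ wt a) :
    (C.weaken X).Computes f :=
  h.congr _ X (fun a => by rw [← hf]; rfl) fun a => by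
    have := hp a
    simp
    omega

theorem Code.Computes.zmodZero {α : Type*} [Enc α] (hp : ∀ a : α, wt p ≤ wt a) :
    (Code.nil.weaken X).Computes (fun _ : α => (0 : ZMod p)) :=
  natZero.zmod (fun _ => ZMod.val_zero) hp

end ZMod

open Code.Computes in
theorem exists_zmodAdd : ∃ C : Code, ∀ (p : ℕ) [NeZero p],
    C.Computes (fun x : PrimeTag p × (ZMod p × ZMod p) => x.2.1 + x.2.2) := by
  obtain ⟨Ca, ha⟩ := exists_natAdd
  obtain ⟨Cs, hs⟩ := exists_digitSub
  exact ⟨_, fun p _ => by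
    have h1 := ha.comp (var (α := PrimeTag p × (ZMod p × ZMod p)).snd.fst.val.pair var.snd.snd.val)
    have h2 := hs.comp (h1.pair var.fst.prime)
    -- the sum of the residues, diminished by `p` unless there is a borrow
    refine (h2.fst.ite h1 h2.snd).zmod (fun x => ?_) fun x => by simp; omega
    obtain ⟨-, a, b⟩ := x
    have ha := a.val_lt
    have hb := b.val_lt
    rcases le_or_gt p (a.val + b.val) with h | h
    · simp only [(digitSub_eq _ _).1 h, Bool.false_eq_true, if_false]
      refine val_eq_of ?_ (by omega)
      rw [Nat.cast_sub h]
      simp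
    · simp only [(digitSub_eq _ _).2 h, if_true]
      exact val_eq_of (by simp) h⟩

open Code.Computes in
theorem exists_zmodSub : ∃ C : Code, ∀ (p : ℕ) [NeZero p],
    C.Computes (fun x : PrimeTag p × (ZMod p × ZMod p) => x.2.1 - x.2.2) := by
  obtain ⟨Ca, ha⟩ := exists_natAdd
  obtain ⟨Cs, hs⟩ := exists_digitSub
  exact ⟨_, fun p _ => by
    have h0 := hs.comp (var (α := PrimeTag p × (ZMod p × ZMod p)).snd.fst.val.pair var.snd.snd.val)
    have h1 := ha.comp (var (α := PrimeTag p × (ZMod p × ZMod p)).snd.fst.val.pair var.fst.prime)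
    have h2 := hs.comp (h1.pair var.snd.snd.val)
    -- the difference of the residues, where `p` is added first if there is a borrow
    refine (h0.fst.ite h2.snd h0.snd).zmod (fun x => ?_) fun x => by simp; omega
    obtain ⟨-, a, b⟩ := x
    have ha := a.val_lt
    have hb := b.val_lt
    rcases le_or_gt b.val a.val with h | h
    · simp only [(digitSub_eq _ _).1 h, Bool.false_eq_true, if_false]
      refine val_eq_of ?_ (by omega)
      rw [Nat.cast_sub h]
      simp
    · have h' : b.val ≤ a.val + p := by omega
      simp only [(digitSub_eq _ _).2 h, if_true, (digitSub_eq _ _).1 h']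
      refine val_eq_of ?_ (by omega)
      rw [Nat.cast_sub h']
      simp⟩

/-- Multiplication by repeated doubling, from the most significant digit of `n` on. -/
theorem foldl_double {R : Type*} [NonAssocSemiring R] (a : R) (n : ℕ) :
    n.bits.reverse.foldl (fun s b => if b = true then s + s + a else s + s) 0 = n * a := by
  rw [List.foldl_reverse]
  nth_rw 2 [← bitsVal_bits n]
  induction n.bits with
  | nil => simp [bitsVal]
  | cons b l ih =>
    rw [List.foldr_cons, ih, bitsVal_cons]
    cases b
    · simp [two_mul, add_mul]
    · simp [two_mul, add_mul]
      abel

open Code.Computes in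
theorem exists_zmodMul : ∃ C : Code, ∀ (p : ℕ) [NeZero p],
    C.Computes (fun x : PrimeTag p × (ZMod p × ZMod p) => x.2.1 * x.2.2) := by
  obtain ⟨Ca, ha⟩ := exists_zmodAdd
  exact ⟨_, fun p _ => by
    have h1 := (ha p).comp ((var (α := (PrimeTag p × ZMod p) × (ZMod p × Bool))).fst.fst.pair
      (var.snd.fst.pair var.snd.fst))
    have h2 := (ha p).comp (var.fst.fst.pair (h1.pair var.fst.snd))
    exact (foldAdd 0 (var.snd.snd.ite h2 h1)
      (var (α := PrimeTag p × (ZMod p × ZMod p)).fst.pair var.snd.snd) var.snd.fst.val.bits.reverse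
      (zmodZero fun a => by simp; omega) (fun c s a => by simp)).of_eq fun x => by
        rw [foldl_double]
        simp⟩

/-! ### Finite fields -/

/-- A finite field with the data that are used to describe its elements. -/
structure FieldData : Type (v + 1) where
  p : ℕ
  [prime : Fact p.Prime]
  K : Type v
  [field : Field K]
  [algebra : Algebra (ZMod p) K]
  pb : PowerBasis (ZMod p) K

namespace FieldData

attribute [instance] FieldData.prime FieldData.field FieldData.algebra

variable (F : FieldData.{v})

instance : NeZero F.p := ⟨F.prime.out.ne_zero⟩

variable {F} in
/-- The coordinates of a field element. -/
def coords (k : F.K) : List (ZMod F.p) := List.ofFn fun i => F.pb.basis.repr k i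

/-- The coefficients of the polynomial that defines the field. -/
def modulus : List (ZMod F.p) :=
  List.ofFn fun i : Fin (F.pb.dim + 1) => (minpoly (ZMod F.p) F.pb.gen).coeff i

/-- A one-element type that stands for the description of the field. -/
inductive Desc (F : FieldData.{v}) : Type
  | mk

theorem enc_modulus : enc (PrimeTag.mk (p := F.p), F.modulus) = encField F.pb := by
  change Dat.cons _ (Dat.ofList (List.map _ _)) = _
  simp only [modulus, List.map_ofFn]
  rfl

theorem enc_coords (k : F.K) : enc (coords k) = encElem F.pb k := by
  change Dat.ofList (List.map _ _) = _
  simp only [coords, List.map_ofFn]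
  rfl

theorem wt_zmod_list {p : ℕ} [NeZero p] (l : List (ZMod p)) :
    wt l = l.length * (wt p + 1) + 1 := by
  induction l with
  | nil => simp
  | cons a l ih => rw [wt_cons, ih, List.length_cons, wt_zmod]; ring

/-- The weight of the elements of the field. -/
def eltWt : ℕ := F.pb.dim * (wt F.p + 1) + 1

@[simp] theorem length_coords (k : F.K) : (coords k).length = F.pb.dim := by simp [coords]

theorem wt_coords (k : F.K) : wt (coords k) = F.eltWt := by
  rw [wt_zmod_list, length_coords, eltWt]

/-- The field is stored as the tree `encField`. -/
instance : Enc F.Desc where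
  enc _ := encField F.pb
  wt _ := wt (PrimeTag.mk (p := F.p), F.modulus)
  size_le _ := F.enc_modulus ▸ size_le _

/-- A field element is stored as the tree `encElem`; all elements have the same weight. -/
instance : Enc F.K where
  enc k := encElem F.pb k
  wt _ := F.eltWt
  size_le k := F.enc_coords k ▸ F.wt_coords k ▸ size_le _

@[simp] theorem wt_elt (k : F.K) : wt k = F.eltWt := rfl

/-- Programs obtain the description of the field as a part of their input; its weight thus bounds
the weight of the field elements. -/
theorem eltWt_le (d : F.Desc) : F.eltWt + wt F.p ≤ wt d := by
  change _ ≤ wt (PrimeTag.mk (p := F.p), F.modulus)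
  simp only [wt_pair, wt_zmod_list, modulus, List.length_ofFn, eltWt, wt_primeTag]
  nlinarith

variable {F}

/-- The field element with given coordinates. -/
def ev (l : List (ZMod F.p)) : F.K :=
  l.foldr (fun a s => algebraMap (ZMod F.p) F.K a + F.pb.gen * s) 0

theorem ev_nil : ev (F := F) [] = 0 := rfl

theorem ev_cons (a : ZMod F.p) (l : List (ZMod F.p)) :
    ev (a :: l) = algebraMap (ZMod F.p) F.K a + F.pb.gen * ev l := rfl

theorem ev_ofFn {n : ℕ} (f : Fin n → ZMod F.p) :
    ev (List.ofFn f) = ∑ i, algebraMap (ZMod F.p) F.K (f i) * F.pb.gen ^ (i : ℕ) := by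
  induction n with
  | zero => simp [ev_nil]
  | succ n ih =>
    rw [List.ofFn_succ, ev_cons, ih, Fin.sum_univ_succ, Finset.mul_sum]
    simp only [Fin.val_zero, pow_zero, mul_one, Fin.val_succ]
    congr 1
    exact Finset.sum_congr rfl fun i _ => by ring

theorem ev_coords (k : F.K) : ev (coords k) = k := by
  rw [coords, ev_ofFn]
  conv_rhs => rw [← F.pb.basis.sum_repr k]
  exact Finset.sum_congr rfl fun i _ => by rw [F.pb.basis_eq_pow, Algebra.smul_def]

/-- The coordinates are determined by their number and by the value of the element. -/
theorem coords_eq {k : F.K} {l : List (ZMod F.p)} (hl : l.length = F.pb.dim) (h : ev l = k) :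
    coords k = l := by
  obtain ⟨f, rfl⟩ : ∃ f : Fin F.pb.dim → ZMod F.p, l = List.ofFn f :=
    ⟨fun i => l.get (i.cast hl.symm), by
      apply List.ext_get <;> simp [hl]⟩
  subst h
  rw [ev_ofFn, coords]
  congr 1
  funext i
  have : ∑ i, algebraMap (ZMod F.p) F.K (f i) * F.pb.gen ^ (i : ℕ) = ∑ i, f i • F.pb.basis i :=
    Finset.sum_congr rfl fun i _ => by rw [F.pb.basis_eq_pow, Algebra.smul_def]
  rw [this, F.pb.basis.repr_sum_self]

theorem ev_append_zero (l : List (ZMod F.p)) : ev (l ++ [0]) = ev l := by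
  induction l with
  | nil => simp [ev_cons, ev_nil]
  | cons a l ih => rw [List.cons_append, ev_cons, ev_cons, ih]

/-- Combinations of two elements may be computed coordinate by coordinate. -/
theorem ev_map_zipPad (u t : ZMod F.p) (f : ZMod F.p × ZMod F.p → ZMod F.p)
    (hf : ∀ x, f x = u * x.1 + t * x.2) (l m : List (ZMod F.p)) :
    ev ((zipPad 0 0 l m).map f) =
      algebraMap (ZMod F.p) F.K u * ev l + algebraMap (ZMod F.p) F.K t * ev m := by
  induction l generalizing m with
  | nil =>
    induction m with
    | nil => simp [zipPad, ev_nil]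
    | cons b m ih =>
      simp only [zipPad, List.map_cons, ev_cons, ev_nil, hf, map_add, map_mul, map_zero] at ih ⊢
      rw [ih]
      ring
  | cons a l ih =>
    cases m with
    | nil =>
      simp only [zipPad, List.map_cons, ev_cons, ev_nil, hf, map_add, map_mul, ih]
      simp [ev_nil]
      ring
    | cons b m =>
      simp only [zipPad, List.map_cons, ev_cons, hf, map_add, map_mul, ih]
      simp
      ring

theorem ev_map_mul (u : ZMod F.p) (l : List (ZMod F.p)) :
    ev (l.map (u * ·)) = algebraMap (ZMod F.p) F.K u * ev l := by
  induction l with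
  | nil => simp [ev_nil]
  | cons a l ih =>
    rw [List.map_cons, ev_cons, ev_cons, ih, map_mul]
    ring

theorem ev_modulus : ev F.modulus = 0 := by
  rw [modulus, ev_ofFn, Fin.sum_univ_eq_sum_range
    (fun i => algebraMap (ZMod F.p) F.K ((minpoly (ZMod F.p) F.pb.gen).coeff i) * F.pb.gen ^ i)]
  have := minpoly.aeval (ZMod F.p) F.pb.gen
  rw [aeval_eq_sum_range, F.pb.natDegree_minpoly] at this
  simpa [Algebra.smul_def] using this

theorem dim_pos : 0 < F.pb.dim := F.pb.dim_pos

theorem modulus_getD : F.modulus.getD F.pb.dim 0 = 1 := by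
  have := (minpoly.monic F.pb.isIntegral_gen).coeff_natDegree
  rw [F.pb.natDegree_minpoly] at this
  rw [modulus, List.getD_eq_getElem _ _ (by simp), List.getElem_ofFn]
  exact this

theorem length_modulus : F.modulus.length = F.pb.dim + 1 := by simp [modulus]

/-- Multiplication by the generator: the coordinates are shifted, and that multiple of the minimal
polynomial is subtracted which makes the coefficient in degree `dim` vanish; this coefficient is
then removed. -/
theorem coords_gen_mul (k : F.K) :
    coords (F.pb.gen * k) = (((zipPad 0 0 (0 :: coords k) F.modulus).map
      fun x => x.1 - (coords k).reverse.headD 0 * x.2).reverse.tail).reverse := by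
  set c := (coords k).reverse.headD 0 with hc
  set t := (zipPad 0 0 (0 :: coords k) F.modulus).map fun x => x.1 - c * x.2 with ht
  have hlen : t.length = F.pb.dim + 1 := by
    simp [ht, length_zipPad, length_modulus]
  have hev : ev t = F.pb.gen * k := by
    rw [ht, ev_map_zipPad 1 (-c) _ (fun x => by ring), ev_cons, ev_coords, ev_modulus]
    simp
  have hlast : t.getD F.pb.dim 0 = 0 := by
    have h1 := List.getD_map (l := zipPad 0 0 (0 :: coords k) F.modulus) (n := F.pb.dim)
      (d := ((0 : ZMod F.p), (0 : ZMod F.p))) (f := fun x => x.1 - c * x.2)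
    simp only [getD_zipPad, modulus_getD, mul_zero, sub_zero, mul_one] at h1
    rw [ht, h1, sub_eq_zero, hc]
    have hl := length_coords F k
    have := dim_pos (F := F)
    rcases List.eq_nil_or_concat (coords k) with h | ⟨l, a, h⟩
    · rw [h] at hl
      simp at hl
      omega
    · rw [h] at hl ⊢
      rw [← hl]
      simp
  rcases List.eq_nil_or_concat t with h | ⟨l, a, h⟩
  · simp [h] at hlen
  · rw [h] at hlast hlen hev ⊢
    have hl : l.length = F.pb.dim := by simpa using hlen
    rw [← hl] at hlast
    obtain rfl : a = 0 := by simpa using hlast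
    rw [List.concat_eq_append, ev_append_zero] at hev
    rw [coords_eq hl hev]
    simp

/-- Multiplication by the rule of Horner. -/
theorem mul_eq_foldl (x y : F.K) : (coords y).reverse.foldl
    (fun s b => F.pb.gen * s + algebraMap (ZMod F.p) F.K b * x) 0 = x * y := by
  rw [List.foldl_reverse]
  conv_rhs => rw [← ev_coords y]
  induction coords y with
  | nil => simp [ev_nil]
  | cons b l ih => rw [List.foldr_cons, ih, ev_cons]; ring

theorem ev_eq_zero {l : List (ZMod F.p)} (h : ∀ a ∈ l, a = 0) : ev l = 0 := by
  induction l with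
  | nil => rfl
  | cons a l ih => rw [ev_cons, ih fun b hb => h b (by simp [hb]), h a (by simp)]; simp

theorem coords_eq_zero_iff (k : F.K) : (∀ a ∈ coords k, a = 0) ↔ k = 0 := by
  constructor
  · intro h
    rw [← ev_coords k, ev_eq_zero h]
  · rintro rfl a ha
    simp [coords] at ha
    exact ha.2

end FieldData

/-! ### Programs for finite fields -/

section

variable {F : FieldData.{v}} {α : Type*} [Enc α] {C : Code}

open FieldData

theorem Code.Computes.fieldDesc {f : α → F.Desc} (h : C.Computes f) :
    (C.weaken 0).Computes (fun _ : α => (PrimeTag.mk (p := F.p), F.modulus)) :=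
  h.congr _ 0 (fun _ => (F.enc_modulus).symm) fun _ => Nat.le_add_right _ _

theorem Code.Computes.coords {f : α → F.K} (h : C.Computes f) :
    (C.weaken 0).Computes (fun a => FieldData.coords (f a)) :=
  h.congr _ 0 (fun a => (F.enc_coords _).symm) fun a => by simp [F.wt_coords]

/-- A program that finds the coordinates of `f a` computes `f`. -/
theorem Code.Computes.elt {g : α → List (ZMod F.p)} (h : C.Computes g) {f : α → F.K}
    (hl : ∀ a, (g a).length = F.pb.dim) (hf : ∀ a, FieldData.ev (g a) = f a) :
    (C.weaken 0).Computes f :=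
  h.congr _ 0 (fun a => by rw [← coords_eq (hl a) (hf a), F.enc_coords]; rfl) fun a => by
    rw [← coords_eq (hl a) (hf a), F.wt_coords]
    simp

open Code.Computes in
theorem exists_eltZero : ∃ C : Code, ∀ F : FieldData.{v},
    C.Computes (fun _ : F.Desc => (0 : F.K)) :=
  ⟨_, fun F => (mapWith (F := fun _ : Bool × ZMod F.p => (0 : ZMod F.p)) (c := fun _ => false)
    (Code.Computes.bits (n := fun _ => 0) natZero |>.congr _ X (fun a => by
      change _ = enc ((0 : ZMod F.p).val)
      rw [ZMod.val_zero]; rfl) fun a => by simp; omega)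
      ff var.fieldDesc.snd.tail).elt
      (fun _ => by simp [length_modulus])
      fun _ => by
        induction F.modulus.tail with
        | nil => rfl
        | cons a l ih => rw [List.map_cons, ev_cons, ih]; simp⟩

open Code.Computes in
theorem exists_eltOne : ∃ C : Code, ∀ F : FieldData.{v},
    C.Computes (fun _ : F.Desc => (1 : F.K)) := by
  obtain ⟨Cb, hb⟩ := exists_bit
  obtain ⟨C0, h0⟩ := exists_eltZero.{v}
  exact ⟨_, fun F => (((hb.comp (tt.pair natZero)).zmod (p := F.p) (f := fun _ => 1)
    (fun _ => by
      have : Fact (1 < F.p) := ⟨F.prime.out.one_lt⟩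
      rw [ZMod.val_one]; rfl)
    fun a => by have := F.eltWt_le a; omega).cons (h0 F).coords.tail).elt
      (fun _ => by have := dim_pos (F := F); simp; omega)
      fun _ => by
        have h : ∀ a ∈ coords (0 : F.K), a = 0 := (coords_eq_zero_iff 0).2 rfl
        have h' : ev (coords (0 : F.K)).tail = 0 :=
          ev_eq_zero fun a ha => h a (List.mem_of_mem_tail ha)
        rw [ev_cons, h']
        simp⟩

open Code.Computes in
theorem exists_eltAdd : ∃ C : Code, ∀ F : FieldData.{v},
    C.Computes (fun x : F.Desc × (F.K × F.K) => x.2.1 + x.2.2) := by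
  obtain ⟨Ca, ha⟩ := exists_zmodAdd
  exact ⟨_, fun F => (mapWith (ha F.p) var.fst.fieldDesc.fst
    (Code.Computes.zipPad (zmodZero fun a => by have := F.eltWt_le a.1; simp; omega)
      (zmodZero fun a => by have := F.eltWt_le a.1; simp; omega)
      var.snd.fst.coords var.snd.snd.coords)).elt
      (fun x => by simp [length_zipPad])
      fun x => by
        rw [ev_map_zipPad 1 1 _ (fun x => by ring), ev_coords, ev_coords]
        simp⟩

open Code.Computes in
theorem exists_eltSub : ∃ C : Code, ∀ F : FieldData.{v},
    C.Computes (fun x : F.Desc × (F.K × F.K) => x.2.1 - x.2.2) := by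
  obtain ⟨Ca, ha⟩ := exists_zmodSub
  exact ⟨_, fun F => (mapWith (ha F.p) var.fst.fieldDesc.fst
    (Code.Computes.zipPad (zmodZero fun a => by have := F.eltWt_le a.1; simp; omega)
      (zmodZero fun a => by have := F.eltWt_le a.1; simp; omega)
      var.snd.fst.coords var.snd.snd.coords)).elt
      (fun x => by simp [length_zipPad])
      fun x => by
        rw [ev_map_zipPad 1 (-1) _ (fun x => by ring), ev_coords, ev_coords]
        simp
        ring⟩

open Code.Computes in
theorem exists_eltGenMul : ∃ C : Code, ∀ F : FieldData.{v},
    C.Computes (fun x : F.Desc × F.K => F.pb.gen * x.2) := by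
  obtain ⟨Cs, hs⟩ := exists_zmodSub
  obtain ⟨Cm, hm⟩ := exists_zmodMul
  exact ⟨_, fun F => by
    have hF := (hs F.p).comp ((var
      (α := (PrimeTag F.p × ZMod F.p) × (ZMod F.p × ZMod F.p))).fst.fst.pair
      (var.snd.fst.pair ((hm F.p).comp (var.fst.fst.pair (var.fst.snd.pair var.snd.snd)))))
    refine ((mapWith hF (var.fst.fieldDesc.fst.pair (var.snd.coords.reverse.headD
      (zmodZero fun a => by have := F.eltWt_le a.1; simp; omega)))
      (Code.Computes.zipPad (zmodZero fun a => by have := F.eltWt_le a.1; simp; omega)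
      (zmodZero fun a => by have := F.eltWt_le a.1; simp; omega)
      ((zmodZero fun a => by have := F.eltWt_le a.1; simp; omega).cons var.snd.coords)
        var.fst.fieldDesc.snd)).reverse.tail.reverse).elt (fun x => ?_) fun x => ?_
    · rw [← coords_gen_mul, length_coords]
    · rw [← coords_gen_mul, ev_coords]⟩

open Code.Computes in
theorem exists_eltSMul : ∃ C : Code, ∀ F : FieldData.{v},
    C.Computes (fun x : F.Desc × (ZMod F.p × F.K) => algebraMap (ZMod F.p) F.K x.2.1 * x.2.2) := by
  obtain ⟨Cm, hm⟩ := exists_zmodMul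
  exact ⟨_, fun F => (mapWith (hm F.p |>.comp (var.fst.fst.pair (var.fst.snd.pair var.snd)))
        (var.fst.fieldDesc.fst.pair var.snd.fst) var.snd.snd.coords).elt (fun x => by simp)
        fun x => by rw [ev_map_mul, ev_coords]⟩

open Code.Computes in
theorem exists_eltMul : ∃ C : Code, ∀ F : FieldData.{v},
    C.Computes (fun x : F.Desc × (F.K × F.K) => x.2.1 * x.2.2) := by
  obtain ⟨Cs, hs⟩ := exists_eltGenMul.{v}
  obtain ⟨Ca, ha⟩ := exists_eltAdd.{v}
  obtain ⟨Cm, hm⟩ := exists_eltSMul.{v}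
  obtain ⟨C0, h0⟩ := exists_eltZero.{v}
  exact ⟨_, fun F => by
    have h1 := (hm F).comp (var (α := (F.Desc × F.K) × (F.K × ZMod F.p)).fst.fst.pair
      (var.snd.snd.pair var.fst.snd))
    have h2 := (hs F).comp (var (α := (F.Desc × F.K) × (F.K × ZMod F.p)).fst.fst.pair var.snd.fst)
    have h3 := (ha F).comp (var.fst.fst.pair (h2.pair h1))
    have h4 := foldAdd 0 h3 (var (α := F.Desc × (F.K × F.K)).fst.pair var.snd.fst)
      var.snd.snd.coords.reverse ((h0 F).comp var.fst) (fun c s a => by simp)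
    exact h4.of_eq fun x => mul_eq_foldl _ _⟩

open scoped Classical in
open Code.Computes in
theorem exists_eltIsZero : ∃ C : Code, ∀ F : FieldData.{v},
    C.Computes (fun x : F.K => decide (x = 0)) :=
  ⟨_, fun F => (foldAdd (F := fun x : Bool × (Bool × ZMod F.p) => x.2.1 && !isCons x.2.2.val.bits) 0
    (var.snd.fst.and var.snd.snd.val.bits.isCons.not) ff var.coords tt
    (fun c s a => by simp)).of_eq fun x => by
      have key : ∀ (l : List (ZMod F.p)) (b : Bool),
          l.foldl (fun s a => s && !isCons a.val.bits) b =
            (b && l.all fun a => decide (a = 0)) := by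
        intro l
        induction l with
        | nil => simp
        | cons a l ih =>
          intro b
          rw [List.foldl_cons, ih, List.all_cons, Bool.and_assoc]
          congr 2
          by_cases h : a = 0
          · simp [h, isCons]
          · cases hb : a.val.bits with
            | nil =>
              have : a.val = 0 := by rw [← bitsVal_bits a.val, hb]; rfl
              exact absurd ((ZMod.val_eq_zero a).1 this) h
            | cons => simp [isCons, h]
      rw [key, Bool.true_and, Bool.eq_iff_iff, List.all_eq_true, decide_eq_true_iff,
        ← coords_eq_zero_iff]
      simp⟩

end

/-! ### The algorithm -/

section Algorithm

open scoped Classical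

variable {K : Type*} [Field K]

/-- Difference of polynomials, given by their coefficients, constant term first. -/
def polySub (f g : List K) : List K := (zipPad 0 0 f g).map fun x => x.1 - x.2

/-- The combination `a * f - b * g`. -/
def polyComb (a : K) (f : List K) (b : K) (g : List K) : List K :=
  polySub (f.map (a * ·)) (g.map (b * ·))

/-- The product of two polynomials. The loop computes its negative, so that subtraction is the only
operation on two polynomials that is needed. -/
def polyMul (f g : List K) : List K :=
  polySub [] (f.reverse.foldl (fun s a => polySub (0 :: s) (g.map (a * ·))) [])

/-- The combination `a * u - b * v` of two vectors of polynomials. -/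
def vecComb (a : K) (u : List (List K)) (b : K) (v : List (List K)) : List (List K) :=
  (zipPad [] [] u v).map fun x => polyComb a x.1 b x.2

/-- The product of a polynomial with a vector of polynomials. -/
def vecScale (g : List K) (v : List (List K)) : List (List K) := v.map (polyMul g ·)

/-- Removal of the zeros at the beginning of a list. -/
def trim (l : List K) : List K :=
  l.foldl (fun s _ => if s.headD 0 = 0 then s.tail else s) l

/-- One step in bringing the fractions `v / g`, with vectors `v` of polynomials, to a common
denominator: the state consists of the numerators and of the common denominator. -/
def commonStep (s : List (List (List K)) × List K) (x : List (List K) × List K) :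
    List (List (List K)) × List K :=
  (s.1.map (vecScale x.2 ·) ++ [vecScale s.2 x.1], polyMul s.2 x.2)

/-- The fractions `v / g` in the list `l`, with vectors `v` of polynomials, over a common
denominator: the list of the numerators, and the denominator, which is the product of all `g`. -/
def common (l : List (List (List K) × List K)) : List (List (List K)) × List K :=
  l.foldl commonStep ([], [1])

/-- The coefficients of all entries of a vector of polynomials in one list: coefficients of higher
powers come first, and among those of the same power the ones of later entries. The number of
powers is the length of `fuel`. -/
def interleave (fuel : List K) (v : List (List K)) : List K :=
  (fuel.foldl (fun (s : List (List K) × List K) _ =>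
    (s.1.map List.tail, (s.1.map (List.headD · 0)).reverse ++ s.2)) (v, [])).2

/-- The image of a vector of `m` polynomials: the polynomial `∑ r, z ^ r * v r (z ^ m)` in a
variable `z`, given by its coefficients, leading coefficient first. -/
def image (v : List (List K)) : List K := trim (interleave v.flatten v)

/-- Multiplication of an image by `z ^ m`, where `zs` consists of `m` zeros, and of the
accompanying vector of polynomials by `x`. -/
def shift (zs : List K) (e : List K × List (List K)) : List K × List (List K) :=
  (e.1 ++ zs, e.2.map (0 :: ·))

/-- Multiplication of `e` by the power of `x` that makes its image at least as long as that
of `z`. -/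
def align (zs : List K) (z e : List K × List (List K)) : List K × List (List K) :=
  z.1.foldl (fun e _ => if z.1.length ≤ e.1.length then e else shift zs e) e

/-- Cancellation of the leading coefficient of `z` by `e`, where both images have the same
length. -/
def cancel (z e : List K × List (List K)) : List K × List (List K) :=
  (trim (polyComb (e.1.headD 0) z.1 (z.1.headD 0) e.1),
    vecComb (e.1.headD 0) z.2 (z.1.headD 0) e.2)

/-- Comparison of the new vector `s.1` with a vector `e` that was found before: if the lengths of
their images are congruent modulo `m`, the longer one is reduced by the shorter one, and the shorter
one is kept. -/
def passStep (zs : List K) (s : (List K × List (List K)) × List (List K × List (List K)))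
    (e : List K × List (List K)) :
    (List K × List (List K)) × List (List K × List (List K)) :=
  let big := if e.1.length ≤ s.1.1.length then s.1 else e
  let small := if e.1.length ≤ s.1.1.length then e else s.1
  let sm := align zs big small
  if (isCons small.1 && (decide (big.1.length ≤ sm.1.length) &&
      decide (sm.1.length ≤ big.1.length))) = true
  then (cancel big sm, small :: s.2) else (s.1, e :: s.2)

/-- The new vector `s.1` passes through the list `s.2`. The result contains that list in the reverse
order, up to the reductions. -/
def pass (zs : List K) (s : (List K × List (List K)) × List (List K × List (List K))) :
    (List K × List (List K)) × List (List K × List (List K)) :=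
  s.2.foldl (passStep zs) (s.1, [])

/-- The new vector `z` passes through the list `E` as often as the length of `fuel` says, and is
then added to the list. Once a pass
has changed nothing but the order of the list, no later one does. -/
def insertVec (zs fuel : List K) (E : List (List K × List (List K)))
    (z : List K × List (List K)) : List (List K × List (List K)) :=
  let r := fuel.foldl (fun s _ => pass zs s) (z, E)
  r.1 :: r.2

/-- Lattice reduction: the lengths of the nonzero images in the result are incongruent
modulo `m`. Every pass that changes something diminishes the total length of the images, so that
this total length is a sufficient number of passes. -/
def reduceList (zs : List K) (L : List (List K × List (List K))) : List (List K × List (List K)) :=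
  L.foldl (insertVec zs (L.map Prod.fst).flatten) []

/-- The unit vectors whose length is that of the given list. -/
def unitVecs {α : Type*} (l : List α) : List (List (List K)) :=
  (l.foldl (fun (s : List (List K) × List (List (List K))) _ =>
    ([] :: s.1, ([1] :: s.1) :: s.2.map ([] :: ·))) ([], [])).2

/-- A nontrivial relation between the columns of `U` and the vector `b`: its coefficients at the
columns of `U` and its coefficient at `b`. -/
def solve (zs : List K) (U : List (List (List K))) (b : List (List K)) : List (List K) × List K :=
  let R := reduceList zs (zipPad [] [] ((b :: U).map image) (unitVecs (b :: U)))
  -- the vector that accompanies an image that vanishes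
  let t := R.foldl (fun s e => if isCons e.1 = true then s else e.2) []
  (t.tail, t.headD [])

/-- The products of `e` with those powers of `x` for which the length of the image does not exceed
that of the list `l`. -/
def powers (zs l : List K) (e : List K × List (List K)) : List (List (List K)) :=
  (l.foldl (fun (s : (List K × List (List K)) × List (List (List K))) _ =>
    if s.1.1.length ≤ l.length then (shift zs s.1, s.1.2 :: s.2) else s) (e, [])).2

/-- A vector of fractions over a common denominator: the numerators and the denominator. -/
def colCommon (c : List (List K × List K)) : List (List K) × List K :=
  let r := common (c.map fun x => ([x.1], x.2))
  (r.1.map (List.headD · []), r.2)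

/-- A matrix of fractions, given by its columns, over a common denominator. -/
def matCommon (M : List (List (List K × List K))) : List (List (List K)) × List K :=
  common (M.map colCommon)

/-- From two matrices of polynomials, given by their columns, the vectors of polynomials that span
the intersection of the two lattices. -/
def mainPoly (B U : List (List (List K))) : List (List (List K)) :=
  let zs := U.map fun _ => 0
  let r := common (B.map (solve zs U))
  let R := reduceList zs (zipPad [] [] (r.1.map image) B)
  -- a vector has degree at most that of the denominator `r.2` if and only if the length of its
  -- image is at most `m` times the length of the trimmed denominator
  (R.map (powers zs (r.1.map fun _ => trim r.2.reverse).flatten)).flatten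

/-- From two matrices of fractions, given by their columns, the vectors of fractions that form a
basis of the intersection of the two lattices. Both matrices are brought to the same denominator,
which does not affect the coordinates of the columns of one with respect to those of the other. -/
def mainAlg (b u : List (List (List K × List K))) : List (List (List K × List K)) :=
  let B := matCommon b
  let U := matCommon u
  (mainPoly (B.1.map (vecScale U.2)) (U.1.map (vecScale B.2))).map
    (List.map fun f => (f, polyMul B.2 U.2))

end Algorithm

/-! ### Running time of the algorithm -/

namespace Code.Computes

variable {α β γ σ : Type*} [Enc α] [Enc β] [Enc γ] [Enc σ] {C D L S : Code}

/-- A loop, whose states are bounded by means of a predicate `I N c i s`: here `c` is the parameter,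
`i` the number of rounds, `s` the state, and `N` the weight of the input. -/
theorem foldInv (B : ℕ[X]) {F : γ × (σ × α) → σ} (hF : C.Computes F)
    {c : β → γ} {l : β → List α} {s : β → σ}
    (hc : D.Computes c) (hl : L.Computes l) (hs : S.Computes s) (I : ℕ → γ → ℕ → σ → Prop)
    (h0 : ∀ N c s, wt c + wt s < N → I N c 0 s)
    (hI : ∀ N c i s a, wt c + wt a < N → i < N → I N c i s → I N c (i + 1) (F (c, (s, a))))
    (hB : ∀ N c i s, wt c < N → i < N → I N c i s → wt s ≤ B.eval N) :
    (C.foldAt B D L S).Computes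
      (fun x => (l x).foldl (fun s a => F (c x, (s, a))) (s x)) := by
  refine foldAt _ hF hc hl hs fun c l l' s => ?_
  set N := wt c + wt (l ++ l') + wt s with hN
  have hlen := length_lt_wt (l ++ l')
  have hs := wt_pos s
  have hl := wt_pos (l ++ l')
  rw [List.length_append] at hlen
  have key : ∀ (l₁ : List α) (i : ℕ) (s : σ), i + l₁.length < N → (∀ a ∈ l₁, wt c + wt a < N) →
      I N c i s → I N c (i + l₁.length) (l₁.foldl (fun s a => F (c, (s, a))) s) := by
    intro l₁
    induction l₁ with
    | nil => intro i s _ _ h; simpa using h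
    | cons a l₁ ih =>
      intro i s hi ha h
      rw [List.length_cons] at hi ⊢
      have := ih (i + 1) (F (c, (s, a))) (by omega) (fun b hb => ha b (by simp [hb]))
        (hI N c i s a (ha a (by simp)) (by omega) h)
      rwa [Nat.add_right_comm] at this
  refine hB N c _ _ (by omega) (by omega) (key l 0 s (by omega) (fun a ha => ?_)
    (h0 N c s (by omega)))
  have := wt_le_of_mem (l := l ++ l') (List.mem_append_left _ ha)
  omega

theorem flatten {l : α → List (List β)} (hl : L.Computes l) :
    (Code.foldAdd (Code.append Code.id.snd.snd Code.id.snd.fst) X (Code.nil.weaken 3) L.reverse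
      Code.nil).Computes (fun x => (l x).flatten) :=
  (foldAdd (F := fun x : Bool × (List β × List β) => x.2.2 ++ x.2.1) X
    (append var.snd.snd var.snd.fst) ff hl.reverse .empty fun c s a => by
      have := wt_append a s
      simp
      omega).of_eq fun x => by
        rw [List.foldl_reverse]
        induction l x with
        | nil => rfl
        | cons a l ih => rw [List.foldr_cons, ih, List.flatten_cons]

end Code.Computes

/-! ### Lengths and weights in the course of the algorithm -/

section Lengths

variable {K : Type*} [Field K]

@[simp] theorem length_polySub (f g : List K) : (polySub f g).length = max f.length g.length := by
  simp [polySub, length_zipPad]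

@[simp] theorem length_polyComb (a : K) (f : List K) (b : K) (g : List K) :
    (polyComb a f b g).length = max f.length g.length := by
  simp [polyComb]

theorem length_polyMul_le (f g : List K) : (polyMul f g).length ≤ f.length + g.length := by
  have key : (f.reverse.foldl (fun s a => polySub (0 :: s) (g.map (a * ·))) []).length ≤
      f.length + g.length := by
    rw [List.foldl_reverse]
    induction f with
    | nil => simp
    | cons a f ih =>
      simp only [List.foldr_cons, length_polySub, List.length_cons, List.length_map]
      omega
  simpa [polyMul] using key

@[simp] theorem length_vecComb (a : K) (u : List (List K)) (b : K) (v : List (List K)) :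
    (vecComb a u b v).length = max u.length v.length := by
  simp [vecComb, length_zipPad]

open scoped Classical in
theorem length_trim_le (l : List K) : (trim l).length ≤ l.length := by
  have key : ∀ m s : List K,
      (m.foldl (fun s _ => if s.headD 0 = 0 then s.tail else s) s).length ≤ s.length := by
    intro m
    induction m with
    | nil => simp
    | cons a m ih =>
      intro s
      refine (ih _).trans ?_
      dsimp only
      split_ifs <;> simp
  exact key l l

end Lengths

section Bounds

variable {K : Type*}

theorem mem_zipPad {α β : Type*} {d : α} {e : β} {l : List α} {m : List β} {x : α × β}
    (h : x ∈ zipPad d e l m) : (x.1 ∈ l ∨ x.1 = d) ∧ (x.2 ∈ m ∨ x.2 = e) := by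
  induction l generalizing m with
  | nil =>
    obtain ⟨b, hb, rfl⟩ := List.mem_map.1 h
    exact ⟨.inr rfl, .inl hb⟩
  | cons a l ih =>
    rcases List.mem_cons.1 h with rfl | h
    · cases m <;> simp
    · obtain ⟨h1, h2⟩ := ih h
      exact ⟨h1.imp_left (List.mem_cons_of_mem _), h2.imp_left List.mem_of_mem_tail⟩

/-- A vector of at most `r` polynomials with at most `ℓ` coefficients. -/
def VecBd (r ℓ : ℕ) (v : List (List K)) : Prop := v.length ≤ r ∧ ∀ f ∈ v, f.length ≤ ℓ

theorem VecBd.mono {r r' ℓ ℓ' : ℕ} {v : List (List K)} (h : VecBd r ℓ v) (hr : r ≤ r')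
    (hl : ℓ ≤ ℓ') : VecBd r' ℓ' v := ⟨h.1.trans hr, fun f hf => (h.2 f hf).trans hl⟩

theorem VecBd.cons {r ℓ : ℕ} {v : List (List K)} (h : VecBd r ℓ v) {f : List K}
    (hf : f.length ≤ ℓ) : VecBd (r + 1) ℓ (f :: v) :=
  ⟨by simpa using h.1, by simpa [hf] using h.2⟩

/-- An image with at most `n` coefficients, together with a vector of at most `r` polynomials with
at most `ℓ` coefficients. -/
def EntryBd (n r ℓ : ℕ) (e : List K × List (List K)) : Prop := e.1.length ≤ n ∧ VecBd r ℓ e.2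

theorem EntryBd.mono {n r ℓ ℓ' : ℕ} {e : List K × List (List K)} (h : EntryBd n r ℓ e)
    (hl : ℓ ≤ ℓ') : EntryBd n r ℓ' e := ⟨h.1, h.2.mono le_rfl hl⟩

/-- The bound of `EntryBd` for a vector and for all entries of a list. -/
def StateBd (n r ℓ : ℕ) (s : (List K × List (List K)) × List (List K × List (List K))) : Prop :=
  EntryBd n r ℓ s.1 ∧ ∀ e ∈ s.2, EntryBd n r ℓ e

theorem StateBd.mono {n r ℓ ℓ' : ℕ}
    {s : (List K × List (List K)) × List (List K × List (List K))} (hs : StateBd n r ℓ s)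
    (h : ℓ ≤ ℓ') : StateBd n r ℓ' s :=
  ⟨hs.1.mono h, fun e he => (hs.2 e he).mono h⟩

variable [Field K]

theorem VecBd.vecScale {r ℓ : ℕ} {v : List (List K)} (h : VecBd r ℓ v) (g : List K) :
    VecBd r (g.length + ℓ) (vecScale g v) := by
  refine ⟨by simpa [ExplicitIso.vecScale] using h.1, fun f hf => ?_⟩
  obtain ⟨f', hf', rfl⟩ := List.mem_map.1 hf
  exact (length_polyMul_le g f').trans (Nat.add_le_add_left (h.2 f' hf') _)

theorem VecBd.shift {r ℓ : ℕ} {v : List (List K)} (h : VecBd r ℓ v) :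
    VecBd r (ℓ + 1) (v.map (0 :: ·)) := by
  refine ⟨by simpa using h.1, fun f hf => ?_⟩
  obtain ⟨f', hf', rfl⟩ := List.mem_map.1 hf
  simpa using h.2 f' hf'

theorem VecBd.vecComb {r ℓ : ℕ} {u v : List (List K)} (hu : VecBd r ℓ u) (hv : VecBd r ℓ v)
    (a b : K) : VecBd r ℓ (vecComb a u b v) := by
  refine ⟨by simpa using ⟨hu.1, hv.1⟩, fun f hf => ?_⟩
  obtain ⟨x, hx, rfl⟩ := List.mem_map.1 hf
  obtain ⟨h1, h2⟩ := mem_zipPad hx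
  rw [length_polyComb, max_le_iff]
  constructor
  · rcases h1 with h1 | h1
    · exact hu.2 _ h1
    · simp [h1]
  · rcases h2 with h2 | h2
    · exact hv.2 _ h2
    · simp [h2]

theorem EntryBd.cancel {n r ℓ : ℕ} {z e : List K × List (List K)} (hz : EntryBd n r ℓ z)
    (he : EntryBd n r ℓ e) : EntryBd n r ℓ (cancel z e) :=
  ⟨(length_trim_le _).trans (by simpa using ⟨hz.1, he.1⟩), hz.2.vecComb he.2 _ _⟩

/-- The alignment takes at most as many shifts as the longer image has coefficients, and each of
them adds one coefficient to the accompanying polynomials. -/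
theorem VecBd.align {n r ℓ : ℕ} (zs : List K) {z e : List K × List (List K)}
    (hz : EntryBd n r ℓ z) (he : VecBd r ℓ e.2) : VecBd r (ℓ + n) (align zs z e).2 := by
  have key : ∀ (l : List K) (e : List K × List (List K)) (ℓ : ℕ), VecBd r ℓ e.2 →
      VecBd r (ℓ + l.length) (l.foldl (fun e _ => if z.1.length ≤ e.1.length then e
        else ExplicitIso.shift zs e) e).2 := by
    intro l
    induction l with
    | nil => intro e ℓ h; exact h
    | cons a l ih =>
      intro e ℓ h
      rw [List.foldl_cons, List.length_cons, add_comm l.length, ← add_assoc]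
      refine ih _ _ ?_
      split_ifs
      · exact h.mono le_rfl (Nat.le_succ _)
      · exact h.shift
  exact (key z.1 e ℓ he).mono le_rfl (Nat.add_le_add_left hz.1 _)

/-- The images do not become longer, and the accompanying polynomials become longer by at most the
length of an image: a reduction requires that the aligned image has the length of the longer one. -/
theorem StateBd.passStep {n r ℓ : ℕ} (zs : List K)
    {s : (List K × List (List K)) × List (List K × List (List K))} (hs : StateBd n r ℓ s)
    {e : List K × List (List K)} (he : EntryBd n r ℓ e) :
    StateBd n r (ℓ + n) (passStep zs s e) := by
  have key : ∀ big small : List K × List (List K), EntryBd n r ℓ big → EntryBd n r ℓ small →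
      StateBd n r (ℓ + n) (if (isCons small.1 &&
        (decide (big.1.length ≤ (align zs big small).1.length) &&
          decide ((align zs big small).1.length ≤ big.1.length))) = true
      then (ExplicitIso.cancel big (align zs big small), small :: s.2) else (s.1, e :: s.2)) := by
    intro big small hb hs'
    split_ifs with h
    · simp only [Bool.and_eq_true, decide_eq_true_eq] at h
      refine ⟨(hb.mono (Nat.le_add_right _ _)).cancel
        ⟨h.2.2.trans hb.1, hs'.2.align zs hb⟩, ?_⟩
      intro x hx
      rcases List.mem_cons.1 hx with rfl | hx
      · exact hs'.mono (Nat.le_add_right _ _)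
      · exact (hs.2 x hx).mono (Nat.le_add_right _ _)
    · refine ⟨hs.1.mono (Nat.le_add_right _ _), ?_⟩
      intro x hx
      rcases List.mem_cons.1 hx with rfl | hx
      · exact he.mono (Nat.le_add_right _ _)
      · exact (hs.2 x hx).mono (Nat.le_add_right _ _)
  unfold ExplicitIso.passStep
  by_cases h : e.1.length ≤ s.1.1.length
  · simp only [h, if_true]
    exact key _ _ hs.1 he
  · simp only [h, if_false]
    exact key _ _ he hs.1

theorem length_passStep (zs : List K)
    (s : (List K × List (List K)) × List (List K × List (List K)))
    (e : List K × List (List K)) : (passStep zs s e).2.length = s.2.length + 1 := by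
  simp only [passStep]
  split_ifs <;> simp

theorem StateBd.pass {n r ℓ : ℕ} (zs : List K)
    {s : (List K × List (List K)) × List (List K × List (List K))} (hs : StateBd n r ℓ s) :
    StateBd n r (ℓ + s.2.length * n) (pass zs s) ∧ (pass zs s).2.length = s.2.length := by
  have key : ∀ (l : List (List K × List (List K)))
      (t : (List K × List (List K)) × List (List K × List (List K))) (ℓ : ℕ),
      StateBd n r ℓ t → (∀ e ∈ l, EntryBd n r ℓ e) →
      StateBd n r (ℓ + l.length * n) (l.foldl (ExplicitIso.passStep zs) t) ∧
        (l.foldl (ExplicitIso.passStep zs) t).2.length = l.length + t.2.length := by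
    intro l
    induction l with
    | nil => intro t ℓ h _; simpa using h
    | cons a l ih =>
      intro t ℓ h hl
      obtain ⟨h1, h2⟩ := ih _ _ (h.passStep zs (hl a (by simp)))
        fun e he => (hl e (by simp [he])).mono (Nat.le_add_right _ _)
      rw [List.foldl_cons, List.length_cons, h2, length_passStep]
      exact ⟨by convert h1 using 1; ring, by ring⟩
  obtain ⟨h1, h2⟩ := key s.2 (s.1, []) ℓ ⟨hs.1, by simp⟩ hs.2
  exact ⟨h1, h2.trans (by simp)⟩

theorem StateBd.iterate_pass {n r ℓ : ℕ} (zs : List K) {γ : Type*} (l : List γ)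
    {s : (List K × List (List K)) × List (List K × List (List K))} (hs : StateBd n r ℓ s) :
    StateBd n r (ℓ + l.length * (s.2.length * n)) (l.foldl (fun s _ => ExplicitIso.pass zs s) s) ∧
      (l.foldl (fun s _ => ExplicitIso.pass zs s) s).2.length = s.2.length := by
  induction l generalizing s ℓ with
  | nil => simpa using hs
  | cons a l ih =>
    obtain ⟨h1, h2⟩ := hs.pass zs
    obtain ⟨h3, h4⟩ := ih h1
    rw [h2] at h3 h4
    rw [List.foldl_cons, List.length_cons]
    exact ⟨by convert h3 using 1; ring, h4⟩

end Bounds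

section Weights

variable {F : FieldData.{v}}

/-- The weight of a polynomial depends on the number of its coefficients only. -/
theorem wt_eltList (l : List F.K) : wt l = l.length * (F.eltWt + 1) + 1 := by
  induction l with
  | nil => simp
  | cons a l ih => rw [wt_cons, ih, List.length_cons, FieldData.wt_elt]; ring

/-- A bound for the weight of `r` polynomials with `ℓ` coefficients of weight `e`. -/
def vecWt {R : Type*} [Semiring R] (e r ℓ : R) : R := r * (ℓ * (e + 1) + 2) + 1

/-- A bound for the weight of an image with `n` coefficients of weight `e` that is accompanied by
`r` polynomials with `ℓ` coefficients. -/
def entryWt {R : Type*} [Semiring R] (e n r ℓ : R) : R := n * (e + 1) + vecWt e r ℓ + 2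

@[simp] theorem eval_vecWt (N : ℕ) (e r ℓ : ℕ[X]) :
    (vecWt e r ℓ).eval N = vecWt (e.eval N) (r.eval N) (ℓ.eval N) := by
  simp [vecWt]

@[simp] theorem eval_entryWt (N : ℕ) (e n r ℓ : ℕ[X]) :
    (entryWt e n r ℓ).eval N = entryWt (e.eval N) (n.eval N) (r.eval N) (ℓ.eval N) := by
  simp [entryWt]

theorem wt_poly_le {f : List F.K} {ℓ e : ℕ} (h : f.length ≤ ℓ) (he : F.eltWt ≤ e) :
    wt f ≤ ℓ * (e + 1) + 1 := by
  rw [wt_eltList]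
  gcongr

theorem wt_vec_le {v : List (List F.K)} {r ℓ e : ℕ} (h : VecBd r ℓ v) (he : F.eltWt ≤ e) :
    wt v ≤ vecWt e r ℓ := by
  refine (wt_le_of_forall fun f hf => wt_poly_le (h.2 f hf) he).trans ?_
  have : v.length * (ℓ * (e + 1) + 1 + 1) ≤ r * (ℓ * (e + 1) + 2) := Nat.mul_le_mul_right _ h.1
  rw [vecWt]
  omega

theorem wt_list_le {α : Type*} [Enc α] {l : List α} {k B : ℕ} (hl : l.length ≤ k)
    (h : ∀ a ∈ l, wt a ≤ B) : wt l ≤ k * (B + 1) + 1 := by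
  refine (wt_le_of_forall h).trans ?_
  gcongr

theorem wt_entry_le {x : List F.K × List (List F.K)} {n r ℓ e : ℕ} (h : EntryBd n r ℓ x)
    (he : F.eltWt ≤ e) : wt x ≤ entryWt e n r ℓ := by
  have h1 := wt_poly_le h.1 he
  have h2 := wt_vec_le h.2 he
  simp only [wt_pair, entryWt]
  omega

theorem length_lt_of_wt {α : Type*} [Enc α] {l : List α} {N : ℕ} (h : wt l < N) : l.length < N :=
  (length_lt_wt l).trans h

theorem vecBd_of_wt {v : List (List F.K)} {N : ℕ} (h : wt v ≤ N) : VecBd N N v :=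
  ⟨(length_lt_wt v).le.trans h, fun f hf =>
    (length_lt_wt f).le.trans ((wt_le_of_mem hf).le.trans h)⟩

theorem entryBd_of_wt {x : List F.K × List (List F.K)} {N : ℕ} (h : wt x ≤ N) :
    EntryBd N N N x := by
  rw [wt_pair] at h
  exact ⟨(length_lt_wt x.1).le.trans (by omega), vecBd_of_wt (by omega)⟩

end Weights

/-! ### Programs for polynomials and vectors of polynomials -/

section

open scoped Classical
open Code.Computes

theorem exists_polySub : ∃ C : Code, ∀ F : FieldData.{v},
    C.Computes (fun x : F.Desc × (List F.K × List F.K) => polySub x.2.1 x.2.2) := by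
  obtain ⟨C0, h0⟩ := exists_eltZero.{v}
  obtain ⟨Cs, hs⟩ := exists_eltSub.{v}
  exact ⟨_, fun F => mapWith (hs F) var.fst (Code.Computes.zipPad ((h0 F).comp var.fst)
    ((h0 F).comp var.fst) var.snd.fst var.snd.snd)⟩

theorem exists_polyScale : ∃ C : Code, ∀ F : FieldData.{v},
    C.Computes (fun x : F.Desc × (F.K × List F.K) => x.2.2.map (x.2.1 * ·)) := by
  obtain ⟨Cm, hm⟩ := exists_eltMul.{v}
  exact ⟨_, fun F => mapWith ((hm F).comp (var.fst.fst.pair (var.fst.snd.pair var.snd)))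
    (var.fst.pair var.snd.fst) var.snd.snd⟩

theorem exists_polyComb : ∃ C : Code, ∀ F : FieldData.{v},
    C.Computes (fun x : F.Desc × ((F.K × List F.K) × (F.K × List F.K)) =>
      polyComb x.2.1.1 x.2.1.2 x.2.2.1 x.2.2.2) := by
  obtain ⟨Cm, hm⟩ := exists_polyScale.{v}
  obtain ⟨Cs, hs⟩ := exists_polySub.{v}
  exact ⟨_, fun F => (hs F).comp (var.fst.pair (((hm F).comp (var.fst.pair var.snd.fst)).pair
    ((hm F).comp (var.fst.pair var.snd.snd))))⟩

theorem exists_polyMul : ∃ C : Code, ∀ F : FieldData.{v},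
    C.Computes (fun x : F.Desc × (List F.K × List F.K) => polyMul x.2.1 x.2.2) := by
  obtain ⟨C0, h0⟩ := exists_eltZero.{v}
  obtain ⟨Cm, hm⟩ := exists_polyScale.{v}
  obtain ⟨Cs, hs⟩ := exists_polySub.{v}
  exact ⟨_, fun F => by
    have h1 := (hm F).comp (var (α := (F.Desc × List F.K) × (List F.K × F.K)).fst.fst.pair
      (var.snd.snd.pair var.fst.snd))
    have h2 := ((h0 F).comp (var (α := (F.Desc × List F.K) × (List F.K × F.K)).fst.fst)).cons
      var.snd.fst
    have h3 := foldAdd (X + 1) ((hs F).comp (var.fst.fst.pair (h2.pair h1)))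
      (var (α := F.Desc × (List F.K × List F.K)).fst.pair var.snd.snd) var.snd.fst.reverse
      .empty (fun c s a => by
        have : (max (s.length + 1) c.2.length) * (F.eltWt + 1) ≤
          (s.length + 1 + c.2.length) * (F.eltWt + 1) := Nat.mul_le_mul_right _ (by omega)
        simp [wt_eltList]
        nlinarith)
    exact (hs F).comp (var.fst.pair (empty.pair h3))⟩

theorem exists_vecComb : ∃ C : Code, ∀ F : FieldData.{v},
    C.Computes (fun x : F.Desc × ((F.K × List (List F.K)) × (F.K × List (List F.K))) =>
      vecComb x.2.1.1 x.2.1.2 x.2.2.1 x.2.2.2) := by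
  obtain ⟨Cm, hm⟩ := exists_polyComb.{v}
  exact ⟨_, fun F => mapWith ((hm F).comp (var (α := (F.Desc × (F.K × F.K)) ×
      (List F.K × List F.K)).fst.fst.pair ((var.fst.snd.fst.pair var.snd.fst).pair
        (var.fst.snd.snd.pair var.snd.snd))))
    (var.fst.pair (var.snd.fst.fst.pair var.snd.snd.fst))
    (Code.Computes.zipPad .empty .empty var.snd.fst.snd var.snd.snd.snd)⟩

theorem exists_vecScale : ∃ C : Code, ∀ F : FieldData.{v},
    C.Computes (fun x : F.Desc × (List F.K × List (List F.K)) => vecScale x.2.1 x.2.2) := by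
  obtain ⟨Cm, hm⟩ := exists_polyMul.{v}
  exact ⟨_, fun F => mapWith ((hm F).comp (var.fst.fst.pair (var.fst.snd.pair var.snd)))
    (var.fst.pair var.snd.fst) var.snd.snd⟩

theorem exists_trim : ∃ C : Code, ∀ F : FieldData.{v},
    C.Computes (fun x : F.Desc × List F.K => trim x.2) := by
  obtain ⟨C0, h0⟩ := exists_eltZero.{v}
  obtain ⟨Cz, hz⟩ := exists_eltIsZero.{v}
  exact ⟨_, fun F => by
    have h1 := foldAdd 0 (((hz F).comp (var (α := F.Desc × (List F.K × F.K)).snd.fst.headD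
      ((h0 F).comp var.fst))).ite var.snd.fst.tail var.snd.fst) (var (α := F.Desc × List F.K).fst)
      var.snd var.snd (fun c s a => by
        dsimp only
        split_ifs
        · simpa using wt_tail_le s
        · simp)
    exact h1.of_eq fun x => by simp [trim]⟩

theorem exists_common : ∃ C : Code, ∀ F : FieldData.{v},
    C.Computes (fun x : F.Desc × List (List (List F.K) × List F.K) => common x.2) := by
  obtain ⟨C1, h1⟩ := exists_eltOne.{v}
  obtain ⟨Cm, hm⟩ := exists_polyMul.{v}
  obtain ⟨Cv, hv⟩ := exists_vecScale.{v}
  exact ⟨_, fun F => by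
    have hs : Code.Computes _ (fun x : F.Desc × ((List (List (List F.K)) × List F.K) ×
        (List (List F.K) × List F.K)) => commonStep x.2.1 x.2.2) :=
      ((mapWith ((hv F).comp (var.fst.fst.pair (var.fst.snd.pair var.snd)))
        (var.fst.pair var.snd.snd.snd) var.snd.fst.fst).append
        (((hv F).comp (var.fst.pair (var.snd.fst.snd.pair var.snd.snd.fst))).cons .empty)).pair
        ((hm F).comp (var.fst.pair (var.snd.fst.snd.pair var.snd.snd.snd)))
    -- in each round, denominator and numerators become longer by at most the length `N` of the
    -- entry; as there are at most `N` rounds, their length remains at most `N + N * N`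
    refine foldInv ((2 * X) * (vecWt X X (X + X * X) + 1) + 1 + ((X + X * X) * (X + 1) + 1) + 1) hs
      (var (α := F.Desc × List (List (List F.K) × List F.K)).fst) var.snd
      (empty.pair (((h1 F).comp var.fst).cons .empty))
      (fun N _ i s => s.1.length ≤ N + i ∧ (∀ v ∈ s.1, VecBd N (N + i * N) v) ∧
        s.2.length ≤ N + i * N) ?_ ?_ ?_
    · rintro N c ⟨vs, P⟩ h
      simp only [wt_pair] at h
      refine ⟨(length_lt_of_wt (l := vs) (by omega : _ < N)).le.trans (by simp), fun v hv => ?_,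
        (length_lt_of_wt (l := P) (by omega : _ < N)).le.trans (by simp)⟩
      have : wt v < wt vs := wt_le_of_mem hv
      exact (vecBd_of_wt (by omega)).mono le_rfl (by simp)
    · rintro N c i ⟨vs, P⟩ ⟨v, g⟩ h hi ⟨h1, h2, h3⟩
      simp only [wt_pair] at h h1 h2 h3 ⊢
      have hg : g.length < N := length_lt_of_wt (by omega)
      have hv : VecBd N N v := vecBd_of_wt (by omega)
      have e : N + (i + 1) * N = N + i * N + N := by ring
      simp only [commonStep]
      refine ⟨by simp; omega, fun w hw => ?_, ?_⟩
      · rcases List.mem_append.1 hw with hw | hw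
        · obtain ⟨w', hw', rfl⟩ := List.mem_map.1 hw
          exact ((h2 w' hw').vecScale g).mono le_rfl (by omega)
        · rw [List.mem_singleton.1 hw]
          exact (hv.vecScale P).mono le_rfl (by omega)
      · exact (length_polyMul_le _ _).trans (by omega)
    · rintro N c i ⟨vs, P⟩ hc hi ⟨h1, h2, h3⟩
      have he : F.eltWt ≤ N := by have := F.eltWt_le c; omega
      have hi' : N + i * N ≤ N + N * N := by gcongr
      have a1 := wt_list_le (k := 2 * N) (l := vs) (by simp at h1; omega) fun v hv =>
        wt_vec_le ((h2 v hv).mono le_rfl hi') he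
      have a2 := wt_poly_le (h3.trans hi') he
      simp only [wt_pair, eval_add, eval_mul, eval_vecWt, eval_X, eval_one, eval_ofNat] at a1 a2 ⊢
      omega⟩

theorem exists_image : ∃ C : Code, ∀ F : FieldData.{v},
    C.Computes (fun x : F.Desc × List (List F.K) => image x.2) := by
  obtain ⟨C0, h0⟩ := exists_eltZero.{v}
  obtain ⟨Ct, ht⟩ := exists_trim.{v}
  exact ⟨_, fun F => by
    have hh := mapWith (var (α := F.Desc × List F.K).snd.headD ((h0 F).comp var.fst))
      (var (α := F.Desc × ((List (List F.K) × List F.K) × F.K)).fst) var.snd.fst.fst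
    have hs := (mapWith (F := fun x : F.Desc × List F.K => x.2.tail) var.snd.tail
      (var (α := F.Desc × ((List (List F.K) × List F.K) × F.K)).fst) var.snd.fst.fst).pair
      (hh.reverse.append var.snd.fst.snd)
    refine (ht F).comp (var.fst.pair (foldInv (vecWt X X X + ((X + X * X) * (X + 1) + 1) + 1) hs
      (var (α := F.Desc × List (List F.K)).fst) var.snd.flatten (var.snd.pair .empty)
      (fun N _ i s => VecBd N N s.1 ∧ s.2.length ≤ N + i * N) ?_ ?_ ?_).snd)
    · rintro N c ⟨v, o⟩ h
      simp only [wt_pair] at h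
      exact ⟨vecBd_of_wt (v := v) (by omega), by
        simpa using (length_lt_of_wt (l := o) (by omega : _ < N)).le⟩
    · rintro N c i ⟨v, o⟩ a h hi ⟨h1, h2⟩
      refine ⟨⟨by simpa using h1.1, fun f hf => ?_⟩, ?_⟩
      · obtain ⟨f', hf', rfl⟩ := List.mem_map.1 hf
        have := h1.2 f' hf'
        simp
        omega
      · have e : N + (i + 1) * N = N + i * N + N := by ring
        have := h1.1
        simp at h2 this ⊢
        omega
    · rintro N c i ⟨v, o⟩ hc hi ⟨h1, h2⟩
      have he : F.eltWt ≤ N := by have := F.eltWt_le c; omega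
      have hi' : N + i * N ≤ N + N * N := by gcongr
      have a1 := wt_vec_le h1 he
      have a2 := wt_poly_le (h2.trans hi') he
      simp only [wt_pair, eval_add, eval_mul, eval_vecWt, eval_X, eval_one] at a1 a2 ⊢
      omega⟩

theorem exists_shift : ∃ C : Code, ∀ F : FieldData.{v},
    C.Computes (fun x : (F.Desc × List F.K) × (List F.K × List (List F.K)) =>
      shift x.1.2 x.2) := by
  obtain ⟨C0, h0⟩ := exists_eltZero.{v}
  exact ⟨_, fun F => (var.snd.fst.append var.fst.snd).pair
    (mapWith (F := fun x : F.Desc × List F.K => 0 :: x.2) (((h0 F).comp var.fst).cons var.snd)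
      var.fst.fst var.snd.snd)⟩

theorem entryBd_shift {K : Type*} [Field K] {n r ℓ : ℕ} {zs : List K}
    {e : List K × List (List K)} (h : EntryBd n r ℓ e) :
    EntryBd (n + zs.length) r (ℓ + 1) (shift zs e) :=
  ⟨by simpa [shift] using h.1, h.2.shift⟩

theorem exists_align : ∃ C : Code, ∀ F : FieldData.{v},
    C.Computes (fun x : (F.Desc × List F.K) × ((List F.K × List (List F.K)) ×
      (List F.K × List (List F.K))) => align x.1.2 x.2.1 x.2.2) := by
  obtain ⟨Cs, hs⟩ := exists_shift.{v}
  exact ⟨_, fun F => by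
    have h1 := ((var (α := ((F.Desc × List F.K) × List F.K) × ((List F.K × List (List F.K)) ×
      F.K)).fst.snd.lengthLe var.snd.fst.fst).ite var.snd.fst
      ((hs F).comp (var.fst.fst.pair var.snd.fst)))
    refine (foldInv (entryWt X (X + X * X) X (2 * X)) h1
      (var (α := (F.Desc × List F.K) × ((List F.K × List (List F.K)) ×
      (List F.K × List (List F.K)))).fst.pair var.snd.fst.fst) var.snd.fst.fst var.snd.snd
      (fun N _ i e => EntryBd (N + i * N) N (N + i) e) ?_ ?_ ?_).of_eq fun x => by simp [align]
    · rintro N c e h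
      have := entryBd_of_wt (x := e) (N := N) (by omega)
      simpa using this
    · rintro N ⟨⟨d, zs⟩, z⟩ i e a h hi h1
      simp only [wt_pair] at h
      have hz : zs.length < N := length_lt_of_wt (by omega)
      have e' : N + (i + 1) * N = N + i * N + N := by ring
      dsimp only
      rw [e']
      split_ifs
      · exact ⟨h1.1.trans (by omega), h1.2.mono le_rfl (by omega)⟩
      · have := entryBd_shift (zs := zs) h1
        exact ⟨this.1.trans (by omega), this.2⟩
    · rintro N ⟨⟨d, zs⟩, z⟩ i e hc hi h1
      have he : F.eltWt ≤ N := by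
        have := F.eltWt_le d
        simp only [wt_pair] at hc
        omega
      have hi' : N + i * N ≤ N + N * N := by gcongr
      have := wt_entry_le (n := N + N * N) (r := N) (ℓ := 2 * N)
        ⟨h1.1.trans hi', h1.2.mono le_rfl (by omega)⟩ he
      simpa using this⟩

end

/-! ### Programs for lattice reduction and for the whole algorithm -/

section

open scoped Classical
open Code.Computes

theorem exists_cancel : ∃ C : Code, ∀ F : FieldData.{v},
    C.Computes (fun x : F.Desc × ((List F.K × List (List F.K)) × (List F.K × List (List F.K))) =>
      cancel x.2.1 x.2.2) := by
  obtain ⟨C0, h0⟩ := exists_eltZero.{v}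
  obtain ⟨Ct, ht⟩ := exists_trim.{v}
  obtain ⟨Cp, hp⟩ := exists_polyComb.{v}
  obtain ⟨Cv, hv⟩ := exists_vecComb.{v}
  exact ⟨_, fun F => by
    have a := (var (α := F.Desc × ((List F.K × List (List F.K)) ×
      (List F.K × List (List F.K))))).snd.snd.fst.headD ((h0 F).comp var.fst)
    have b := (var (α := F.Desc × ((List F.K × List (List F.K)) ×
      (List F.K × List (List F.K))))).snd.fst.fst.headD ((h0 F).comp var.fst)
    exact ((ht F).comp (var.fst.pair ((hp F).comp
      (var.fst.pair ((a.pair var.snd.fst.fst).pair (b.pair var.snd.snd.fst)))))).pair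
      ((hv F).comp (var.fst.pair ((a.pair var.snd.fst.snd).pair (b.pair var.snd.snd.snd))))⟩

theorem exists_passStep : ∃ C : Code, ∀ F : FieldData.{v},
    C.Computes (fun x : (F.Desc × List F.K) × (((List F.K × List (List F.K)) ×
      List (List F.K × List (List F.K))) × (List F.K × List (List F.K))) =>
      passStep x.1.2 x.2.1 x.2.2) := by
  obtain ⟨Ca, ha⟩ := exists_align.{v}
  obtain ⟨Cc, hc⟩ := exists_cancel.{v}
  exact ⟨_, fun F => by
    have hb := (var (α := (F.Desc × List F.K) × (((List F.K × List (List F.K)) ×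
      List (List F.K × List (List F.K))) × (List F.K × List (List F.K))))).snd.snd.fst.lengthLe
      var.snd.fst.fst.fst
    have big := hb.ite var.snd.fst.fst var.snd.snd
    have small := hb.ite var.snd.snd var.snd.fst.fst
    have sm := (ha F).comp (var.fst.pair (big.pair small))
    exact ((small.fst.isCons.and ((big.fst.lengthLe sm.fst).and (sm.fst.lengthLe big.fst))).ite
      (((hc F).comp (var.fst.fst.pair (big.pair sm))).pair (small.cons var.snd.fst.snd))
      (var.snd.fst.fst.pair (var.snd.snd.cons var.snd.fst.snd))).of_eq fun x => by
        simp only [passStep, decide_eq_true_eq]⟩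

/-- A bound for the weight of a list of `k` images that are accompanied by vectors, together with
one more such pair. -/
theorem wt_state_le {F : FieldData.{v}}
    {s : (List F.K × List (List F.K)) × List (List F.K × List (List F.K))} {n r ℓ e k : ℕ}
    (h : StateBd n r ℓ s) (he : F.eltWt ≤ e) (hk : s.2.length ≤ k) :
    wt s ≤ (k + 1) * (entryWt e n r ℓ + 1) + 1 := by
  have h1 := wt_entry_le h.1 he
  have h2 := wt_list_le hk fun x hx => wt_entry_le (h.2 x hx) he
  rw [wt_pair, add_mul]
  omega

theorem stateBd_of_wt {F : FieldData.{v}}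
    {s : (List F.K × List (List F.K)) × List (List F.K × List (List F.K))} {N : ℕ}
    (h : wt s < N) : StateBd N N N s ∧ s.2.length ≤ N := by
  rw [wt_pair] at h
  refine ⟨⟨entryBd_of_wt (by omega), fun e he => ?_⟩, (length_lt_of_wt (by omega)).le⟩
  have := wt_le_of_mem he
  exact entryBd_of_wt (by omega)

theorem exists_pass : ∃ C : Code, ∀ F : FieldData.{v},
    C.Computes (fun x : (F.Desc × List F.K) × ((List F.K × List (List F.K)) ×
      List (List F.K × List (List F.K))) => pass x.1.2 x.2) := by
  obtain ⟨Cs, hs⟩ := exists_passStep.{v}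
  exact ⟨_, fun F => by
    refine foldInv ((2 * X + 1) * (entryWt X X X (X + X * X) + 1) + 1) (hs F)
      (var (α := (F.Desc × List F.K) × ((List F.K × List (List F.K)) ×
        List (List F.K × List (List F.K))))).fst var.snd.snd (var.snd.fst.pair .empty)
      (fun N _ i s => StateBd N N (N + i * N) s ∧ s.2.length ≤ N + i) ?_ ?_ ?_
    · rintro N c s h
      have := stateBd_of_wt (s := s) (N := N) (by omega)
      simpa using this
    · rintro N c i s a h hi ⟨h1, h2⟩
      have ha : EntryBd N N (N + i * N) a :=
        (entryBd_of_wt (by omega)).mono (Nat.le_add_right _ _)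
      refine ⟨?_, by rw [length_passStep]; dsimp only; omega⟩
      convert h1.passStep c.2 ha using 1
      ring
    · rintro N ⟨d, zs⟩ i s hc hi ⟨h1, h2⟩
      have he : F.eltWt ≤ N := by
        have := F.eltWt_le d
        simp only [wt_pair] at hc
        omega
      have hi' : N + i * N ≤ N + N * N := by gcongr
      have := wt_state_le (k := 2 * N) (h1.mono hi') he (by omega)
      simpa using this⟩

theorem exists_insertVec : ∃ C : Code, ∀ F : FieldData.{v},
    C.Computes (fun x : (F.Desc × (List F.K × List F.K)) × (List (List F.K × List (List F.K)) ×
      (List F.K × List (List F.K))) => insertVec x.1.2.1 x.1.2.2 x.2.1 x.2.2) := by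
  obtain ⟨Cs, hs⟩ := exists_pass.{v}
  exact ⟨_, fun F => by
    have h1 := foldInv ((X + 1) * (entryWt X X X (X + X * (X * X)) + 1) + 1)
      ((hs F).comp (var (α := (F.Desc × List F.K) × (((List F.K × List (List F.K)) ×
        List (List F.K × List (List F.K))) × F.K)).fst.pair var.snd.fst))
      (var (α := (F.Desc × (List F.K × List F.K)) × (List (List F.K × List (List F.K)) ×
      (List F.K × List (List F.K)))).fst.fst.pair var.fst.snd.fst) var.fst.snd.snd
      (var.snd.snd.pair var.snd.fst)
      (fun N _ i s => StateBd N N (N + i * (N * N)) s ∧ s.2.length ≤ N)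
      (fun N c s h => by
        have := stateBd_of_wt (s := s) (N := N) (by omega)
        simpa using this)
      (fun N c i s a h hi hI => by
        obtain ⟨h3, h4⟩ := hI.1.pass c.2
        refine ⟨h3.mono ?_, h4.le.trans hI.2⟩
        have := Nat.mul_le_mul_right N hI.2
        rw [add_mul]
        omega)
      (by
        rintro N ⟨d, zs⟩ i s hc hi ⟨h1, h2⟩
        have he : F.eltWt ≤ N := by
          have := F.eltWt_le d
          simp only [wt_pair] at hc
          omega
        have hi' : N + i * (N * N) ≤ N + N * (N * N) := by gcongr
        have := wt_state_le (h1.mono hi') he h2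
        simpa using this)
    exact h1.fst.cons h1.snd⟩

theorem exists_reduceList : ∃ C : Code, ∀ F : FieldData.{v},
    C.Computes (fun x : (F.Desc × List F.K) × List (List F.K × List (List F.K)) =>
      reduceList x.1.2 x.2) := by
  obtain ⟨Cs, hs⟩ := exists_insertVec.{v}
  exact ⟨_, fun F => by
    -- the insertion of a vector takes `N` passes through at most `2 * N` vectors, and each
    -- comparison adds at most `N` coefficients to the accompanying polynomials
    have h1 := foldInv ((2 * X) * (entryWt X X X (X + X * (X * (2 * X * X))) + 1) + 1)
      (hs F) (var (α := (F.Desc × List F.K) × List (List F.K × List (List F.K))).fst.fst.pair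
        (var.fst.snd.pair (mapWith (F := fun x : Bool × (List F.K × List (List F.K)) => x.2.1)
          var.snd.fst ff var.snd).flatten)) var.snd .empty
      (fun N _ i s => (∀ e ∈ s, EntryBd N N (N + i * (N * (2 * N * N))) e) ∧ s.length ≤ N + i)
      (fun N c s h => by
        refine ⟨fun e he => ?_, (length_lt_of_wt (l := s) (by omega : _ < N)).le.trans (by simp)⟩
        have := wt_le_of_mem he
        exact (entryBd_of_wt (by omega)).mono (by simp))
      (fun N c i s a h hi hI => by
        have ha : EntryBd N N N a := entryBd_of_wt (by omega)
        have h0 : StateBd N N (N + i * (N * (2 * N * N))) (a, s) :=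
          ⟨ha.mono (Nat.le_add_right _ _), hI.1⟩
        have hf : c.2.2.length < N := length_lt_of_wt (by
          simp only [wt_pair] at h
          omega)
        obtain ⟨h3, h4⟩ := h0.iterate_pass c.2.1 c.2.2
        have e : N + (i + 1) * (N * (2 * N * N)) = N + i * (N * (2 * N * N)) + N * (2 * N * N) := by
          ring
        have e' : c.2.2.length * (s.length * N) ≤ N * (2 * N * N) := by
          gcongr
          have := hI.2
          omega
        have h5 := h3.mono (ℓ' := N + (i + 1) * (N * (2 * N * N))) (by
          rw [e]
          exact Nat.add_le_add_left e' _)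
        refine ⟨fun x hx => ?_, ?_⟩
        · rcases List.mem_cons.1 hx with rfl | hx
          · exact h5.1
          · exact h5.2 x hx
        · have := hI.2
          have h6 : (insertVec c.2.1 c.2.2 s a).length = s.length + 1 := by
            simpa [insertVec] using h4
          dsimp only
          omega)
      (by
        rintro N ⟨d, x⟩ i s hc hi ⟨h1, h2⟩
        have he : F.eltWt ≤ N := by
          have := F.eltWt_le d
          simp only [wt_pair] at hc
          omega
        have hi' : N + i * (N * (2 * N * N)) ≤ N + N * (N * (2 * N * N)) := by gcongr
        have := wt_list_le (k := 2 * N) (by omega) fun e h => wt_entry_le ((h1 e h).mono hi') he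
        simpa using this)
    exact h1⟩

theorem exists_unitVecs : ∃ C : Code, ∀ F : FieldData.{v},
    C.Computes (fun x : F.Desc × List (List (List F.K)) => unitVecs (K := F.K) x.2) := by
  obtain ⟨C1, h1⟩ := exists_eltOne.{v}
  exact ⟨_, fun F => by
    have hs : Code.Computes _ (fun x : F.Desc × ((List (List F.K) × List (List (List F.K))) ×
        List (List F.K)) => (([] : List F.K) :: x.2.1.1,
          ([1] :: x.2.1.1) :: x.2.1.2.map ([] :: ·))) :=
      (empty.cons var.snd.fst.fst).pair (((((h1 F).comp var.fst).cons .empty).cons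
        var.snd.fst.fst).cons (mapWith (F := fun x : F.Desc × List (List F.K) => [] :: x.2)
          (empty.cons var.snd) var.fst var.snd.fst.snd))
    refine (foldInv (vecWt X (2 * X) X + (2 * X * (vecWt X (2 * X) X + 1) + 1) + 1) hs
      (var (α := F.Desc × List (List (List F.K)))).fst var.snd (empty.pair .empty)
      (fun N _ i s => VecBd (N + i) N s.1 ∧ s.2.length ≤ N + i ∧ ∀ v ∈ s.2, VecBd (N + i) N v)
      ?_ ?_ ?_).snd
    · rintro N c ⟨z, o⟩ h
      simp only [wt_pair] at h
      refine ⟨vecBd_of_wt (v := z) (by omega), (length_lt_of_wt (l := o) (by omega : _ < N)).le,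
        fun v hv => ?_⟩
      have : wt v < wt o := wt_le_of_mem hv
      exact vecBd_of_wt (v := v) (by omega)
    · rintro N c i ⟨z, o⟩ a h hi ⟨h1, h2, h3⟩
      refine ⟨h1.cons (by simp), by simp at h2 ⊢; omega, fun v hv => ?_⟩
      rcases List.mem_cons.1 hv with rfl | hv
      · exact h1.cons (by simp; omega)
      · obtain ⟨v', hv', rfl⟩ := List.mem_map.1 hv
        exact (h3 v' hv').cons (by simp)
    · rintro N c i ⟨z, o⟩ hc hi ⟨h1, h2, h3⟩
      have he : F.eltWt ≤ N := by have := F.eltWt_le c; omega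
      have a1 := wt_vec_le (h1.mono (by omega : N + i ≤ 2 * N) le_rfl) he
      have a2 := wt_list_le (k := 2 * N) (l := o) (by simp at h2; omega) fun v hv =>
        wt_vec_le ((h3 v hv).mono (by omega : N + i ≤ 2 * N) le_rfl) he
      simp only [wt_pair, eval_add, eval_mul, eval_vecWt, eval_X, eval_one, eval_ofNat] at a1 a2 ⊢
      omega⟩

theorem exists_solve : ∃ C : Code, ∀ F : FieldData.{v},
    C.Computes (fun x : (F.Desc × List F.K) × (List (List (List F.K)) × List (List F.K)) =>
      solve x.1.2 x.2.1 x.2.2) := by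
  obtain ⟨Ci, hi⟩ := exists_image.{v}
  obtain ⟨Cu, hu⟩ := exists_unitVecs.{v}
  obtain ⟨Cr, hr⟩ := exists_reduceList.{v}
  exact ⟨_, fun F => by
    have hc := (var (α := (F.Desc × List F.K) × (List (List (List F.K)) ×
      List (List F.K)))).snd.snd.cons var.snd.fst
    have h1 := (hr F).comp (var.fst.pair (Code.Computes.zipPad .empty .empty
      (mapWith (hi F) var.fst.fst hc) ((hu F).comp (var.fst.fst.pair hc))))
    have h2 := foldAdd (F := fun x : Bool × (List (List F.K) × (List F.K × List (List F.K))) =>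
      if isCons x.2.2.1 = true then x.2.1 else x.2.2.2) X
      (var.snd.snd.fst.isCons.ite var.snd.fst var.snd.snd.snd) ff h1 .empty (fun c s a => by
        dsimp only
        split_ifs <;> simp
        omega)
    exact h2.tail.pair (h2.headD .empty)⟩

theorem exists_powers : ∃ C : Code, ∀ F : FieldData.{v},
    C.Computes (fun x : (F.Desc × (List F.K × List F.K)) × (List F.K × List (List F.K)) =>
      powers x.1.2.1 x.1.2.2 x.2) := by
  obtain ⟨Cs, hs⟩ := exists_shift.{v}
  exact ⟨_, fun F => by
    have h1 := (var (α := (F.Desc × (List F.K × List F.K)) × (((List F.K × List (List F.K)) ×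
      List (List (List F.K))) × F.K)).snd.fst.fst.fst.lengthLe var.fst.snd.snd).ite
      (((hs F).comp ((var.fst.fst.pair var.fst.snd.fst).pair var.snd.fst.fst)).pair
        (var.snd.fst.fst.snd.cons var.snd.fst.snd)) var.snd.fst
    refine ((foldInv (entryWt X (X + X * X) X (2 * X) + (2 * X * (vecWt X X (2 * X) + 1) + 1) + 1)
      h1 (var (α := (F.Desc × (List F.K × List F.K)) × (List F.K × List (List F.K)))).fst
      var.fst.snd.snd (var.snd.pair .empty)
      (fun N _ i s => EntryBd (N + i * N) N (N + i) s.1 ∧ s.2.length ≤ N + i ∧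
        ∀ v ∈ s.2, VecBd N (N + i) v) ?_ ?_ ?_).snd).of_eq fun x => by simp [powers]
    · rintro N c ⟨e, o⟩ h
      simp only [wt_pair (x := (e, o))] at h
      refine ⟨?_, (length_lt_of_wt (l := o) (by omega : _ < N)).le, fun v hv => ?_⟩
      · have := entryBd_of_wt (x := e) (N := N) (by omega)
        simpa using this
      · have : wt v < wt o := wt_le_of_mem hv
        exact vecBd_of_wt (v := v) (by omega)
    · rintro N ⟨d, zs, l⟩ i ⟨e, o⟩ a h hi ⟨h1, h2, h3⟩
      simp only [wt_pair (x := (d, zs, l)), wt_pair (x := (zs, l))] at h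
      have hz : zs.length < N := length_lt_of_wt (by omega)
      have e' : N + (i + 1) * N = N + i * N + N := by ring
      dsimp only at h1 h2 h3 ⊢
      rw [e']
      split_ifs
      · have := entryBd_shift (zs := zs) h1
        refine ⟨⟨this.1.trans (by omega), this.2⟩, Nat.succ_le_succ h2, fun v hv => ?_⟩
        rcases List.mem_cons.1 hv with rfl | hv
        · exact h1.2.mono le_rfl (by omega)
        · exact (h3 v hv).mono le_rfl (by omega)
      · exact ⟨⟨h1.1.trans (by omega), h1.2.mono le_rfl (by omega)⟩, h2.trans (by omega),
          fun v hv => (h3 v hv).mono le_rfl (by omega)⟩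
    · rintro N ⟨d, x⟩ i ⟨e, o⟩ hc hi ⟨h1, h2, h3⟩
      have he : F.eltWt ≤ N := by
        have := F.eltWt_le d
        simp only [wt_pair] at hc
        omega
      have hi' : N + i * N ≤ N + N * N := by gcongr
      have a1 := wt_entry_le (n := N + N * N) (r := N) (ℓ := 2 * N)
        ⟨h1.1.trans hi', h1.2.mono le_rfl (by omega)⟩ he
      have a2 := wt_list_le (k := 2 * N) (l := o) (by simp at h2; omega) fun v hv =>
        wt_vec_le ((h3 v hv).mono le_rfl (by omega : N + i ≤ 2 * N)) he
      rw [wt_pair (x := (e, o))]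
      simp only [eval_add, eval_mul, eval_vecWt, eval_entryWt, eval_X, eval_one,
        eval_ofNat] at a1 a2 ⊢
      omega⟩

theorem exists_matCommon : ∃ C : Code, ∀ F : FieldData.{v},
    C.Computes (fun x : F.Desc × List (List (List F.K × List F.K)) => matCommon x.2) := by
  obtain ⟨Cc, hc⟩ := exists_common.{v}
  exact ⟨_, fun F => by
    have h1 := (hc F).comp ((var (α := F.Desc × List (List F.K × List F.K))).fst.pair
      (mapWith (F := fun x : Bool × (List F.K × List F.K) => ([x.2.1], x.2.2))
        ((var.snd.fst.cons .empty).pair var.snd.snd) ff var.snd))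
    have h2 : Code.Computes _ (fun x : F.Desc × List (List F.K × List F.K) => colCommon x.2) :=
      (mapWith (F := fun x : Bool × List (List F.K) => x.2.headD [])
        (var.snd.headD .empty) ff h1.fst).pair h1.snd
    exact (hc F).comp (var.fst.pair (mapWith h2 var.fst var.snd))⟩

theorem exists_mainPoly : ∃ C : Code, ∀ F : FieldData.{v},
    C.Computes (fun x : F.Desc × (List (List (List F.K)) × List (List (List F.K))) =>
      mainPoly x.2.1 x.2.2) := by
  obtain ⟨C0, h0⟩ := exists_eltZero.{v}
  obtain ⟨Cc, hc⟩ := exists_common.{v}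
  obtain ⟨Cs, hs⟩ := exists_solve.{v}
  obtain ⟨Ci, hi⟩ := exists_image.{v}
  obtain ⟨Cr, hr⟩ := exists_reduceList.{v}
  obtain ⟨Cp, hp⟩ := exists_powers.{v}
  obtain ⟨Ct, ht⟩ := exists_trim.{v}
  exact ⟨_, fun F => by
    have zs := mapWith (F := fun x : F.Desc × List (List F.K) => (0 : F.K)) ((h0 F).comp var.fst)
      (var (α := F.Desc × (List (List (List F.K)) × List (List (List F.K))))).fst var.snd.snd
    have r := (hc F).comp (var.fst.pair (mapWith ((hs F).comp
      (var.fst.fst.pair (var.fst.snd.pair var.snd))) ((var.fst.pair zs).pair var.snd.snd)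
        var.snd.fst))
    have R := (hr F).comp ((var.fst.pair zs).pair (Code.Computes.zipPad .empty .empty
      (mapWith (hi F) var.fst r.fst) var.snd.fst))
    have D := (ht F).comp (var.fst.pair r.snd.reverse)
    have l := (mapWith (F := fun x : List F.K × List (List F.K) => x.1) var.fst D r.fst).flatten
    exact (mapWith (hp F) (var.fst.pair (zs.pair l)) R).flatten⟩

theorem exists_mainAlg : ∃ C : Code, ∀ F : FieldData.{v},
    C.Computes (fun x : F.Desc × (List (List (List F.K × List F.K)) ×
      List (List (List F.K × List F.K))) => mainAlg x.2.1 x.2.2) := by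
  obtain ⟨Cc, hc⟩ := exists_matCommon.{v}
  obtain ⟨Cp, hp⟩ := exists_mainPoly.{v}
  obtain ⟨Cm, hm⟩ := exists_polyMul.{v}
  obtain ⟨Cv, hv⟩ := exists_vecScale.{v}
  exact ⟨_, fun F => by
    have B := (hc F).comp ((var (α := F.Desc × (List (List (List F.K × List F.K)) ×
      List (List (List F.K × List F.K))))).fst.pair var.snd.fst)
    have U := (hc F).comp ((var (α := F.Desc × (List (List (List F.K × List F.K)) ×
      List (List (List F.K × List F.K))))).fst.pair var.snd.snd)
    have s := (hv F).comp ((var (α := (F.Desc × List F.K) × List (List F.K))).fst.fst.pair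
      (var.fst.snd.pair var.snd))
    have M := (hp F).comp (var.fst.pair ((mapWith s (var.fst.pair U.snd) B.fst).pair
      (mapWith s (var.fst.pair B.snd) U.fst)))
    have D := (hm F).comp (var.fst.pair (B.snd.pair U.snd))
    have f := mapWith (F := fun x : List F.K × List F.K => (x.2, x.1)) (var.snd.pair var.fst)
      (var (α := List F.K × List (List F.K))).fst var.snd
    exact mapWith f D M⟩

end

/-! ### Lists of coefficients as polynomials -/

section Poly

variable {K : Type*} [Field K]

/-- The polynomial with the given coefficients, constant term first. -/
def toPoly (l : List K) : K[X] := l.foldr (fun a f => C a + X * f) 0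

@[simp] theorem toPoly_nil : toPoly ([] : List K) = 0 := rfl

theorem toPoly_cons (a : K) (l : List K) : toPoly (a :: l) = C a + X * toPoly l := rfl

theorem coeff_toPoly (l : List K) (i : ℕ) : (toPoly l).coeff i = l.getD i 0 := by
  induction l generalizing i with
  | nil => simp
  | cons a l ih => cases i <;> simp [toPoly_cons, ih, coeff_C]

theorem toPoly_polySub (f g : List K) : toPoly (polySub f g) = toPoly f - toPoly g := by
  ext i
  have h := List.getD_map (l := zipPad 0 0 f g) (n := i) (d := ((0 : K), (0 : K)))
    (f := fun x => x.1 - x.2)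
  simp only [getD_zipPad, sub_zero] at h
  rw [coeff_sub, coeff_toPoly, coeff_toPoly, coeff_toPoly, polySub, h]

theorem toPoly_scale (a : K) (f : List K) : toPoly (f.map (a * ·)) = C a * toPoly f := by
  induction f with
  | nil => simp
  | cons b f ih => rw [List.map_cons, toPoly_cons, toPoly_cons, ih, C_mul]; ring

theorem toPoly_polyComb (a : K) (f : List K) (b : K) (g : List K) :
    toPoly (polyComb a f b g) = C a * toPoly f - C b * toPoly g := by
  rw [polyComb, toPoly_polySub, toPoly_scale, toPoly_scale]

theorem toPoly_zero_cons (l : List K) : toPoly (0 :: l) = X * toPoly l := by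
  simp [toPoly_cons]

theorem toPoly_polyMul (f g : List K) : toPoly (polyMul f g) = toPoly f * toPoly g := by
  have key : toPoly (f.reverse.foldl (fun s a => polySub (0 :: s) (g.map (a * ·))) []) =
      -(toPoly f * toPoly g) := by
    rw [List.foldl_reverse]
    induction f with
    | nil => simp
    | cons a f ih =>
      rw [List.foldr_cons, toPoly_polySub, toPoly_zero_cons, ih, toPoly_scale, toPoly_cons]
      ring
  rw [polyMul, toPoly_polySub, key]
  simp

theorem toPoly_append_zeros (l zs : List K) (h : ∀ a ∈ zs, a = 0) :
    toPoly (l ++ zs) = toPoly l := by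
  induction l with
  | nil =>
    induction zs with
    | nil => rfl
    | cons a zs ih =>
      rw [List.nil_append] at ih ⊢
      rw [toPoly_cons, ih fun b hb => h b (by simp [hb]), h a (by simp)]
      simp
  | cons a l ih => rw [List.cons_append, toPoly_cons, toPoly_cons, ih]

theorem toPoly_zeros_append (l zs : List K) (h : ∀ a ∈ zs, a = 0) :
    toPoly (zs ++ l) = X ^ zs.length * toPoly l := by
  induction zs with
  | nil => simp
  | cons a zs ih =>
    rw [List.cons_append, toPoly_cons, ih fun b hb => h b (by simp [hb]), h a (by simp),
      List.length_cons, pow_succ']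
    simp
    ring

/-- The vector of polynomials that is given by a list. -/
def vecPoly (r : ℕ) (v : List (List K)) : Fin r → K[X] := fun i => toPoly (v.getD i [])

theorem vecPoly_vecComb (r : ℕ) (a : K) (u : List (List K)) (b : K) (v : List (List K)) :
    vecPoly r (vecComb a u b v) = C a • vecPoly r u - C b • vecPoly r v := by
  funext i
  have h := List.getD_map (l := zipPad [] [] u v) (n := i) (d := (([] : List K), ([] : List K)))
    (f := fun x => polyComb a x.1 b x.2)
  rw [getD_zipPad] at h
  have h' : (vecComb a u b v).getD i [] = polyComb a (u.getD i []) b (v.getD i []) := h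
  simp only [vecPoly, Pi.sub_apply, Pi.smul_apply, smul_eq_mul]
  rw [h', toPoly_polyComb]

theorem vecPoly_shift (r : ℕ) {v : List (List K)} (hv : v.length = r) :
    vecPoly r (v.map (0 :: ·)) = (X : K[X]) • vecPoly r v := by
  funext i
  have hi : (i : ℕ) < v.length := hv ▸ i.2
  simp [vecPoly, hi, toPoly_zero_cons]

theorem toPoly_getD_vecScale (g : List K) (v : List (List K)) (i : ℕ) :
    toPoly ((vecScale g v).getD i []) = toPoly g * toPoly (v.getD i []) := by
  rcases lt_or_ge i v.length with hi | hi
  · simp [vecScale, hi, toPoly_polyMul]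
  · simp [vecScale, hi]

theorem length_vecScale (g : List K) (v : List (List K)) : (vecScale g v).length = v.length := by
  simp [vecScale]

/-- The lists of numerators in `common l` have a common denominator: each fraction `v / g` in `l` is
equal to the corresponding fraction in `common l`. -/
theorem common_spec (l : List (List (List K) × List K)) (hl : ∀ x ∈ l, toPoly x.2 ≠ 0) :
    toPoly (common l).2 ≠ 0 ∧
    List.Forall₂ (fun x w => w.length = x.1.length ∧
      ∀ i, toPoly x.2 * toPoly (w.getD i []) = toPoly (common l).2 * toPoly (x.1.getD i []))
      l (common l).1 := by
  induction l using List.reverseRecOn with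
  | nil => simp [common, toPoly_cons]
  | append_singleton l x ih =>
    obtain ⟨h1, h2⟩ := ih fun y hy => hl y (by simp [hy])
    have hx := hl x (by simp)
    have e : common (l ++ [x]) = commonStep (common l) x := by simp [common]
    rw [e]
    simp only [commonStep, toPoly_polyMul]
    refine ⟨mul_ne_zero h1 hx, List.rel_append (List.forall₂_map_right_iff.2 ?_)
      (List.Forall₂.cons ⟨length_vecScale _ _, fun i => ?_⟩ .nil)⟩
    · refine h2.imp fun y w h => ⟨(length_vecScale _ _).trans h.1, fun i => ?_⟩
      rw [toPoly_getD_vecScale, mul_left_comm, h.2 i]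
      ring
    · rw [toPoly_getD_vecScale]
      ring

open scoped Classical in
/-- Trimming removes exactly the zeros at the beginning. -/
theorem exists_append_trim (l : List K) :
    (∃ zs : List K, (∀ a ∈ zs, a = 0) ∧ l = zs ++ trim l) ∧
      (trim l ≠ [] → (trim l).headD 0 ≠ 0) := by
  have key : ∀ m s : List K,
      (∃ zs : List K, (∀ a ∈ zs, a = 0) ∧
        s = zs ++ m.foldl (fun s _ => if s.headD 0 = 0 then s.tail else s) s) ∧
      (s.length ≤ m.length → m.foldl (fun s _ => if s.headD 0 = 0 then s.tail else s) s ≠ [] →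
        (m.foldl (fun s _ => if s.headD 0 = 0 then s.tail else s) s).headD 0 ≠ 0) := by
    have stays : ∀ m s : List K, s.headD 0 ≠ 0 →
        m.foldl (fun s _ => if s.headD 0 = 0 then s.tail else s) s = s := by
      intro m s h
      induction m with
      | nil => rfl
      | cons a m ih => rw [List.foldl_cons, if_neg h, ih]
    intro m
    induction m with
    | nil =>
      intro s
      refine ⟨⟨[], by simp⟩, fun h h' => ?_⟩
      exact absurd (List.length_eq_zero_iff.1 (by simpa using h)) h'
    | cons a m ih =>
      intro s
      by_cases h : s.headD 0 = 0
      · rw [List.foldl_cons, if_pos h]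
        obtain ⟨⟨zs, h1, h2⟩, h3⟩ := ih s.tail
        cases s with
        | nil => exact ⟨⟨zs, h1, h2⟩, fun _ => h3 (by simp)⟩
        | cons b s =>
          refine ⟨⟨b :: zs, ?_, by simpa using h2⟩, fun hl => h3 (by simpa using hl)⟩
          intro c hc
          rcases List.mem_cons.1 hc with rfl | hc
          · simpa using h
          · exact h1 c hc
      · rw [stays _ _ h]
        exact ⟨⟨[], by simp⟩, fun _ _ => h⟩
  exact ⟨(key l l).1, (key l l).2 le_rfl⟩

/-! ### Vectors of polynomials as polynomials in one variable -/

/-- The polynomial with the given coefficients, leading coefficient first. Images are stored in this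
order since the reduction acts on their leading coefficients. -/
def imgPoly (I : List K) : K[X] := toPoly I.reverse

theorem imgPoly_trim (l : List K) : imgPoly (trim l) = imgPoly l := by
  obtain ⟨⟨zs, h1, h2⟩, -⟩ := exists_append_trim l
  conv_rhs => rw [h2]
  rw [imgPoly, imgPoly, List.reverse_append, toPoly_append_zeros _ _ (by simpa using h1)]

theorem imgPoly_append_zeros (I zs : List K) (h : ∀ a ∈ zs, a = 0) :
    imgPoly (I ++ zs) = X ^ zs.length * imgPoly I := by
  rw [imgPoly, imgPoly, List.reverse_append, toPoly_zeros_append _ _ (by simpa using h),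
    List.length_reverse]

theorem polySub_reverse (f g : List K) (h : f.length = g.length) :
    (polySub f g).reverse = polySub f.reverse g.reverse := by
  rw [polySub, polySub, zipPad_eq_zip _ _ _ _ h, zipPad_eq_zip _ _ _ _ (by simpa using h),
    ← List.map_reverse, List.zip, List.reverse_zipWith h]

theorem imgPoly_polyComb (a : K) (f : List K) (b : K) (g : List K) (h : f.length = g.length) :
    imgPoly (polyComb a f b g) = C a * imgPoly f - C b * imgPoly g := by
  rw [imgPoly, polyComb, polySub_reverse _ _ (by simpa using h), toPoly_polySub,
    ← List.map_reverse, ← List.map_reverse, toPoly_scale, toPoly_scale]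
  rfl

theorem coeff_imgPoly_length (a : K) (I : List K) : (imgPoly (a :: I)).coeff I.length = a := by
  simp [imgPoly, coeff_toPoly]

theorem coeff_imgPoly_of_le (I : List K) {i : ℕ} (h : I.length ≤ i) : (imgPoly I).coeff i = 0 := by
  rw [imgPoly, coeff_toPoly, List.getD_eq_default _ _ (by simpa using h)]

/-- The vector `v` with `F = ∑ r, z ^ r * v r (z ^ m)`, for a polynomial `F` in `z`. -/
def unflat (m : ℕ) (F : K[X]) : Fin m → K[X] := fun r =>
  ∑ k ∈ Finset.range (F.natDegree + 1), monomial k (F.coeff (m * k + r))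

theorem coeff_unflat {m : ℕ} (F : K[X]) (r : Fin m) (k : ℕ) :
    (unflat m F r).coeff k = F.coeff (m * k + r) := by
  simp only [unflat, finsetSum_coeff, coeff_monomial, Finset.sum_ite_eq', Finset.mem_range]
  split_ifs with h
  · rfl
  · have hm : 1 ≤ m := r.pos
    have : k ≤ m * k := Nat.le_mul_of_pos_left _ hm
    rw [coeff_eq_zero_of_natDegree_lt (by omega)]

theorem unflat_sub {m : ℕ} (a : K) (F : K[X]) (b : K) (G : K[X]) :
    unflat m (C a * F - C b * G) = C a • unflat m F - C b • unflat m G := by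
  funext r
  ext k
  simp [coeff_unflat]

/-- Multiplication of the image by `z ^ m` is multiplication of the vector by `x`. -/
theorem unflat_X_pow_mul {m : ℕ} (F : K[X]) : unflat m (X ^ m * F) = (X : K[X]) • unflat m F := by
  funext r
  ext k
  have hr := r.2
  rw [coeff_unflat, coeff_X_pow_mul']
  cases k with
  | zero => simp
  | succ k =>
    have e : m * (k + 1) + r = m + (m * k + r) := by ring
    rw [e, if_pos (by omega), Nat.add_sub_cancel_left]
    simp [coeff_unflat]

theorem getD_foldl_interleave (fuel : List K) (v : List (List K)) (o : List K) :
    let res := (fuel.foldl (fun (s : List (List K) × List K) _ =>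
      (s.1.map List.tail, (s.1.map (List.headD · 0)).reverse ++ s.2)) (v, o)).2
    ∃ l : List K, res = l.reverse ++ o ∧ ∀ r < v.length, ∀ k < fuel.length,
      l.getD (v.length * k + r) 0 = (v.getD r []).getD k 0 := by
  induction fuel generalizing v o with
  | nil => exact ⟨[], by simp⟩
  | cons a fuel ih =>
    obtain ⟨l, h1, h2⟩ := ih (v.map List.tail) ((v.map (List.headD · 0)).reverse ++ o)
    refine ⟨v.map (List.headD · 0) ++ l, ?_, ?_⟩
    · simp only [List.foldl_cons]
      rw [h1]
      simp
    · intro r hr k hk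
      cases k with
      | zero =>
        rw [List.getD_append _ _ _ _ (by simpa using hr)]
        simp only [mul_zero, zero_add]
        rw [List.getD_eq_getElem _ _ (by simpa using hr), List.getD_eq_getElem _ _ hr]
        simp only [List.getElem_map]
        cases v[r] <;> simp
      | succ k =>
        have := h2 r (by simpa using hr) k (by simpa using hk)
        rw [List.length_map] at this
        have e : v.length * (k + 1) + r = v.length + (v.length * k + r) := by ring
        have h' : (v.map List.tail).getD r [] = (v.getD r []).tail :=
          List.getD_map (d := ([] : List K)) ..
        rw [List.getD_append_right _ _ _ _ (by rw [List.length_map, e]; omega), List.length_map, e,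
          Nat.add_sub_cancel_left, this, h']
        cases v.getD r [] <;> simp

theorem length_le_flatten {α : Type*} {v : List (List α)} {f : List α} (h : f ∈ v) :
    f.length ≤ v.flatten.length := by
  rw [List.length_flatten]
  exact List.single_le_sum (by simp) _ (List.mem_map_of_mem h)

theorem length_foldl_interleave (fuel : List K) (v : List (List K)) (o : List K) :
    (fuel.foldl (fun (s : List (List K) × List K) _ =>
      (s.1.map List.tail, (s.1.map (List.headD · 0)).reverse ++ s.2)) (v, o)).2.length =
      v.length * fuel.length + o.length := by
  induction fuel generalizing v o with
  | nil => simp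
  | cons a fuel ih => rw [List.foldl_cons, ih]; simp; ring

/-- The image of a vector determines the vector. -/
theorem unflat_image {m : ℕ} {v : List (List K)} (hv : v.length = m) :
    unflat m (imgPoly (image v)) = vecPoly m v := by
  funext r
  ext k
  rw [coeff_unflat, image, imgPoly_trim, vecPoly, coeff_toPoly, imgPoly, coeff_toPoly]
  have hr : (r : ℕ) < v.length := hv ▸ r.2
  rcases lt_or_ge k v.flatten.length with hk | hk
  · obtain ⟨l, h1, h2⟩ := getD_foldl_interleave v.flatten v []
    rw [interleave, h1]
    simpa [← hv] using h2 r hr k hk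
  · rw [List.getD_eq_default, List.getD_eq_default]
    · rw [List.getD_eq_getElem _ _ hr]
      exact (length_le_flatten (List.getElem_mem _)).trans hk
    · rw [List.length_reverse, interleave, length_foldl_interleave, hv]
      have := Nat.mul_le_mul_left m hk
      rw [List.length_nil]
      omega

end Poly

/-! ### Lattice reduction -/

section Reduce

open scoped Classical

variable {K : Type*}

/-- The residue modulo `m` of the length of a nonzero image; there is none for the zero image. -/
def res (m : ℕ) (e : List K × List (List K)) : Option ℕ :=
  if e.1 = [] then none else some (e.1.length % m)

/-- The images of `z` and `e` do not allow a reduction: their lengths are incongruent modulo `m`, or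
one of them vanishes. -/
def NoConf (m : ℕ) (z e : List K × List (List K)) : Prop :=
  z.1 ≠ [] → e.1 ≠ [] → z.1.length % m ≠ e.1.length % m

/-- The sum of the lengths of the images; this is what the reduction diminishes. -/
def totalLength (l : List (List K × List (List K))) : ℕ := (l.map fun e => e.1.length).sum

theorem totalLength_cons (e : List K × List (List K)) (l : List (List K × List (List K))) :
    totalLength (e :: l) = e.1.length + totalLength l := by simp [totalLength]

theorem totalLength_append (l l' : List (List K × List (List K))) :
    totalLength (l ++ l') = totalLength l + totalLength l' := by simp [totalLength]

theorem totalLength_reverse (l : List (List K × List (List K))) :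
    totalLength l.reverse = totalLength l := by simp [totalLength]

theorem nodup_cons {m : ℕ} {z : List K × List (List K)} {E : List (List K × List (List K))}
    (hE : (E.filterMap (res m)).Nodup) (h : ∀ e ∈ E, NoConf m z e) :
    ((z :: E).filterMap (res m)).Nodup := by
  by_cases hz : z.1 = []
  · rwa [List.filterMap_cons_none (by rw [res, if_pos hz])]
  · rw [List.filterMap_cons_some (b := z.1.length % m) (by rw [res, if_neg hz]), List.nodup_cons]
    refine ⟨fun hmem => ?_, hE⟩
    obtain ⟨e, he, h1⟩ := List.mem_filterMap.1 hmem
    rw [res] at h1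
    split_ifs at h1 with h2
    exact h e he hz h2 (Option.some.inj h1).symm

variable [Field K]

/-- The two vectors of polynomials that a pair describes. -/
def sem (m r : ℕ) (e : List K × List (List K)) : (Fin m → K[X]) × (Fin r → K[X]) :=
  (unflat m (imgPoly e.1), vecPoly r e.2)

/-- The coefficient list of the image has no leading zeros, and the accompanying vector has `r`
entries. Hence the length of a nonzero image is its degree plus one. -/
structure Valid (r : ℕ) (e : List K × List (List K)) : Prop where
  lead : e.1 ≠ [] → e.1.headD 0 ≠ 0
  length : e.2.length = r

/-- The lattice that is spanned by a list of vectors. -/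
def spanOf (m r : ℕ) (l : List (List K × List (List K))) :
    Submodule K[X] ((Fin m → K[X]) × (Fin r → K[X])) :=
  Submodule.span K[X] {x | ∃ e ∈ l, sem m r e = x}

theorem spanOf_cons (m r : ℕ) (e : List K × List (List K)) (l : List (List K × List (List K))) :
    spanOf m r (e :: l) = Submodule.span K[X] {sem m r e} ⊔ spanOf m r l := by
  rw [spanOf, spanOf, ← Submodule.span_union]
  congr 1
  ext x
  simp [eq_comm]

theorem spanOf_append (m r : ℕ) (l l' : List (List K × List (List K))) :
    spanOf m r (l ++ l') = spanOf m r l ⊔ spanOf m r l' := by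
  rw [spanOf, spanOf, spanOf, ← Submodule.span_union]
  congr 1
  ext x
  simp [or_and_right, exists_or]

variable {m r : ℕ} {zs : List K}

theorem sem_shift (hzs : ∀ a ∈ zs, a = 0) (hm : zs.length = m) {e : List K × List (List K)}
    (he : e.2.length = r) : sem m r (shift zs e) = (X : K[X]) • sem m r e := by
  rw [sem, shift, imgPoly_append_zeros _ _ hzs, hm, unflat_X_pow_mul, vecPoly_shift r he]
  rfl

/-- A multiple of `e` by a power of `x`. -/
structure IsShift (m r j : ℕ) (e e' : List K × List (List K)) : Prop where
  sem : sem m r e' = (X : K[X]) ^ j • sem m r e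
  length_fst : e'.1.length = e.1.length + m * j
  length_snd : e'.2.length = r
  head : e.1 ≠ [] → e'.1.headD 0 = e.1.headD 0

theorem IsShift.refl {e : List K × List (List K)} (he : e.2.length = r) : IsShift m r 0 e e :=
  ⟨by simp, by simp, he, fun _ => rfl⟩

theorem IsShift.shift (hzs : ∀ a ∈ zs, a = 0) (hm : zs.length = m) {j : ℕ}
    {e e' : List K × List (List K)} (h : IsShift m r j e e') :
    IsShift m r (j + 1) e (shift zs e') where
  sem := by rw [sem_shift hzs hm h.length_snd, h.sem, smul_smul, pow_succ']
  length_fst := by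
    simp only [ExplicitIso.shift, List.length_append, h.length_fst, hm]
    ring
  length_snd := by simpa [ExplicitIso.shift] using h.length_snd
  head he := by
    rw [← h.head he]
    have : e'.1 ≠ [] := by
      intro h'
      have := h.length_fst
      rw [h', List.length_nil] at this
      exact he (List.length_eq_zero_iff.1 (by omega))
    obtain ⟨I, v⟩ := e'
    cases I with
    | nil => exact absurd rfl this
    | cons a I => rfl

/-- The alignment reaches the length of `z`, since there are as many rounds as `z` has coefficients,
and exceeds it by less than `m`. -/
theorem align_spec (hzs : ∀ a ∈ zs, a = 0) (hm : zs.length = m) (h0 : 0 < m)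
    {z e : List K × List (List K)} (he : e.2.length = r) (hl : e.1.length ≤ z.1.length) :
    ∃ j, IsShift m r j e (align zs z e) ∧ z.1.length ≤ (align zs z e).1.length ∧
      (align zs z e).1.length < z.1.length + m := by
  have key : ∀ (f : List K) (e' : List K × List (List K)) (j : ℕ), IsShift m r j e e' →
      e'.1.length < z.1.length + m →
      let e'' := f.foldl (fun e _ => if z.1.length ≤ e.1.length then e else shift zs e) e'
      ∃ j, IsShift m r j e e'' ∧ (z.1.length ≤ e''.1.length ∨ f.length ≤ e''.1.length) ∧
        (e'.1.length + f.length ≤ e''.1.length ∨ z.1.length ≤ e''.1.length) ∧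
        e''.1.length < z.1.length + m := by
    intro f
    induction f with
    | nil => exact fun e' j h h' => ⟨j, h, .inr (by simp), .inl (by simp), h'⟩
    | cons a f ih =>
      intro e' j h h'
      rw [List.foldl_cons]
      split_ifs with hc
      · obtain ⟨j', h1, h2, h3, h4⟩ := ih e' j h h'
        simp only [List.length_cons]
        refine ⟨j', h1, ?_, ?_, h4⟩ <;> omega
      · have e1 : (shift zs e').1.length = e'.1.length + m := by
          simp [shift, hm]
        obtain ⟨j', h1, h2, h3, h4⟩ := ih _ _ (h.shift hzs hm) (by omega)
        simp only [List.length_cons]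
        refine ⟨j', h1, ?_, ?_, h4⟩ <;> omega
  obtain ⟨j, h1, h2, -, h4⟩ := key z.1 e 0 (.refl he) (by omega)
  exact ⟨j, h1, by rw [align]; omega, h4⟩

theorem length_trim_lt {l : List K} (h : l ≠ []) (h0 : l.headD 0 = 0) :
    (trim l).length < l.length := by
  obtain ⟨⟨ws, -, h2⟩, h3⟩ := exists_append_trim l
  have e := congrArg List.length h2
  rw [List.length_append] at e
  have : ws ≠ [] := by
    rintro rfl
    rw [List.nil_append] at h2
    rw [← h2] at h3
    exact h3 h h0
  have := List.length_pos_iff.2 this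
  omega

theorem Valid.cancel {z e : List K × List (List K)} (hz : Valid r z) (he : Valid r e) :
    Valid r (cancel z e) where
  lead := (exists_append_trim _).2
  length := by
    simp [ExplicitIso.cancel, length_vecComb, hz.length, he.length]

theorem sem_cancel {z e : List K × List (List K)} (h : z.1.length = e.1.length) :
    sem m r (cancel z e) = C (e.1.headD 0) • sem m r z - C (z.1.headD 0) • sem m r e := by
  rw [sem, cancel, imgPoly_trim, imgPoly_polyComb _ _ _ _ h, unflat_sub, vecPoly_vecComb]
  rfl

theorem length_cancel_lt {z e : List K × List (List K)} (h : z.1.length = e.1.length)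
    (hz : z.1 ≠ []) : (cancel z e).1.length < z.1.length := by
  have hl : (polyComb (e.1.headD 0) z.1 (z.1.headD 0) e.1).length = z.1.length := by
    rw [length_polyComb, h, max_self]
  refine (length_trim_lt ?_ ?_).trans_eq hl
  · intro h'
    rw [h', List.length_nil] at hl
    exact hz (List.length_eq_zero_iff.1 hl.symm)
  · obtain ⟨I, v⟩ := z
    obtain ⟨J, w⟩ := e
    cases I with
    | nil => exact absurd rfl hz
    | cons a I =>
      cases J with
      | nil => simp at h
      | cons b J =>
        rw [polyComb, polySub, zipPad_eq_zip _ _ _ _ (by simpa using h)]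
        simp [mul_comm]

/-- Elimination does not change the lattice, since the factor `a` of the vector that is replaced is
invertible. -/
theorem span_smul_sub_sup {R M : Type*} [CommRing R] [AddCommGroup M] [Module R M] {a : R}
    (ha : IsUnit a) (b : R) (x y : M) :
    Submodule.span R {a • x - b • y} ⊔ Submodule.span R {y} =
      Submodule.span R {x} ⊔ Submodule.span R {y} := by
  have hy : ∀ (c : R) (N : Submodule R M), c • y ∈ N ⊔ Submodule.span R {y} := fun c N =>
    Submodule.smul_mem _ _ (Submodule.mem_sup_right (Submodule.mem_span_singleton_self _))
  apply le_antisymm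
  · refine sup_le ?_ le_sup_right
    rw [Submodule.span_singleton_le_iff_mem]
    exact Submodule.sub_mem _ (Submodule.smul_mem _ _ (Submodule.mem_sup_left
      (Submodule.mem_span_singleton_self _))) (hy _ _)
  · refine sup_le ?_ le_sup_right
    rw [Submodule.span_singleton_le_iff_mem, ← Submodule.smul_mem_iff_of_isUnit _ ha]
    have h := Submodule.add_mem _ (Submodule.mem_sup_left (T := Submodule.span R {y})
      (Submodule.mem_span_singleton_self (R := R) (a • x - b • y))) (hy b _)
    rwa [sub_add_cancel] at h

/-- Either nothing happens, and the two images do not allow a reduction; or the lattice and the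
residue in the list remain the same, and the sum of the lengths of the two images becomes smaller.
-/
theorem passStep_spec (hzs : ∀ a ∈ zs, a = 0) (hm : zs.length = m) (h0 : 0 < m)
    {z e : List K × List (List K)} (hz : Valid r z) (he : Valid r e)
    (E : List (List K × List (List K))) :
    (passStep zs (z, E) e = (z, e :: E) ∧ NoConf m z e) ∨
    ∃ z' e', passStep zs (z, E) e = (z', e' :: E) ∧ ¬ NoConf m z e ∧ Valid r z' ∧ Valid r e' ∧
      res m e' = res m e ∧ z'.1.length + e'.1.length < z.1.length + e.1.length ∧
      Submodule.span K[X] {sem m r z'} ⊔ Submodule.span K[X] {sem m r e'} =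
        Submodule.span K[X] {sem m r z} ⊔ Submodule.span K[X] {sem m r e} := by
  -- the case where it is known which one of the two images is the longer one
  have key : ∀ big small : List K × List (List K), Valid r big → Valid r small →
      small.1.length ≤ big.1.length →
      let sm := align zs big small
      let cond := isCons small.1 && (decide (big.1.length ≤ sm.1.length) &&
        decide (sm.1.length ≤ big.1.length))
      (cond = false ∧ NoConf m big small) ∨ (cond = true ∧ small.1 ≠ [] ∧ big.1 ≠ [] ∧
        small.1.length % m = big.1.length % m ∧ Valid r (cancel big sm) ∧
        (cancel big sm).1.length < big.1.length ∧
        Submodule.span K[X] {sem m r (cancel big sm)} ⊔ Submodule.span K[X] {sem m r small} =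
        Submodule.span K[X] {sem m r big} ⊔ Submodule.span K[X] {sem m r small}) := by
    intro big small hb hs hle sm cond
    obtain ⟨j, h1, h2, h3⟩ := align_spec hzs hm h0 hs.length hle
    change IsShift m r j small sm at h1
    change big.1.length ≤ sm.1.length at h2
    change sm.1.length < _ at h3
    by_cases hn : small.1 = []
    · left
      exact ⟨by simp [cond, hn, isCons], fun _ h => absurd hn h⟩
    have hbn : big.1 ≠ [] := by
      intro h
      rw [h, List.length_nil] at hle
      exact hn (List.length_eq_zero_iff.1 (by omega))
    by_cases hc : sm.1.length ≤ big.1.length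
    · right
      have heq : big.1.length = sm.1.length := le_antisymm h2 hc
      have hhead := h1.head hn
      have hsm : Valid r sm := ⟨fun _ => hhead ▸ hs.lead hn, h1.length_snd⟩
      refine ⟨?_, hn, hbn, ?_, hb.cancel hsm, length_cancel_lt heq hbn, ?_⟩
      · simp only [cond, h2, hc, decide_true, Bool.and_true]
        cases hh : small.1 with
        | nil => exact absurd hh hn
        | cons a l => rfl
      · rw [heq, h1.length_fst, Nat.add_mul_mod_self_left]
      · rw [sem_cancel heq, hhead, h1.sem]
        have hu := hs.lead hn
        set a := small.1.headD 0
        set b := big.1.headD 0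
        rw [smul_smul]
        exact span_smul_sub_sup (isUnit_C.2 hu.isUnit) _ _ _
    · left
      refine ⟨by simp [cond, hc], fun _ _ hmod => hc ?_⟩
      -- congruent lengths that differ by less than `m` are equal
      have h4 := h1.length_fst
      rw [h4] at h2 h3 ⊢
      have h5 : big.1.length ≡ small.1.length + m * j [MOD m] := by
        rw [Nat.ModEq, hmod, Nat.add_mul_mod_self_left]
      obtain ⟨k, hk⟩ := (Nat.modEq_iff_dvd' h2).1 h5
      have : k < 1 := by
        by_contra hk1
        have := Nat.mul_le_mul_left m (not_lt.1 hk1)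
        omega
      obtain rfl : k = 0 := by omega
      omega
  have hsymm : ∀ {z e : List K × List (List K)}, NoConf m z e → NoConf m e z :=
    fun h h1 h2 h3 => h h2 h1 h3.symm
  simp only [passStep]
  by_cases hle : e.1.length ≤ z.1.length
  · simp only [if_pos hle]
    rcases key z e hz he hle with ⟨h1, h2⟩ | ⟨h1, h2, h3, h4, h5, h6, h7⟩
    · left
      exact ⟨by rw [h1]; rfl, h2⟩
    · right
      refine ⟨_, _, by rw [if_pos h1], fun h => h h3 h2 h4.symm, h5, he, rfl, by omega, h7⟩
  · simp only [if_neg hle]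
    rcases key e z he hz (by omega) with ⟨h1, h2⟩ | ⟨h1, h2, h3, h4, h5, h6, h7⟩
    · left
      exact ⟨by rw [h1]; rfl, hsymm h2⟩
    · right
      refine ⟨_, _, by rw [if_pos h1], fun h => h h2 h3 h4, h5, hz, ?_, by omega, ?_⟩
      · rw [res, res, if_neg h2, if_neg h3, h4]
      · rw [h7, sup_comm]

/-- Either a pass changes nothing, and the new vector allows no reduction with any vector in the
list; or the total length becomes smaller. In both cases the residues in the list are the same as
before, up to the order, so that they remain distinct. -/
theorem pass_spec (hzs : ∀ a ∈ zs, a = 0) (hm : zs.length = m) (h0 : 0 < m)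
    {z : List K × List (List K)} {E : List (List K × List (List K))} (hz : Valid r z)
    (hE : ∀ e ∈ E, Valid r e) :
    ((pass zs (z, E) = (z, E.reverse) ∧ ∀ e ∈ E, NoConf m z e) ∨
      ((∃ e ∈ E, ¬ NoConf m z e) ∧ (pass zs (z, E)).1.1.length + totalLength (pass zs (z, E)).2 <
        z.1.length + totalLength E)) ∧
    Valid r (pass zs (z, E)).1 ∧ (∀ e ∈ (pass zs (z, E)).2, Valid r e) ∧
    (pass zs (z, E)).2.map (res m) = (E.map (res m)).reverse ∧
    spanOf m r ((pass zs (z, E)).1 :: (pass zs (z, E)).2) = spanOf m r (z :: E) := by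
  have key : ∀ (E acc : List (List K × List (List K))) (z : List K × List (List K)), Valid r z →
      (∀ e ∈ E, Valid r e) → (∀ e ∈ acc, Valid r e) →
      let s := E.foldl (passStep zs) (z, acc)
      ((s = (z, E.reverse ++ acc) ∧ ∀ e ∈ E, NoConf m z e) ∨
        ((∃ e ∈ E, ¬ NoConf m z e) ∧ s.1.1.length + totalLength s.2 <
          z.1.length + totalLength E + totalLength acc)) ∧
      Valid r s.1 ∧ (∀ e ∈ s.2, Valid r e) ∧
      s.2.map (res m) = (E.map (res m)).reverse ++ acc.map (res m) ∧
      Submodule.span K[X] {sem m r s.1} ⊔ spanOf m r s.2 =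
        Submodule.span K[X] {sem m r z} ⊔ spanOf m r E ⊔ spanOf m r acc := by
    intro E
    induction E with
    | nil =>
      intro acc z hz _ ha
      refine ⟨.inl ⟨rfl, by simp⟩, hz, ha, by simp, ?_⟩
      simp [spanOf]
    | cons e E ih =>
      intro acc z hz hE ha
      have he := hE e (by simp)
      have hE' : ∀ e ∈ E, Valid r e := fun e he => hE e (by simp [he])
      rw [List.foldl_cons]
      rcases passStep_spec hzs hm h0 hz he acc with ⟨h1, h2⟩ | ⟨z', e', h1, h2, h3, h4, h5, h6, h7⟩
      · rw [h1]
        obtain ⟨i1, i2, i3, i4, i5⟩ := ih (e :: acc) z hz hE' (by simpa [he] using ha)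
        refine ⟨?_, i2, i3, by simpa using i4, ?_⟩
        · rcases i1 with ⟨i1, i1'⟩ | ⟨⟨e1, h8, h9⟩, i1⟩
          · left
            exact ⟨by simpa using i1, by simpa [h2] using i1'⟩
          · right
            refine ⟨⟨e1, by simp [h8], h9⟩, ?_⟩
            rw [totalLength_cons] at i1 ⊢
            omega
        · rw [i5, spanOf_cons, spanOf_cons]
          ac_rfl
      · rw [h1]
        obtain ⟨i1, i2, i3, i4, i5⟩ := ih (e' :: acc) z' h3 hE' (by simpa [h4] using ha)
        refine ⟨.inr ⟨⟨e, by simp, h2⟩, ?_⟩, i2, i3, by simpa [h5] using i4, ?_⟩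
        · rcases i1 with ⟨i1, -⟩ | ⟨-, i1⟩
          · rw [i1]
            simp only [totalLength_cons, totalLength_append, totalLength_reverse]
            omega
          · rw [totalLength_cons] at i1 ⊢
            omega
        · rw [i5, spanOf_cons, spanOf_cons]
          rw [show ∀ a b c d : Submodule K[X] ((Fin m → K[X]) × (Fin r → K[X])),
            a ⊔ b ⊔ (c ⊔ d) = (a ⊔ c) ⊔ b ⊔ d from fun a b c d => by ac_rfl, h7]
          ac_rfl
  obtain ⟨i1, i2, i3, i4, i5⟩ := key E [] z hz hE (by simp)
  rw [show pass zs (z, E) = E.foldl (passStep zs) (z, []) from rfl]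
  refine ⟨?_, i2, i3, by simpa using i4, ?_⟩
  · simpa [totalLength] using i1
  · rw [spanOf_cons, spanOf_cons]
    simpa [spanOf] using i5

/-- If there are as many passes as the total length of the images, one of them changes nothing, and
the residue of the new vector differs from those in the list. -/
theorem insertVec_spec (hzs : ∀ a ∈ zs, a = 0) (hm : zs.length = m) (h0 : 0 < m) {fuel : List K}
    {z : List K × List (List K)} {E : List (List K × List (List K))} (hz : Valid r z)
    (hE : ∀ e ∈ E, Valid r e) (hd : (E.filterMap (res m)).Nodup)
    (hf : z.1.length + totalLength E ≤ fuel.length) :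
    (insertVec zs fuel E z).length = E.length + 1 ∧ (∀ e ∈ insertVec zs fuel E z, Valid r e) ∧
    ((insertVec zs fuel E z).filterMap (res m)).Nodup ∧
    totalLength (insertVec zs fuel E z) ≤ z.1.length + totalLength E ∧
    spanOf m r (insertVec zs fuel E z) = spanOf m r (z :: E) := by
  have key : ∀ (f : List K) (s : (List K × List (List K)) × List (List K × List (List K))),
      Valid r s.1 → (∀ e ∈ s.2, Valid r e) → (s.2.filterMap (res m)).Nodup →
      let s' := f.foldl (fun s _ => pass zs s) s
      s'.2.length = s.2.length ∧ Valid r s'.1 ∧ (∀ e ∈ s'.2, Valid r e) ∧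
      (s'.2.filterMap (res m)).Nodup ∧
      ((∀ e ∈ s'.2, NoConf m s'.1 e) ∨
        s'.1.1.length + totalLength s'.2 + f.length ≤ s.1.1.length + totalLength s.2) ∧
      s'.1.1.length + totalLength s'.2 ≤ s.1.1.length + totalLength s.2 ∧
      spanOf m r (s'.1 :: s'.2) = spanOf m r (s.1 :: s.2) := by
    intro f
    induction f using List.reverseRecOn with
    | nil => exact fun s h1 h2 h3 => ⟨rfl, h1, h2, h3, .inr (by simp), le_rfl, rfl⟩
    | append_singleton f a ih =>
      intro s h1 h2 h3
      rw [List.foldl_append, List.foldl_cons, List.foldl_nil]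
      obtain ⟨i0, i1, i2, i3, i4, i5, i6⟩ := ih s h1 h2 h3
      set s' := f.foldl (fun s _ => pass zs s) s
      obtain ⟨j1, j2, j3, j4, j5⟩ := pass_spec hzs hm h0 i1 i2
      have hl := congrArg List.length j4
      simp only [List.length_map, List.length_reverse] at hl
      rw [show ((s'.1, s'.2) : _ × _) = s' from rfl] at *
      refine ⟨hl.trans i0, j2, j3, ?_, ?_, ?_, j5.trans i6⟩
      · have e1 : ∀ l : List (List K × List (List K)),
            l.filterMap (res m) = (l.map (res m)).filterMap id := fun l => by
          rw [List.filterMap_map]; rfl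
        rw [e1, j4, List.filterMap_reverse, List.nodup_reverse, ← e1]
        exact i3
      · rcases j1 with ⟨j1, j1'⟩ | ⟨⟨e, he, j1⟩, j1'⟩
        · left
          rw [j1]
          simpa using j1'
        · right
          rcases i4 with i4 | i4
          · exact absurd (i4 e he) j1
          · rw [List.length_append, List.length_singleton]
            omega
      · rcases j1 with ⟨j1, -⟩ | ⟨-, j1⟩
        · rw [j1, totalLength_reverse]
          exact i5
        · omega
  obtain ⟨i0, i1, i2, i3, i4, i5, i6⟩ := key fuel (z, E) hz hE hd
  simp only [insertVec]
  set s' := fuel.foldl (fun s _ => pass zs s) (z, E)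
  refine ⟨by simpa using i0, by simpa [i1] using i2, nodup_cons i3 ?_, ?_, i6⟩
  · rcases i4 with i4 | i4
    · exact i4
    · intro e he h
      have := List.length_pos_iff.2 h
      dsimp only at i4
      omega
  · rw [totalLength_cons]
    exact i5

/-- The reduced list spans the same lattice, and the residues of the nonzero images are distinct. -/
theorem reduceList_spec (hzs : ∀ a ∈ zs, a = 0) (hm : zs.length = m) (h0 : 0 < m)
    {L : List (List K × List (List K))} (hL : ∀ e ∈ L, Valid r e) :
    (reduceList zs L).length = L.length ∧ (∀ e ∈ reduceList zs L, Valid r e) ∧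
    ((reduceList zs L).filterMap (res m)).Nodup ∧
    spanOf m r (reduceList zs L) = spanOf m r L := by
  have key : ∀ (fuel : List K) (L : List (List K × List (List K))), (∀ e ∈ L, Valid r e) →
      totalLength L ≤ fuel.length →
      let R := L.foldl (insertVec zs fuel) []
      R.length = L.length ∧ (∀ e ∈ R, Valid r e) ∧ (R.filterMap (res m)).Nodup ∧
      totalLength R ≤ totalLength L ∧ spanOf m r R = spanOf m r L := by
    intro fuel L
    induction L using List.reverseRecOn with
    | nil => intro _ _; simp
    | append_singleton L z ih =>
      intro hL hf
      rw [totalLength_append, totalLength_cons] at hf ⊢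
      obtain ⟨i1, i2, i3, i4, i5⟩ := ih (fun e he => hL e (by simp [he])) (by omega)
      rw [List.foldl_append, List.foldl_cons, List.foldl_nil]
      obtain ⟨j1, j2, j3, j4, j5⟩ := insertVec_spec hzs hm h0 (fuel := fuel)
        (hL z (by simp)) i2 i3 (by omega)
      refine ⟨by simp [j1, i1], j2, j3, by omega, ?_⟩
      rw [j5, spanOf_cons, i5, spanOf_append, spanOf_cons, sup_comm]
      simp [spanOf]
  obtain ⟨h1, h2, h3, -, h5⟩ := key (L.map Prod.fst).flatten L hL (by
    simp [totalLength, List.length_flatten, Function.comp_def])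
  exact ⟨h1, h2, h3, h5⟩

end Reduce

/-! ### The vectors that the algorithm computes -/

theorem exists_eq_ofFn {α : Type*} {l : List α} {N : ℕ} (h : l.length = N) :
    ∃ f : Fin N → α, l = List.ofFn f := by
  subst h
  exact ⟨l.get, (List.ofFn_get l).symm⟩

theorem zipPad_eq_ofFn {α β : Type*} (a : α) (b : β) {l : List α} {l' : List β} {N : ℕ}
    (h : l.length = N) (h' : l'.length = N) :
    zipPad a b l l' = List.ofFn fun i : Fin N => (l.getD i a, l'.getD i b) := by
  refine List.ext_getElem (by simp [length_zipPad, h, h']) fun i h1 h2 => ?_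
  rw [← List.getD_eq_getElem _ (a, b) h1, getD_zipPad]
  simp

/-- The unit vectors: as polynomials, they are the standard basis. -/
theorem unitVecs_spec (K : Type*) [Field K] {α : Type*} (l : List α) :
    (unitVecs (K := K) l).length = l.length ∧ ∀ i < l.length,
      ((unitVecs (K := K) l).getD i []).length = l.length ∧
      ∀ j, ((unitVecs (K := K) l).getD i []).getD j [] = if i = j then [1] else [] := by
  set F : List (List K) × List (List (List K)) → α → List (List K) × List (List (List K)) :=
    fun s _ => ([] :: s.1, ([1] :: s.1) :: s.2.map ([] :: ·)) with hF
  have key : ∀ l : List α, (l.foldl F ([], [])).1 = List.replicate l.length [] ∧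
      (l.foldl F ([], [])).2.length = l.length ∧ ∀ i < l.length,
      (((l.foldl F ([], [])).2).getD i []).length = l.length ∧
      ∀ j, (((l.foldl F ([], [])).2).getD i []).getD j [] = if i = j then [1] else [] := by
    intro l
    induction l using List.reverseRecOn with
    | nil => simp
    | append_singleton l a ih =>
      obtain ⟨h1, h2, h3⟩ := ih
      rw [List.foldl_append, List.foldl_cons, List.foldl_nil, List.length_append,
        List.length_singleton]
      set s := l.foldl F ([], [])
      refine ⟨by simp [hF, h1, List.replicate_succ], by simp [hF, h2], fun i hi => ?_⟩
      cases i with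
      | zero =>
        refine ⟨by simp [hF, h1], fun j => ?_⟩
        cases j with
        | zero => simp [hF]
        | succ j =>
          simp only [hF, h1, List.getD_cons_zero, List.getD_cons_succ]
          simp
      | succ i =>
        obtain ⟨h4, h5⟩ := h3 i (by omega)
        have e : (F s a).2.getD (i + 1) [] = [] :: s.2.getD i [] := by
          have hi' : i < s.2.length := by omega
          simp [hF, hi']
        rw [e]
        refine ⟨by rw [List.length_cons, h4], fun j => ?_⟩
        cases j with
        | zero => simp
        | succ j => rw [List.getD_cons_succ, h5]; simp
  exact (key l).2

section Solve

open scoped Classical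

variable {K : Type*} [Field K] {m r : ℕ} {zs : List K}

theorem spanOf_ofFn {N : ℕ} (e : Fin N → List K × List (List K)) :
    spanOf m r (List.ofFn e) = Submodule.span K[X] (Set.range fun i => sem m r (e i)) := by
  rw [spanOf]
  congr 1
  ext x
  simp [List.mem_ofFn]

/-- Lattice reduction of the images of the vectors `x`, accompanied by the vectors `w`. -/
theorem reduceList_ofFn (hzs : ∀ a ∈ zs, a = 0) (hm : zs.length = m) (h0 : 0 < m) {N : ℕ}
    {x w : List (List (List K))} (hx : x.length = N) (hw : w.length = N)
    (hxm : ∀ c ∈ x, c.length = m) (hwr : ∀ c ∈ w, c.length = r) :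
    ∃ e : Fin N → List K × List (List K),
      reduceList zs (zipPad [] [] (x.map image) w) = List.ofFn e ∧
      (∀ i, Valid r (e i)) ∧
      (∀ i j, (e i).1 ≠ [] → (e i).1.length % m = (e j).1.length % m → (e j).1 ≠ [] → i = j) ∧
      Submodule.span K[X] (Set.range fun i => sem m r (e i)) =
        Submodule.span K[X] (Set.range fun i : Fin N =>
          (vecPoly m (x.getD i []), vecPoly r (w.getD i []))) := by
  have hx' : (x.map image).length = N := by simpa using hx
  have e1 := zipPad_eq_ofFn [] [] hx' hw
  have him : ∀ i : Fin N, (x.map image).getD i [] = image (x.getD i []) := fun i => by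
    have : (i : ℕ) < x.length := hx ▸ i.2
    simp [this]
  have hxi : ∀ i : Fin N, (x.getD i []).length = m := fun i => by
    rw [List.getD_eq_getElem _ _ (hx ▸ i.2)]
    exact hxm _ (List.getElem_mem _)
  have hwi : ∀ i : Fin N, (w.getD i []).length = r := fun i => by
    rw [List.getD_eq_getElem _ _ (hw ▸ i.2)]
    exact hwr _ (List.getElem_mem _)
  obtain ⟨h1, h2, h3, h4⟩ := reduceList_spec (r := r) hzs hm h0
    (L := zipPad [] [] (x.map image) w) (by
      rw [e1]
      intro e he
      obtain ⟨i, rfl⟩ := (List.mem_ofFn' _ _).1 he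
      refine ⟨?_, hwi i⟩
      dsimp only
      rw [him]
      exact (exists_append_trim _).2)
  rw [e1] at h1 h4
  rw [List.length_ofFn] at h1
  obtain ⟨e, he⟩ := exists_eq_ofFn h1
  rw [← e1] at he
  refine ⟨e, he, ?_, ?_, ?_⟩
  · intro i
    exact h2 _ (by rw [he]; exact (List.mem_ofFn' _ _).2 ⟨i, rfl⟩)
  · rw [he] at h3
    intro i j hi hij hj
    by_contra hne
    rw [List.Nodup, List.pairwise_filterMap, List.pairwise_ofFn] at h3
    rcases lt_or_gt_of_ne hne with hlt | hlt
    · exact h3 hlt _ (if_neg hi) _ (if_neg hj) hij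
    · exact h3 hlt _ (if_neg hj) _ (if_neg hi) hij.symm
  · rw [← e1, he, spanOf_ofFn, e1, spanOf_ofFn] at h4
    rw [h4]
    congr 2
    funext i
    rw [sem]
    dsimp only
    rw [him, unflat_image (hxi i)]

theorem imgPoly_nil : imgPoly ([] : List K) = 0 := rfl

theorem unflat_zero : unflat m (0 : K[X]) = 0 := by
  funext r
  ext k
  simp [coeff_unflat]

theorem exists_mem_foldl_isCons {R : List (List K × List (List K))} (h : ∃ e ∈ R, e.1 = []) :
    ∃ e ∈ R, e.1 = [] ∧ R.foldl (fun s e => if isCons e.1 = true then s else e.2) [] = e.2 := by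
  induction R using List.reverseRecOn with
  | nil => simp at h
  | append_singleton R a ih =>
    rw [List.foldl_append, List.foldl_cons, List.foldl_nil]
    rcases ha : a.1 with _ | ⟨c, I⟩
    · exact ⟨a, by simp, ha, rfl⟩
    · obtain ⟨e, he, he'⟩ := h
      have : e ∈ R := by
        rcases List.mem_append.1 he with he | he
        · exact he
        · obtain rfl := List.mem_singleton.1 he
          rw [ha] at he'
          exact absurd he' (List.cons_ne_nil _ _)
      obtain ⟨e, he, h1, h2⟩ := ih ⟨e, this, he'⟩
      exact ⟨e, by simp [he], h1, h2⟩

/-- The columns of `U` and the vector `b` are `m + 1` vectors in a module of rank `m`. After the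
reduction one of the images vanishes, since the lengths of the nonzero images are incongruent
modulo `m`, and the vector that accompanies it is a nontrivial relation. -/
theorem solve_spec (hzs : ∀ a ∈ zs, a = 0) (hm : zs.length = m) (h0 : 0 < m)
    {U : List (List (List K))} {b : List (List K)} (hU : U.length = m)
    (hU' : ∀ c ∈ U, c.length = m) (hb : b.length = m)
    (hi : LinearIndependent K[X] fun l : Fin m => vecPoly m (U.getD l [])) :
    (solve zs U b).1.length = m ∧ toPoly (solve zs U b).2 ≠ 0 ∧
    ∑ l : Fin m, toPoly ((solve zs U b).1.getD l []) • vecPoly m (U.getD l []) +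
      toPoly (solve zs U b).2 • vecPoly m b = 0 := by
  have hx : (b :: U).length = m + 1 := by simp [hU]
  obtain ⟨hw1, hw2⟩ := unitVecs_spec K (b :: U)
  rw [hx] at hw1 hw2
  obtain ⟨e, he1, he2, he3, he4⟩ := reduceList_ofFn (r := m + 1) hzs hm h0 (N := m + 1) hx hw1
    (by simpa [hb] using hU') (fun c hc => by
      obtain ⟨i, hi, rfl⟩ := List.mem_iff_getElem.1 hc
      rw [← List.getD_eq_getElem _ [] hi]
      exact (hw2 i (by omega)).1)
  have hunit : ∀ i : Fin (m + 1),
      vecPoly (m + 1) ((unitVecs (K := K) (b :: U)).getD i []) = Pi.single i 1 := by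
    intro i
    funext j
    rw [vecPoly, (hw2 i i.2).2, Pi.single_apply]
    simp only [Fin.val_inj, eq_comm (a := i)]
    split_ifs <;> simp [toPoly_cons]
  simp only [hunit] at he4
  -- each vector in the list is the combination of the columns of `b :: U` that its companion says
  set φ := Fintype.linearCombination K[X]
    (fun i : Fin (m + 1) => vecPoly m ((b :: U).getD i [])) with hφ
  have hrel : ∀ i, (sem m (m + 1) (e i)).1 = φ (sem m (m + 1) (e i)).2 := by
    intro i
    have hle : Submodule.span K[X] (Set.range fun i : Fin (m + 1) =>
        (vecPoly m ((b :: U).getD i []), (Pi.single i 1 : Fin (m + 1) → K[X]))) ≤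
        LinearMap.eqLocus (LinearMap.fst K[X] _ _) (φ ∘ₗ LinearMap.snd K[X] _ _) := by
      rw [Submodule.span_le]
      rintro _ ⟨k, rfl⟩
      rw [SetLike.mem_coe, LinearMap.mem_eqLocus]
      simp [hφ]
    exact (LinearMap.mem_eqLocus).1
      (hle (he4 ▸ Submodule.subset_span (Set.mem_range_self i)))
  have hspan : Submodule.span K[X] (Set.range fun i => vecPoly (m + 1) (e i).2) = ⊤ := by
    have h := congrArg (Submodule.map (LinearMap.snd K[X] _ _)) he4
    rw [Submodule.map_span, Submodule.map_span, ← Set.range_comp, ← Set.range_comp] at h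
    refine h.trans ?_
    have := (Pi.basisFun K[X] (Fin (m + 1))).span_eq
    convert this using 3
    funext i
    simp
  have hli := linearIndependent_of_top_le_span_of_card_eq_finrank hspan.ge (by simp)
  -- there are only `m` residues for `m + 1` images
  have hex : ∃ x ∈ List.ofFn e, x.1 = [] := by
    by_contra hno
    push Not at hno
    have hne : ∀ i, (e i).1 ≠ [] := fun i => hno _ ((List.mem_ofFn' _ _).2 ⟨i, rfl⟩)
    have hinj : Function.Injective
        (fun i : Fin (m + 1) => (⟨(e i).1.length % m, Nat.mod_lt _ h0⟩ : Fin m)) :=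
      fun i j h => he3 i j (hne i) (Fin.mk.inj_iff.1 h) (hne j)
    simpa using Fintype.card_le_of_injective _ hinj
  obtain ⟨x, hx1, hx2, hx3⟩ := exists_mem_foldl_isCons hex
  obtain ⟨i, rfl⟩ := (List.mem_ofFn' _ _).1 hx1
  have hs : solve zs U b = ((e i).2.tail, (e i).2.headD []) := by
    rw [solve, he1, hx3]
  have h1 := hrel i
  rw [sem, hx2, imgPoly_nil, unflat_zero] at h1
  have h2 : ∑ l : Fin m, toPoly ((e i).2.tail.getD l []) • vecPoly m (U.getD l []) +
      toPoly ((e i).2.headD []) • vecPoly m b = 0 := by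
    refine Eq.trans ?_ (show φ (vecPoly (m + 1) (e i).2) = 0 from h1.symm)
    rw [hφ, Fintype.linearCombination_apply, Fin.sum_univ_succ, add_comm]
    cases (e i).2 <;> simp [vecPoly]
  rw [hs]
  refine ⟨by simp [(he2 i).length], fun hD => hli.ne_zero i ?_, h2⟩
  dsimp only at hD
  rw [hD, zero_smul, add_zero] at h2
  have h3 := Fintype.linearIndependent_iff.1 hi _ h2
  funext k
  refine Fin.cases ?_ (fun l => ?_) k
  · refine Eq.trans ?_ hD
    cases (e i).2 <;> simp [vecPoly]
  · refine Eq.trans ?_ (h3 l)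
    cases (e i).2 <;> simp [vecPoly]

/-- The list `powers zs l e` consists of the products of `e` with `x ^ j` for those `j` for which
the image is at most as long as `l`. -/
theorem powers_spec (hzs : ∀ a ∈ zs, a = 0) (hm : zs.length = m) (h0 : 0 < m) (l : List K)
    {e : List K × List (List K)} (he : e.1 ≠ []) (her : e.2.length = r) :
    ∃ (k : ℕ) (f : ℕ → List (List K)), powers zs l e = (List.range k).reverse.map f ∧
      (∀ j, (f j).length = r ∧ vecPoly r (f j) = (X : K[X]) ^ j • vecPoly r e.2) ∧
      ∀ j, j < k ↔ e.1.length + m * j ≤ l.length := by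
  have hsh : ∀ j, IsShift m r j e ((shift zs)^[j] e) := by
    intro j
    induction j with
    | zero => exact .refl her
    | succ j ih => rw [Function.iterate_succ_apply']; exact ih.shift hzs hm
  have hpos := List.length_pos_iff.2 he
  have key : ∀ l' : List K, ∃ k,
      l'.foldl (fun (s : (List K × List (List K)) × List (List (List K))) _ =>
        if s.1.1.length ≤ l.length then (shift zs s.1, s.1.2 :: s.2) else s) (e, []) =
        ((shift zs)^[k] e, (List.range k).reverse.map fun j => ((shift zs)^[j] e).2) ∧
      (∀ j < k, e.1.length + m * j ≤ l.length) ∧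
      (k = l'.length ∨ l.length < e.1.length + m * k) := by
    intro l'
    induction l' using List.reverseRecOn with
    | nil => exact ⟨0, rfl, by simp, .inl rfl⟩
    | append_singleton l' a ih =>
      obtain ⟨k, h1, h2, h3⟩ := ih
      rw [List.foldl_append, List.foldl_cons, List.foldl_nil, h1]
      have hk := (hsh k).length_fst
      dsimp only
      rw [hk]
      split_ifs with hc
      · refine ⟨k + 1, ?_, ?_, .inl ?_⟩
        · rw [Function.iterate_succ_apply', List.range_succ]
          simp
        · intro j hj
          have := Nat.mul_le_mul_left m (Nat.le_of_lt_succ hj)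
          omega
        · simp only [List.length_append, List.length_singleton]
          omega
      · exact ⟨k, rfl, h2, .inr (by omega)⟩
  obtain ⟨k, h1, h2, h3⟩ := key l
  refine ⟨k, fun j => ((shift zs)^[j] e).2, ?_, fun j => ⟨(hsh j).length_snd, ?_⟩,
    fun j => ⟨h2 j, fun hj => ?_⟩⟩
  · rw [powers, h1]
  · exact congrArg Prod.snd (hsh j).sem
  · by_contra hk
    have h4 := Nat.mul_le_mul_left m (not_lt.1 hk)
    have h5 : k ≤ m * k := Nat.le_mul_of_pos_left _ h0
    omega

theorem natDegree_imgPoly {I : List K} (hI : I ≠ []) (h : I.headD 0 ≠ 0) :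
    (imgPoly I).natDegree + 1 = I.length ∧ imgPoly I ≠ 0 := by
  cases I with
  | nil => exact absurd rfl hI
  | cons a I =>
    have h1 : (imgPoly (a :: I)).coeff I.length ≠ 0 := by
      rw [coeff_imgPoly_length]
      exact h
    have h2 := le_natDegree_of_ne_zero h1
    have h3 : (imgPoly (a :: I)).natDegree < (a :: I).length := by
      by_contra h4
      refine h1 ?_
      have h5 : imgPoly (a :: I) = 0 := leadingCoeff_eq_zero.1 (coeff_imgPoly_of_le _ (not_lt.1 h4))
      rw [h5, coeff_zero]
    rw [List.length_cons] at h3 ⊢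
    exact ⟨by omega, fun h0 => h1 (by rw [h0, coeff_zero])⟩

theorem length_trim_reverse {l : List K} (h : toPoly l ≠ 0) :
    (trim l.reverse).length = (toPoly l).natDegree + 1 := by
  have e : imgPoly (trim l.reverse) = toPoly l := by
    rw [imgPoly_trim, imgPoly, List.reverse_reverse]
  have hne : trim l.reverse ≠ [] := by
    intro h'
    rw [h', imgPoly_nil] at e
    exact h e.symm
  rw [← e, (natDegree_imgPoly hne ((exists_append_trim _).2 hne)).1]

/-- The result of the algorithm over `K[x]`: the vectors `T i` form a basis of the lattice that is
spanned by the columns of `B`, their coordinate vectors with respect to the columns of `U` are the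
`- unflat m (F i) / D`, and the degrees of the polynomials `F i` are incongruent modulo `m`. -/
theorem mainPoly_spec (h0 : 0 < m) {B U : List (List (List K))} (hB : B.length = m)
    (hB' : ∀ c ∈ B, c.length = m) (hU : U.length = m) (hU' : ∀ c ∈ U, c.length = m)
    (hBi : LinearIndependent K[X] fun l : Fin m => vecPoly m (B.getD l []))
    (hUi : LinearIndependent K[X] fun l : Fin m => vecPoly m (U.getD l [])) :
    ∃ (D : K[X]) (F : Fin m → K[X]) (T : Fin m → Fin m → K[X]) (k : Fin m → ℕ)
      (out : Fin m → ℕ → List (List K)), D ≠ 0 ∧ (∀ i, F i ≠ 0) ∧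
      mainPoly B U =
        (List.finRange m).flatMap (fun i => (List.range (k i)).reverse.map (out i)) ∧
      (∀ i j, (out i j).length = m ∧ vecPoly m (out i j) = (X : K[X]) ^ j • T i) ∧
      (∀ i, ∑ l, unflat m (F i) l • vecPoly m (U.getD l []) + D • T i = 0) ∧
      Submodule.span K[X] (Set.range T) =
        Submodule.span K[X] (Set.range fun j : Fin m => vecPoly m (B.getD j [])) ∧
      LinearIndependent K[X] T ∧
      Function.Injective (fun i => (F i).natDegree % m) ∧
      ∀ i j, j < k i ↔ (F i).natDegree + 1 + m * j ≤ m * (D.natDegree + 1) := by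
  set zs : List K := U.map fun _ => 0 with hzs'
  have hzs : ∀ a ∈ zs, a = 0 := by simp [hzs']
  have hm : zs.length = m := by simp [hzs', hU]
  have hget : ∀ (L : List (List (List K))) (h : L.length = m) (i : Fin m), L.getD i [] ∈ L := by
    intro L h i
    rw [List.getD_eq_getElem _ _ (h ▸ i.2)]
    exact List.getElem_mem _
  have hsol : ∀ b ∈ B, _ := fun b hb => solve_spec hzs hm h0 hU hU' (hB' b hb) hUi
  obtain ⟨hD, hcom⟩ := common_spec (B.map (solve zs U)) (by
    intro x hx
    obtain ⟨b, hb, rfl⟩ := List.mem_map.1 hx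
    exact (hsol b hb).2.1)
  rw [List.forall₂_map_left_iff] at hcom
  set V := (common (B.map (solve zs U))).1 with hV
  set d := (common (B.map (solve zs U))).2 with hd
  set D := toPoly d with hD'
  have hVl : V.length = m := hcom.length_eq.symm.trans hB
  have hVi : ∀ i : Fin m, (V.getD i []).length = m ∧
      ∑ l : Fin m, vecPoly m (V.getD i []) l • vecPoly m (U.getD l []) +
        D • vecPoly m (B.getD i []) = 0 := by
    intro i
    obtain ⟨h1, h2, h3⟩ := hsol _ (hget B hB i)
    obtain ⟨h4, h5⟩ : (V.getD i []).length = (solve zs U (B.getD i [])).1.length ∧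
        ∀ j, toPoly (solve zs U (B.getD i [])).2 * toPoly ((V.getD i []).getD j []) =
          D * toPoly ((solve zs U (B.getD i [])).1.getD j []) := by
      have hiB : (i : ℕ) < B.length := hB ▸ i.2
      have hiV : (i : ℕ) < V.length := hVl ▸ i.2
      rw [List.getD_eq_getElem _ _ hiB, List.getD_eq_getElem _ _ hiV]
      exact hcom.get hiB hiV
    refine ⟨h4.trans h1, ?_⟩
    refine (smul_eq_zero.1 ?_).resolve_left h2
    rw [smul_add, Finset.smul_sum, smul_comm, ← smul_zero D, ← h3, smul_add, Finset.smul_sum]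
    refine congrArg₂ _ (Finset.sum_congr rfl fun l _ => ?_) rfl
    rw [smul_smul, smul_smul, vecPoly, h5]
  obtain ⟨e, he1, he2, he3, he4⟩ := reduceList_ofFn (r := m) hzs hm h0 hVl hB (fun c hc => by
    obtain ⟨i, hi, rfl⟩ := List.mem_iff_getElem.1 hc
    rw [← List.getD_eq_getElem _ [] hi]
    exact (hVi ⟨i, hVl ▸ hi⟩).1) hB'
  -- the relation between the coordinate vectors and the columns of `B` is linear, so that it
  -- remains true for all vectors in the lattice
  set ψ : ((Fin m → K[X]) × (Fin m → K[X])) →ₗ[K[X]] (Fin m → K[X]) :=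
    Fintype.linearCombination K[X] (fun l : Fin m => vecPoly m (U.getD l [])) ∘ₗ
      LinearMap.fst K[X] _ _ + D • LinearMap.snd K[X] _ _ with hψ
  have hrel : ∀ i, ψ (sem m m (e i)) = 0 := by
    intro i
    have hle : Submodule.span K[X] (Set.range fun i : Fin m =>
        (vecPoly m (V.getD i []), vecPoly m (B.getD i []))) ≤ LinearMap.ker ψ := by
      rw [Submodule.span_le]
      rintro _ ⟨k, rfl⟩
      rw [SetLike.mem_coe, LinearMap.mem_ker]
      simpa [hψ, Fintype.linearCombination_apply] using (hVi k).2
    exact LinearMap.mem_ker.1 (hle (he4 ▸ Submodule.subset_span (Set.mem_range_self i)))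
  have hrel' : ∀ i, ∑ l, unflat m (imgPoly (e i).1) l • vecPoly m (U.getD l []) +
      D • vecPoly m (e i).2 = 0 := fun i => by
    simpa [hψ, Fintype.linearCombination_apply, sem] using hrel i
  have hspan : Submodule.span K[X] (Set.range fun i => vecPoly m (e i).2) =
      Submodule.span K[X] (Set.range fun j : Fin m => vecPoly m (B.getD j [])) := by
    have h := congrArg (Submodule.map (LinearMap.snd K[X] _ _)) he4
    rw [Submodule.map_span, Submodule.map_span, ← Set.range_comp, ← Set.range_comp] at h
    exact h
  have hli : LinearIndependent K[X] fun i => vecPoly m (e i).2 := by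
    rw [linearIndependent_iff_card_eq_finrank_span] at hBi ⊢
    rw [Set.finrank, hspan]
    exact hBi
  have hne : ∀ i, (e i).1 ≠ [] := by
    intro i h
    have h1 := hrel' i
    rw [h, imgPoly_nil, unflat_zero] at h1
    simp only [Pi.zero_apply, zero_smul, Finset.sum_const_zero, zero_add] at h1
    exact hli.ne_zero i ((smul_eq_zero.1 h1).resolve_left hD)
  have hdeg := fun i => natDegree_imgPoly (hne i) ((he2 i).lead (hne i))
  choose k out hp1 hp2 hp3 using fun i => powers_spec (r := m) hzs hm h0
    (V.map fun _ => trim d.reverse).flatten (hne i) (he2 i).length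
  refine ⟨D, fun i => imgPoly (e i).1, fun i => vecPoly m (e i).2, k, out, hD,
    fun i => (hdeg i).2, ?_, hp2, hrel', hspan, hli, fun i j hij => ?_, fun i j => ?_⟩
  · change (List.map _ (reduceList zs _)).flatten = _
    rw [he1, List.ofFn_eq_map, List.map_map, List.flatMap]
    congr 2
    funext i
    exact hp1 i
  · refine he3 i j (hne i) ?_ (hne j)
    rw [← (hdeg i).1, ← (hdeg j).1]
    exact Nat.ModEq.add_right 1 hij
  · rw [hp3, (hdeg i).1]
    simp [List.length_flatten, length_trim_reverse hD, hVl, hD']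

end Solve

/-! ### Degrees of rational functions -/

section Degree

variable {K : Type*} [Field K]

theorem ratDeg_zero : ratDeg (0 : RatFunc K) = ⊥ := by simp [ratDeg]

theorem ratDeg_of_ne {r : RatFunc K} (h : r ≠ 0) : ratDeg r = (r.intDegree : ℤ) := by
  simp [ratDeg, h]

theorem ratDeg_eq_bot {r : RatFunc K} : ratDeg r = ⊥ ↔ r = 0 := by
  rw [ratDeg]
  split_ifs with h <;> simp [h]

theorem ratDeg_mul (r s : RatFunc K) : ratDeg (r * s) = ratDeg r + ratDeg s := by
  by_cases hr : r = 0
  · simp [hr, ratDeg_zero]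
  by_cases hs : s = 0
  · simp [hs, ratDeg_zero]
  rw [ratDeg_of_ne hr, ratDeg_of_ne hs, ratDeg_of_ne (mul_ne_zero hr hs),
    RatFunc.intDegree_mul hr hs]
  rfl

theorem ratDeg_one : ratDeg (1 : RatFunc K) = 0 := by
  have h : (1 : RatFunc K) ≠ 0 := one_ne_zero
  rw [ratDeg_of_ne h, RatFunc.intDegree_one]
  rfl

theorem ratDeg_neg (r : RatFunc K) : ratDeg (-r) = ratDeg r := by
  by_cases h : r = 0
  · rw [h, neg_zero]
  · rw [ratDeg_of_ne h, ratDeg_of_ne (neg_ne_zero.2 h), RatFunc.intDegree_neg]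

theorem ratDeg_algebraMap {f : K[X]} (hf : f ≠ 0) :
    ratDeg (algebraMap K[X] (RatFunc K) f) = ((f.natDegree : ℤ) : WithBot ℤ) := by
  rw [ratDeg_of_ne (by simpa using hf), RatFunc.intDegree_polynomial]

theorem ratDeg_X_zpow (k : ℤ) : ratDeg ((RatFunc.X : RatFunc K) ^ k) = (k : WithBot ℤ) := by
  have hX : (RatFunc.X : RatFunc K) ≠ 0 := RatFunc.X_ne_zero
  have hnat : ∀ j : ℕ, ratDeg ((RatFunc.X : RatFunc K) ^ j) = ((j : ℤ) : WithBot ℤ) := fun j => by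
    rw [← RatFunc.algebraMap_X, ← map_pow, ratDeg_algebraMap (pow_ne_zero _ X_ne_zero),
      natDegree_X_pow]
  obtain ⟨j, rfl | rfl⟩ := k.eq_nat_or_neg
  · rw [zpow_natCast, hnat]
  · have h : ratDeg ((RatFunc.X : RatFunc K) ^ (-(j : ℤ)) * RatFunc.X ^ j) = 0 := by
      rw [← zpow_natCast, ← zpow_add₀ hX, neg_add_cancel, zpow_zero, ratDeg_one]
    rw [ratDeg_mul, hnat, ratDeg_of_ne (zpow_ne_zero _ hX)] at h
    rw [ratDeg_of_ne (zpow_ne_zero _ hX)]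
    norm_cast at h ⊢
    omega

theorem ratDeg_div_algebraMap {f g : K[X]} (hf : f ≠ 0) (hg : g ≠ 0) :
    ratDeg (algebraMap K[X] (RatFunc K) f / algebraMap K[X] (RatFunc K) g) =
      ((f.natDegree - g.natDegree : ℤ) : WithBot ℤ) := by
  have hg' : algebraMap K[X] (RatFunc K) g ≠ 0 := by simpa using hg
  have hf' : algebraMap K[X] (RatFunc K) f ≠ 0 := by simpa using hf
  have h := ratDeg_mul (algebraMap K[X] (RatFunc K) f / algebraMap K[X] (RatFunc K) g)
    (algebraMap K[X] (RatFunc K) g)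
  rw [div_mul_cancel₀ _ hg', ratDeg_algebraMap hf, ratDeg_algebraMap hg,
    ratDeg_of_ne (div_ne_zero hf' hg')] at h
  rw [ratDeg_of_ne (div_ne_zero hf' hg')]
  rw [← WithBot.coe_add, WithBot.coe_inj] at h
  rw [WithBot.coe_inj]
  omega

theorem mem_degSubring {r : RatFunc K} : r ∈ degSubring K ↔ ratDeg r ≤ 0 := Iff.rfl

theorem ratDeg_le_vecDeg {m : ℕ} (v : Fin m → RatFunc K) (i : Fin m) : ratDeg (v i) ≤ vecDeg v :=
  Finset.le_sup (f := fun i => ratDeg (v i)) (Finset.mem_univ i)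

theorem vecDeg_ne_bot {m : ℕ} {v : Fin m → RatFunc K} (hv : v ≠ 0) : vecDeg v ≠ ⊥ := by
  obtain ⟨i, hi⟩ := Function.ne_iff.1 hv
  intro h
  have := ratDeg_le_vecDeg v i
  rw [h, le_bot_iff, ratDeg_eq_bot] at this
  exact hi this

/-! ### Reduced bases -/

/-- Cramer's rule over the ring `R` of rational functions of degree at most zero: a matrix over `R`
whose determinant has degree zero is invertible over `R`, so that a vector whose image has entries
in `R` has itself entries in `R`. -/
theorem mem_degSubring_of_mulVec {m : ℕ} {M : Matrix (Fin m) (Fin m) (RatFunc K)}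
    (hM : ∀ i j, M i j ∈ degSubring K) (hdet : ratDeg M.det = 0) {v : Fin m → RatFunc K}
    (hv : ∀ i, (M.mulVec v) i ∈ degSubring K) (i : Fin m) : v i ∈ degSubring K := by
  let N : Matrix (Fin m) (Fin m) (degSubring K) := Matrix.of fun i j => ⟨M i j, hM i j⟩
  have hN : (degSubring K).subtype.mapMatrix N = M := rfl
  have hadj : ∀ i j, M.adjugate i j ∈ degSubring K := by
    intro i j
    rw [← hN, ← RingHom.map_adjugate]
    exact (N.adjugate i j).2
  have h1 : M.det * v i = (M.adjugate.mulVec (M.mulVec v)) i := by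
    rw [Matrix.mulVec_mulVec, Matrix.adjugate_mul, Matrix.smul_mulVec, Matrix.one_mulVec]
    rfl
  have h2 : M.det * v i ∈ degSubring K := by
    rw [h1]
    exact Subring.sum_mem (degSubring K) (t := Finset.univ)
      fun j _ => Subring.mul_mem (degSubring K) (hadj i j) (hv j)
  rw [mem_degSubring, ratDeg_mul, hdet, zero_add] at h2
  exact h2

/-- There is no cancellation in a linear combination of the vectors of a reduced basis: if its
degree is at most zero, so are the degrees of all summands. -/
theorem combination_mem_degSubring_iff {m : ℕ} {b : Fin m → Fin m → RatFunc K}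
    (hb : IsReducedBasis b) (f : Fin m → RatFunc K) :
    (∀ l, ∑ i, f i * b i l ∈ degSubring K) ↔ ∀ i, ratDeg (f i) + vecDeg (b i) ≤ 0 := by
  constructor
  · intro h
    have hd : ∀ i, ∃ d : ℤ, (d : WithBot ℤ) = vecDeg (b i) := fun i =>
      WithBot.ne_bot_iff_exists.1 (vecDeg_ne_bot (hb.1.ne_zero i))
    choose d hd using hd
    have hX : (RatFunc.X : RatFunc K) ≠ 0 := RatFunc.X_ne_zero
    -- the columns of `M` are the vectors of `b`, scaled to degree zero
    set M : Matrix (Fin m) (Fin m) (RatFunc K) :=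
      Matrix.of fun l i => (RatFunc.X : RatFunc K) ^ (-d i) * b i l with hM
    have hdet0 : (Matrix.of fun i j => b j i).det ≠ 0 := by
      have h1 := Matrix.linearIndependent_rows_iff_isUnit.1
        (show LinearIndependent (RatFunc K) (Matrix.of b).row from hb.1)
      have h2 := (Matrix.isUnit_iff_isUnit_det _).1 h1
      rw [← Matrix.det_transpose] at h2
      exact h2.ne_zero
    have hdet : ratDeg M.det = 0 := by
      have e1 : M.det = (∏ i, (RatFunc.X : RatFunc K) ^ (-d i)) *
          (Matrix.of fun i j => b j i).det := by
        rw [← Matrix.det_mul_row]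
        rfl
      have e2 : ∏ i, (RatFunc.X : RatFunc K) ^ (-d i) = RatFunc.X ^ (-∑ i, d i) := by
        rw [← Finset.sum_neg_distrib]
        induction (Finset.univ : Finset (Fin m)) using Finset.cons_induction with
        | empty => simp
        | cons i s hi ih => rw [Finset.prod_cons, Finset.sum_cons, ih, zpow_add₀ hX]
      have h2 := hb.2
      rw [orthogonalityDefect, ratDeg_of_ne hdet0] at h2
      simp only [← hd, WithBot.unbotD_coe] at h2
      rw [e1, e2, ratDeg_mul, ratDeg_X_zpow, ratDeg_of_ne hdet0]
      norm_cast
      omega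
    intro i
    have h3 := mem_degSubring_of_mulVec (M := M) (v := fun i => f i * RatFunc.X ^ d i)
      (fun l i => by
        rw [mem_degSubring, hM, Matrix.of_apply, ratDeg_mul, ratDeg_X_zpow]
        refine (add_le_add_right (ratDeg_le_vecDeg (b i) l) _).trans ?_
        rw [← hd]
        norm_cast
        omega) hdet (fun l => by
        convert h l using 1
        simp only [Matrix.mulVec, dotProduct, hM, Matrix.of_apply]
        refine Finset.sum_congr rfl fun i _ => ?_
        rw [zpow_neg]
        field_simp) i
    rw [mem_degSubring, ratDeg_mul, ratDeg_X_zpow, hd] at h3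
    exact h3
  · intro h l
    refine Subring.sum_mem _ fun i _ => ?_
    rw [mem_degSubring, ratDeg_mul]
    exact (add_le_add_right (ratDeg_le_vecDeg (b i) l) _).trans (h i)

/-- If the rows of a matrix of polynomials have at most the degrees `k i`, and if the coefficients
in these degrees form an invertible matrix, the degree of the determinant is the sum of the `k i`.
-/
theorem natDegree_det {m : ℕ} (V : Matrix (Fin m) (Fin m) K[X]) (k : Fin m → ℕ)
    (hk : ∀ i l, (V i l).natDegree ≤ k i)
    (hdet : (Matrix.of fun i l => (V i l).coeff (k i)).det ≠ 0) :
    V.det ≠ 0 ∧ V.det.natDegree = ∑ i, k i := by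
  have hprod : ∀ (s : Finset (Fin m)) (f : Fin m → K[X]), (∀ i, (f i).natDegree ≤ k i) →
      (∏ i ∈ s, f i).natDegree ≤ ∑ i ∈ s, k i ∧
      (∏ i ∈ s, f i).coeff (∑ i ∈ s, k i) = ∏ i ∈ s, (f i).coeff (k i) := by
    intro s f hf
    induction s using Finset.cons_induction with
    | empty => simp
    | cons i s hi ih =>
      rw [Finset.prod_cons, Finset.sum_cons, Finset.prod_cons]
      exact ⟨natDegree_mul_le.trans (add_le_add (hf i) ih.1), by
        rw [coeff_mul_add_eq_of_natDegree_le (hf i) ih.1, ih.2]⟩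
  have hcoeff : V.det.coeff (∑ i, k i) = (Matrix.of fun i l => (V i l).coeff (k i)).det := by
    rw [← Matrix.det_transpose, Matrix.det_apply, ← Matrix.det_transpose, Matrix.det_apply,
      finsetSum_coeff]
    refine Finset.sum_congr rfl fun σ _ => ?_
    rw [coeff_smul]
    exact congrArg _ (hprod Finset.univ (fun i => V i (σ i)) fun i => hk i _).2
  have hle : V.det.natDegree ≤ ∑ i, k i := by
    rw [← Matrix.det_transpose, Matrix.det_apply]
    refine natDegree_sum_le_of_forall_le _ _ fun σ _ => (natDegree_smul_le _ _).trans ?_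
    exact (hprod Finset.univ (fun i => V i (σ i)) fun i => hk i _).1
  rw [← hcoeff] at hdet
  exact ⟨fun h => hdet (by rw [h, coeff_zero]), le_antisymm hle (le_natDegree_of_ne_zero hdet)⟩

/-- Vectors whose images have degrees that are incongruent modulo `m`: up to a permutation of the
rows, their leading coefficients form a triangular matrix. -/
theorem det_coeff_unflat_ne_zero {m : ℕ} (h0 : 0 < m) {F : Fin m → K[X]} (hF : ∀ i, F i ≠ 0)
    (hinj : Function.Injective fun i => (F i).natDegree % m) :
    (Matrix.of fun i l => (unflat m (F i) l).coeff ((F i).natDegree / m)).det ≠ 0 := by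
  set M : Matrix (Fin m) (Fin m) K :=
    Matrix.of fun i l => (unflat m (F i) l).coeff ((F i).natDegree / m) with hM
  let s : Fin m → Fin m := fun i => ⟨(F i).natDegree % m, Nat.mod_lt _ h0⟩
  have hs : Function.Bijective s := Finite.injective_iff_bijective.1 fun i j h =>
    hinj (Fin.mk.inj_iff.1 h)
  let σ : Equiv.Perm (Fin m) := Equiv.ofBijective s hs
  have hσ : ∀ r, (F (σ.symm r)).natDegree % m = r := fun r => by
    have h := congrArg Fin.val (σ.apply_symm_apply r)
    exact h
  have hdeg : ∀ r, (F (σ.symm r)).natDegree = m * ((F (σ.symm r)).natDegree / m) + r := fun r => by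
    have h := Nat.div_add_mod (F (σ.symm r)).natDegree m
    rw [hσ] at h
    exact h.symm
  intro h
  have h1 := Matrix.det_permute σ.symm M
  rw [h, mul_zero, Matrix.det_of_isLowerTriangular] at h1
  · obtain ⟨r, -, hr⟩ := Finset.prod_eq_zero_iff.1 h1
    rw [Matrix.submatrix_apply, id, hM, Matrix.of_apply, coeff_unflat, ← hdeg] at hr
    exact hF _ (leadingCoeff_eq_zero.1 hr)
  · intro r l hrl
    have hrl' : r < l := hrl
    rw [Matrix.submatrix_apply, id, hM, Matrix.of_apply, coeff_unflat]
    refine coeff_eq_zero_of_natDegree_lt ?_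
    have := hdeg r
    have := Fin.lt_def.1 hrl'
    omega

theorem natDegree_unflat_le {m : ℕ} (F : K[X]) (l : Fin m) :
    (unflat m F l).natDegree ≤ F.natDegree / m := by
  refine natDegree_le_iff_coeff_eq_zero.2 fun k hk => ?_
  rw [coeff_unflat]
  refine coeff_eq_zero_of_natDegree_lt ?_
  have := (Nat.div_lt_iff_lt_mul l.pos).1 hk
  rw [mul_comm] at this
  omega

/-- Vectors with the common denominator `D` form a reduced basis if the degrees of the images of
their numerators are incongruent modulo `m`; and the degree of a numerator is the integral part of
the degree of its image divided by `m`. -/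
theorem isReducedBasis_of_unflat {m : ℕ} (h0 : 0 < m) {F : Fin m → K[X]} {D : K[X]} (hD : D ≠ 0)
    (hF : ∀ i, F i ≠ 0) (hinj : Function.Injective fun i => (F i).natDegree % m)
    {b : Fin m → Fin m → RatFunc K}
    (hb : ∀ i l, b i l = algebraMap K[X] (RatFunc K) (-unflat m (F i) l) /
      algebraMap K[X] (RatFunc K) D) :
    IsReducedBasis b ∧ ∀ i, vecDeg (b i) =
      (((F i).natDegree / m : ℕ) - (D.natDegree : ℤ) : ℤ) := by
  have hvec : ∀ i, vecDeg (b i) = (((F i).natDegree / m : ℕ) - (D.natDegree : ℤ) : ℤ) := by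
    intro i
    apply le_antisymm
    · refine Finset.sup_le fun l _ => ?_
      rw [hb]
      by_cases hl : unflat m (F i) l = 0
      · rw [hl, neg_zero, map_zero, zero_div, ratDeg_zero]
        exact bot_le
      · rw [ratDeg_div_algebraMap (neg_ne_zero.2 hl) hD, natDegree_neg, WithBot.coe_le_coe]
        have := natDegree_unflat_le (F i) l
        omega
    · let l : Fin m := ⟨(F i).natDegree % m, Nat.mod_lt _ h0⟩
      have hl : (unflat m (F i) l).coeff ((F i).natDegree / m) ≠ 0 := by
        rw [coeff_unflat]
        change (F i).coeff (m * ((F i).natDegree / m) + (F i).natDegree % m) ≠ 0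
        rw [Nat.div_add_mod]
        exact leadingCoeff_ne_zero.2 (hF i)
      have hl0 : unflat m (F i) l ≠ 0 := fun h => hl (by rw [h, coeff_zero])
      refine le_trans ?_ (ratDeg_le_vecDeg (b i) l)
      rw [hb, ratDeg_div_algebraMap (neg_ne_zero.2 hl0) hD, natDegree_neg, WithBot.coe_le_coe]
      have := le_natDegree_of_ne_zero hl
      omega
  refine ⟨?_, hvec⟩
  have hD' : algebraMap K[X] (RatFunc K) D ≠ 0 := by simpa using hD
  set V : Matrix (Fin m) (Fin m) K[X] := Matrix.of fun i l => unflat m (F i) l with hV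
  obtain ⟨hdet0, hdeg⟩ := natDegree_det V (fun i => (F i).natDegree / m)
    (fun i l => natDegree_unflat_le _ _) (det_coeff_unflat_ne_zero h0 hF hinj)
  have hbV : Matrix.of b = (-(algebraMap K[X] (RatFunc K) D)⁻¹) •
      (algebraMap K[X] (RatFunc K)).mapMatrix V := by
    ext i l
    simp [hb, hV, div_eq_mul_inv, mul_comm]
  have hdetb : (Matrix.of b).det = (-(algebraMap K[X] (RatFunc K) D)⁻¹) ^ m *
      algebraMap K[X] (RatFunc K) V.det := by
    rw [hbV, Matrix.det_smul, ← RingHom.map_det, Fintype.card_fin]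
  have hne1 : algebraMap K[X] (RatFunc K) V.det ≠ 0 := by simpa using hdet0
  have hne : (Matrix.of b).det ≠ 0 := by
    rw [hdetb]
    exact mul_ne_zero (pow_ne_zero _ (neg_ne_zero.2 (inv_ne_zero hD'))) hne1
  refine ⟨?_, ?_⟩
  · exact Matrix.linearIndependent_rows_iff_isUnit.2
      ((Matrix.isUnit_iff_isUnit_det _).2 hne.isUnit)
  · have e : (Matrix.of fun i j => b j i).det = (Matrix.of b).det := by
      rw [← Matrix.det_transpose]
      rfl
    have hd : (Matrix.of b).det.intDegree = ∑ i, (((F i).natDegree / m : ℕ) : ℤ) -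
        m * D.natDegree := by
      have h1 : ratDeg ((Matrix.of b).det * algebraMap K[X] (RatFunc K) D ^ m) =
          ratDeg (algebraMap K[X] (RatFunc K) V.det) := by
        have e1 : (Matrix.of b).det * algebraMap K[X] (RatFunc K) D ^ m =
            (-1) ^ m * algebraMap K[X] (RatFunc K) V.det := by
          rw [hdetb, neg_pow, inv_pow]
          field_simp
        rw [e1]
        rcases neg_one_pow_eq_or (RatFunc K) m with h | h <;> rw [h]
        · rw [one_mul]
        · rw [neg_one_mul, ratDeg_neg]
      rw [← map_pow, ratDeg_mul, ratDeg_algebraMap (pow_ne_zero _ hD), ratDeg_algebraMap hdet0,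
        ratDeg_of_ne hne, hdeg, natDegree_pow, ← WithBot.coe_add, WithBot.coe_inj] at h1
      push_cast at h1 ⊢
      linarith
    rw [orthogonalityDefect, e, ratDeg_of_ne hne, hd]
    simp [hvec]

end Degree

/-! ### The intersection of the two lattices -/

section Intersection

variable {K : Type*} [Field K]

theorem linearIndependent_X_pow :
    LinearIndependent K fun j : ℕ => (RatFunc.X : RatFunc K) ^ j := by
  have h := (basisMonomials K).linearIndependent.map'
    (IsScalarTower.toAlgHom K K[X] (RatFunc K)).toLinearMap
    (LinearMap.ker_eq_bot.2 (RatFunc.algebraMap_injective K))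
  have e : (fun j : ℕ => (RatFunc.X : RatFunc K) ^ j) =
      (IsScalarTower.toAlgHom K K[X] (RatFunc K)).toLinearMap ∘ basisMonomials K := by
    funext j
    simp [← X_pow_eq_monomial, RatFunc.algebraMap_X]
  rw [e]
  exact h

theorem algebraMap_mem_polySubring (k : K) : algebraMap K (RatFunc K) k ∈ polySubring K :=
  ⟨C k, by rw [RatFunc.algebraMap_C, RatFunc.algebraMap_eq_C]⟩

theorem algebraMap_mem_degSubring (k : K) : algebraMap K (RatFunc K) k ∈ degSubring K := by
  by_cases hk : k = 0
  · rw [hk, map_zero]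
    exact Subring.zero_mem _
  · rw [RatFunc.algebraMap_eq_C, ← RatFunc.algebraMap_C, mem_degSubring,
      ratDeg_algebraMap (C_ne_zero.2 hk), natDegree_C]
    rfl

variable {A : Type*} [Ring A] [Algebra (RatFunc K) A] {m : ℕ}

theorem mem_inter_iff {c u : Module.Basis (Fin m) (RatFunc K) A} {Λ Δ : Subring A}
    (hc : IsLatticeBasis (polySubring K) c (Λ : Set A))
    (hu : IsLatticeBasis (degSubring K) u (Δ : Set A))
    (hred : IsReducedBasis fun i k => u.repr (c i) k) (w : A) :
    w ∈ (Λ : Set A) ∩ (Δ : Set A) ↔ (∀ i, c.repr w i ∈ polySubring K) ∧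
      ∀ i, ratDeg (c.repr w i) + vecDeg (fun k => u.repr (c i) k) ≤ 0 := by
  rw [Set.mem_inter_iff, hc w, hu w, ← combination_mem_degSubring_iff hred]
  have h : ∀ l, u.repr w l = ∑ i, c.repr w i * u.repr (c i) l := fun l => by
    conv_lhs => rw [← c.sum_repr w]
    rw [map_sum, Finsupp.finsetSum_apply]
    simp only [map_smul, Finsupp.smul_apply, smul_eq_mul]
  simp only [h]

variable [Algebra K A] [IsScalarTower K (RatFunc K) A]

theorem linearIndependent_X_pow_smul (c : Module.Basis (Fin m) (RatFunc K) A) :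
    LinearIndependent K fun p : Fin m × ℕ => (RatFunc.X : RatFunc K) ^ p.2 • c p.1 :=
  (linearIndependent_smul (linearIndependent_X_pow (K := K)) c.linearIndependent).comp _
    Prod.swap_injective

theorem smul_mem_of_isLatticeBasis {S : Subring (RatFunc K)}
    (hS : ∀ k, algebraMap K (RatFunc K) k ∈ S) {c : Module.Basis (Fin m) (RatFunc K) A}
    {Λ : Subring A} (hc : IsLatticeBasis S c (Λ : Set A)) (k : K) {w : A} (hw : w ∈ Λ) :
    k • w ∈ Λ := by
  refine (hc _).2 fun i => ?_
  rw [← algebraMap_smul (RatFunc K) k w, map_smul]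
  exact S.mul_mem (hS k) ((hc w).1 hw i)

/-- The intersection consists of the combinations of a reduced basis with polynomials `f i` for
which `f i • c i` has degree at most zero, and such an `f i` is a combination of the powers `x ^ j`
with `j + |c i| ≤ 0`. -/
theorem isBasisOf_inter {c u : Module.Basis (Fin m) (RatFunc K) A} {Λ Δ : Subring A}
    (hc : IsLatticeBasis (polySubring K) c (Λ : Set A))
    (hu : IsLatticeBasis (degSubring K) u (Δ : Set A))
    (hred : IsReducedBasis fun i k => u.repr (c i) k) :
    IsBasisOf K
      (fun ij : {ij : Fin m × ℕ //
          ((ij.2 : ℤ) : WithBot ℤ) + vecDeg (fun k => u.repr (c ij.1) k) ≤ 0} =>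
        (RatFunc.X : RatFunc K) ^ ij.1.2 • c ij.1.1)
      ((Λ : Set A) ∩ (Δ : Set A)) := by
  refine ⟨(linearIndependent_X_pow_smul c).comp _ Subtype.val_injective, Set.Subset.antisymm ?_ ?_⟩
  · intro w hw
    rw [SetLike.mem_coe] at hw
    induction hw using Submodule.span_induction with
    | zero => exact ⟨Λ.zero_mem, Δ.zero_mem⟩
    | add x y _ _ hx hy => exact ⟨Λ.add_mem hx.1 hy.1, Δ.add_mem hx.2 hy.2⟩
    | smul k x _ hx =>
      exact ⟨smul_mem_of_isLatticeBasis algebraMap_mem_polySubring hc k hx.1,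
        smul_mem_of_isLatticeBasis algebraMap_mem_degSubring hu k hx.2⟩
    | mem x hx =>
      obtain ⟨⟨⟨i, j⟩, hij⟩, rfl⟩ := hx
      have hrepr : ∀ i', c.repr ((RatFunc.X : RatFunc K) ^ j • c i) i' =
          if i = i' then RatFunc.X ^ j else 0 := fun i' => by
        simp [Finsupp.single_apply]
      rw [mem_inter_iff hc hu hred]
      refine ⟨fun i' => ?_, fun i' => ?_⟩ <;> dsimp only <;> rw [hrepr]
      · split_ifs
        · exact ⟨X ^ j, by rw [map_pow, RatFunc.algebraMap_X]⟩
        · exact Subring.zero_mem _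
      · split_ifs with h
        · rw [← h, ← zpow_natCast, ratDeg_X_zpow]
          exact hij
        · rw [ratDeg_zero, WithBot.bot_add]
          exact bot_le
  · intro w hw
    obtain ⟨h1, h2⟩ := (mem_inter_iff hc hu hred w).1 hw
    rw [SetLike.mem_coe, ← c.sum_repr w]
    refine Submodule.sum_mem _ fun i _ => ?_
    obtain ⟨f, hf⟩ := h1 i
    have h3 := h2 i
    rw [← hf] at h3 ⊢
    rw [← f.sum_monomial_eq, Polynomial.sum, map_sum, Finset.sum_smul]
    refine Submodule.sum_mem _ fun j hj => ?_
    have hj' := mem_support_iff.1 hj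
    have hf0 : f ≠ 0 := fun h => hj' (by rw [h, coeff_zero])
    have e : algebraMap K[X] (RatFunc K) (monomial j (f.coeff j)) • c i =
        f.coeff j • (RatFunc.X : RatFunc K) ^ j • c i := by
      rw [← C_mul_X_pow_eq_monomial, map_mul, map_pow, RatFunc.algebraMap_X, mul_smul,
        RatFunc.algebraMap_C, ← RatFunc.algebraMap_eq_C, algebraMap_smul]
    rw [e]
    refine Submodule.smul_mem _ _ (Submodule.subset_span ⟨⟨(i, j), ?_⟩, rfl⟩)
    refine le_trans (add_le_add_left ?_ _) h3
    rw [ratDeg_algebraMap hf0, WithBot.coe_le_coe]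
    exact_mod_cast le_natDegree_of_ne_zero hj'

end Intersection

/-- A list without repetitions that has the same elements as a basis is itself a basis. -/
theorem isBasisOf_get {K A ι : Type*} [Field K] [AddCommGroup A] [Module K A] {f : ι → A}
    {M : Set A} (hf : IsBasisOf K f M) {L : List A}
    (hL : L.Nodup) (h : ∀ w, w ∈ L ↔ w ∈ Set.range f) :
    IsBasisOf K (fun i : Fin L.length => L.get i) M := by
  have hr : Set.range (fun i : Fin L.length => L.get i) = Set.range f := by
    ext w
    rw [← h, List.mem_iff_get]
    rfl
  refine ⟨?_, by rw [hr]; exact hf.2⟩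
  exact hf.1.linearIndepOn_id.linearIndependent.comp
    (fun i : Fin L.length => (⟨L.get i, hr ▸ Set.mem_range_self i⟩ : Set.range f))
    fun i j hij => List.nodup_iff_injective_get.1 hL (Subtype.mk.inj hij)

/-! ### Correctness of the algorithm -/

section Correct

variable {K : Type*} [Field K]

theorem colCommon_spec (l : List (List K × List K)) (hl : ∀ x ∈ l, toPoly x.2 ≠ 0) :
    toPoly (colCommon l).2 ≠ 0 ∧
    List.Forall₂ (fun x f => toPoly x.2 * toPoly f = toPoly (colCommon l).2 * toPoly x.1)
      l (colCommon l).1 := by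
  obtain ⟨h1, h2⟩ := common_spec (l.map fun x => ([x.1], x.2)) (by
    intro x hx
    obtain ⟨y, hy, rfl⟩ := List.mem_map.1 hx
    exact hl y hy)
  rw [List.forall₂_map_left_iff] at h2
  refine ⟨h1, List.forall₂_map_right_iff.2 (h2.imp fun x w h => ?_)⟩
  have h3 := h.2 0
  rw [List.getD_cons_zero] at h3
  cases w <;> exact h3

theorem matCommon_spec (l : List (List (List K × List K)))
    (hl : ∀ c ∈ l, ∀ x ∈ c, toPoly x.2 ≠ 0) :
    toPoly (matCommon l).2 ≠ 0 ∧
    List.Forall₂ (List.Forall₂ fun x f =>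
      toPoly x.2 * toPoly f = toPoly (matCommon l).2 * toPoly x.1) l (matCommon l).1 := by
  obtain ⟨h1, h2⟩ := common_spec (l.map colCommon) (by
    intro x hx
    obtain ⟨c, hc, rfl⟩ := List.mem_map.1 hx
    exact (colCommon_spec c (hl c hc)).1)
  rw [List.forall₂_map_left_iff] at h2
  rw [show common (l.map colCommon) = matCommon l from rfl] at h1 h2
  refine ⟨h1, ?_⟩
  rw [List.forall₂_iff_get] at h2 ⊢
  refine ⟨h2.1, fun i hi hi' => ?_⟩
  obtain ⟨h3, h4⟩ := h2.2 i hi hi'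
  obtain ⟨h5, h6⟩ := colCommon_spec (l.get ⟨i, hi⟩) (hl _ (List.get_mem _ _))
  rw [List.forall₂_iff_get] at h6 ⊢
  refine ⟨h6.1.trans h3.symm, fun k hk hk' => ?_⟩
  have h7 := h6.2 k hk (h6.1 ▸ hk)
  have h8 := h4 k
  rw [List.getD_eq_getElem _ _ hk', List.getD_eq_getElem _ _ (h6.1 ▸ hk)] at h8
  refine mul_left_cancel₀ h5 ?_
  simp only [List.get_eq_getElem] at h7 h8 ⊢
  linear_combination toPoly (l[i][k]'hk).2 * h8 + toPoly (matCommon l).2 * h7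

variable {A : Type*} [Ring A] [Algebra (RatFunc K) A] {m : ℕ}

/-- The fractions `N k` are the coordinates of `w` in the basis `a`. -/
def IsCoords (a : Module.Basis (Fin m) (RatFunc K) A) (w : A) (N : Fin m → List K × List K) :
    Prop :=
  ∀ k, toPoly (N k).2 ≠ 0 ∧
    a.repr w k = algebraMap K[X] (RatFunc K) (toPoly (N k).1) /
      algebraMap K[X] (RatFunc K) (toPoly (N k).2)

/-- The element of `A` with the coordinates `v k / D` in the basis `a`. -/
def ofCoords (a : Module.Basis (Fin m) (RatFunc K) A) (D : K[X]) (v : Fin m → K[X]) : A :=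
  a.equivFun.symm fun k => algebraMap K[X] (RatFunc K) (v k) / algebraMap K[X] (RatFunc K) D

theorem repr_ofCoords (a : Module.Basis (Fin m) (RatFunc K) A) (D : K[X]) (v : Fin m → K[X])
    (k : Fin m) : a.repr (ofCoords a D v) k =
      algebraMap K[X] (RatFunc K) (v k) / algebraMap K[X] (RatFunc K) D := by
  rw [← a.equivFun_apply, ofCoords, LinearEquiv.apply_symm_apply]

theorem ofCoords_sum (a : Module.Basis (Fin m) (RatFunc K) A) (D : K[X]) (q : Fin m → K[X])
    (v : Fin m → Fin m → K[X]) :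
    ofCoords a D (∑ j, q j • v j) =
      ∑ j, algebraMap K[X] (RatFunc K) (q j) • ofCoords a D (v j) := by
  refine a.repr.injective (Finsupp.ext fun k => ?_)
  rw [repr_ofCoords, map_sum, Finsupp.finsetSum_apply]
  simp only [map_smul, Finsupp.smul_apply, repr_ofCoords, Finset.sum_apply, Pi.smul_apply,
    smul_eq_mul, map_sum, map_mul, Finset.sum_div, mul_div_assoc]

theorem linearIndependent_of_ofCoords (a : Module.Basis (Fin m) (RatFunc K) A) (D : K[X])
    {v : Fin m → Fin m → K[X]} (h : LinearIndependent (RatFunc K) fun j => ofCoords a D (v j)) :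
    LinearIndependent K[X] v := by
  refine Fintype.linearIndependent_iff.2 fun q hq j => ?_
  have h1 : ofCoords a D (∑ j, q j • v j) = 0 := by
    rw [hq]
    refine a.repr.injective (Finsupp.ext fun k => ?_)
    rw [repr_ofCoords]
    simp
  rw [ofCoords_sum] at h1
  simpa using Fintype.linearIndependent_iff.1 h _ h1 j

theorem IsLatticeBasis.of_repr_mem {S : Subring (RatFunc K)}
    {b c : Module.Basis (Fin m) (RatFunc K) A} {M : Set A} (hb : IsLatticeBasis S b M)
    (hbc : ∀ i j, b.repr (c i) j ∈ S)
    (hcb : ∀ i j, c.repr (b i) j ∈ S) : IsLatticeBasis S c M := by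
  have key : ∀ (b c : Module.Basis (Fin m) (RatFunc K) A), (∀ i j, c.repr (b i) j ∈ S) →
      ∀ w, (∀ i, b.repr w i ∈ S) → ∀ i, c.repr w i ∈ S := by
    intro b c h w hw i
    rw [← b.sum_repr w, map_sum, Finsupp.finsetSum_apply]
    refine Subring.sum_mem _ fun j _ => ?_
    rw [map_smul, Finsupp.smul_apply, smul_eq_mul]
    exact S.mul_mem (hw j) (h j i)
  intro w
  rw [hb w]
  exact ⟨key b c hcb w, key c b hbc w⟩

/-- The numerators of a matrix over a common denominator, multiplied by a further polynomial `g`,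
represent the same elements over the denominator that is multiplied by `g`. -/
theorem ofCoords_matCommon {a : Module.Basis (Fin m) (RatFunc K) A} {b : Fin m → A}
    {N : Fin m → Fin m → List K × List K} (hb : ∀ i, IsCoords a (b i) (N i)) :
    let W := matCommon (List.ofFn fun i => List.ofFn (N i))
    toPoly W.2 ≠ 0 ∧ W.1.length = m ∧ (∀ c ∈ W.1, c.length = m) ∧
    ∀ g : List K, toPoly g ≠ 0 → ∀ i : Fin m,
      ofCoords a (toPoly g * toPoly W.2) (vecPoly m ((W.1.map (vecScale g)).getD i [])) = b i := by
  intro W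
  obtain ⟨h1, h2⟩ : toPoly W.2 ≠ 0 ∧ List.Forall₂ (List.Forall₂ fun x f =>
      toPoly x.2 * toPoly f = toPoly W.2 * toPoly x.1) (List.ofFn fun i => List.ofFn (N i)) W.1 :=
    matCommon_spec _ (by
    intro c hc x hx
    obtain ⟨i, rfl⟩ := (List.mem_ofFn' _ _).1 hc
    obtain ⟨k, rfl⟩ := (List.mem_ofFn' _ _).1 hx
    exact (hb i k).1)
  clear_value W
  rw [List.forall₂_iff_get] at h2
  have hl : W.1.length = m := by simpa using h2.1.symm
  have h3 : ∀ i : Fin m, List.Forall₂ (fun x f =>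
      toPoly x.2 * toPoly f = toPoly W.2 * toPoly x.1) (List.ofFn (N i)) (W.1.getD i []) := by
    intro i
    have hi : (i : ℕ) < W.1.length := hl ▸ i.2
    have h := h2.2 i (by simp) hi
    rw [List.getD_eq_getElem _ _ hi]
    simpa using h
  have hl' : ∀ i : Fin m, (W.1.getD i []).length = m := fun i => by
    simpa using (h3 i).length_eq.symm
  refine ⟨h1, hl, fun c hc => ?_, fun g hg i => ?_⟩
  · obtain ⟨i, hi, rfl⟩ := List.mem_iff_getElem.1 hc
    rw [← List.getD_eq_getElem _ [] hi]
    exact hl' ⟨i, hl ▸ hi⟩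
  · refine a.repr.injective (Finsupp.ext fun k => ?_)
    have hi : (i : ℕ) < W.1.length := hl ▸ i.2
    have e : (W.1.map (vecScale g)).getD i [] = vecScale g (W.1.getD i []) := by
      simp [hi]
    have hk : (k : ℕ) < (W.1.getD i []).length := by rw [hl']; exact k.2
    have h4 : toPoly (N i k).2 * toPoly ((W.1.getD i []).getD k []) =
        toPoly W.2 * toPoly (N i k).1 := by
      have h := (h3 i).get (i := k) (by simp) hk
      rw [List.getD_eq_getElem _ _ hk]
      simpa using h
    rw [repr_ofCoords, (hb i k).2, e, vecPoly, toPoly_getD_vecScale]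
    have n1 : algebraMap K[X] (RatFunc K) (toPoly (N i k).2) ≠ 0 := by simpa using (hb i k).1
    have n2 : algebraMap K[X] (RatFunc K) (toPoly g * toPoly W.2) ≠ 0 := by
      simpa using ⟨hg, h1⟩
    rw [div_eq_div_iff n2 n1, ← map_mul, ← map_mul]
    congr 1
    linear_combination toPoly g * h4

/-- The algorithm computes the products of the elements of a reduced basis with powers of `x`. -/
theorem mainAlg_spec (h0 : 0 < m) {a b u : Module.Basis (Fin m) (RatFunc K) A}
    {Nb Nu : Fin m → Fin m → List K × List K} (hb : ∀ i, IsCoords a (b i) (Nb i))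
    (hu : ∀ i, IsCoords a (u i) (Nu i)) :
    ∃ (c : Module.Basis (Fin m) (RatFunc K) A) (k : Fin m → ℕ),
      (∀ M : Set A, IsLatticeBasis (polySubring K) b M → IsLatticeBasis (polySubring K) c M) ∧
      IsReducedBasis (fun i k => u.repr (c i) k) ∧
      (∀ i j, j < k i ↔ ((j : ℤ) : WithBot ℤ) + vecDeg (fun k => u.repr (c i) k) ≤ 0) ∧
      List.Forall₂ (fun w o => ∃ N : Fin m → List K × List K, o = List.ofFn N ∧ IsCoords a w N)
        ((List.finRange m).flatMap fun i =>
          (List.range (k i)).reverse.map fun j => (RatFunc.X : RatFunc K) ^ j • c i)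
        (mainAlg (List.ofFn fun i => List.ofFn (Nb i)) (List.ofFn fun i => List.ofFn (Nu i))) := by
  obtain ⟨b1, b2, b3, b4⟩ := ofCoords_matCommon hb
  obtain ⟨u1, u2, u3, u4⟩ := ofCoords_matCommon hu
  rw [mainAlg]
  set WB := matCommon (List.ofFn fun i => List.ofFn (Nb i)) with hWB
  set WU := matCommon (List.ofFn fun i => List.ofFn (Nu i)) with hWU
  replace b4 := b4 WU.2 u1
  replace u4 := u4 WB.2 b1
  set B := WB.1.map (vecScale WU.2) with hB
  set U := WU.1.map (vecScale WB.2) with hU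
  set P := toPoly WB.2 * toPoly WU.2 with hP
  rw [mul_comm, ← hP] at b4
  have hP0 : P ≠ 0 := mul_ne_zero b1 u1
  have hlen : ∀ (W : List (List (List K))) (g : List K), (∀ c ∈ W, c.length = m) →
      ∀ c ∈ W.map (vecScale g), c.length = m := by
    intro W g h c hc
    obtain ⟨x, hx, rfl⟩ := List.mem_map.1 hc
    rw [length_vecScale, h x hx]
  obtain ⟨D, F, T, k, out, hD, hF, hmain, hout, hrel, hspan, hli, hinj, hk⟩ :=
    mainPoly_spec h0 (B := B) (U := U) (by simpa [hB] using b2) (hlen _ _ b3)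
      (by simpa [hU] using u2) (hlen _ _ u3)
      (linearIndependent_of_ofCoords a P (by simpa only [b4] using b.linearIndependent))
      (linearIndependent_of_ofCoords a P (by simpa only [u4] using u.linearIndependent))
  set c₀ : Fin m → A := fun i => ofCoords a P (T i) with hc₀
  have hT : ∀ i, ∃ q : Fin m → K[X], ∑ j, q j • vecPoly m (B.getD j []) = T i := fun i =>
    (Submodule.mem_span_range_iff_exists_fun _).1
      (hspan ▸ Submodule.subset_span (Set.mem_range_self i))
  have hT' : ∀ j : Fin m, ∃ q : Fin m → K[X], ∑ i, q i • T i = vecPoly m (B.getD j []) := fun j =>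
    (Submodule.mem_span_range_iff_exists_fun _).1
      (hspan ▸ Submodule.subset_span (Set.mem_range_self j))
  choose q hq using hT
  choose q' hq' using hT'
  have hcb : ∀ i, c₀ i = ∑ j, algebraMap K[X] (RatFunc K) (q i j) • b j := fun i => by
    simp only [hc₀]
    rw [← hq i, ofCoords_sum]
    simp only [b4]
  have hbc : ∀ j, b j = ∑ i, algebraMap K[X] (RatFunc K) (q' j i) • c₀ i := fun j => by
    rw [← b4 j, ← hq' j, ofCoords_sum]
  have htop : ⊤ ≤ Submodule.span (RatFunc K) (Set.range c₀) := by
    rw [← b.span_eq, Submodule.span_le]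
    rintro _ ⟨j, rfl⟩
    rw [hbc]
    exact Submodule.sum_mem _ fun i _ =>
      Submodule.smul_mem _ _ (Submodule.subset_span (Set.mem_range_self i))
  let c : Module.Basis (Fin m) (RatFunc K) A :=
    basisOfTopLeSpanOfCardEqFinrank c₀ htop (Module.finrank_eq_card_basis a).symm
  have hc : ⇑c = c₀ := coe_basisOfTopLeSpanOfCardEqFinrank _ _ _
  have hrepr : ∀ i l, u.repr (c i) l =
      algebraMap K[X] (RatFunc K) (-unflat m (F i) l) / algebraMap K[X] (RatFunc K) D := by
    intro i l
    have hD' : algebraMap K[X] (RatFunc K) D ≠ 0 := by simpa using hD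
    have e1 : D • T i = ∑ l, (-unflat m (F i) l) • vecPoly m (U.getD l []) := by
      simp only [neg_smul, Finset.sum_neg_distrib]
      exact eq_neg_of_add_eq_zero_right (hrel i)
    have e2 : algebraMap K[X] (RatFunc K) D • c i =
        ∑ l, algebraMap K[X] (RatFunc K) (-unflat m (F i) l) • u l := by
      have e3 := ofCoords_sum a P (fun l => -unflat m (F i) l)
        fun l : Fin m => vecPoly m (U.getD l [])
      simp only [u4] at e3
      rw [← e3, ← e1, hc]
      refine a.repr.injective (Finsupp.ext fun k => ?_)
      simp only [hc₀, map_smul, Finsupp.smul_apply, repr_ofCoords, Pi.smul_apply, smul_eq_mul,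
        map_mul, mul_div_assoc]
    have e4 := congrArg (fun w => u.repr w l) e2
    simp only [u.repr_sum_self, map_smul, Finsupp.smul_apply, smul_eq_mul] at e4
    rw [eq_div_iff hD', mul_comm]
    exact e4
  obtain ⟨hred, hdeg⟩ := isReducedBasis_of_unflat h0 hD hF hinj
    (b := fun i k => u.repr (c i) k) hrepr
  refine ⟨c, k, fun M hM => hM.of_repr_mem (fun i j => ?_) fun i j => ?_, hred, fun i j => ?_, ?_⟩
  · rw [hc, hcb, b.repr_sum_self]
    exact ⟨_, rfl⟩
  · rw [hbc, ← hc, c.repr_sum_self]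
    exact ⟨_, rfl⟩
  · rw [hk, hdeg i]
    have e : ((j : ℤ) : WithBot ℤ) + (((F i).natDegree / m : ℕ) - (D.natDegree : ℤ) : ℤ) ≤ 0 ↔
        (F i).natDegree / m + j ≤ D.natDegree := by
      rw [← WithBot.coe_add, ← WithBot.coe_zero, WithBot.coe_le_coe]
      omega
    rw [e]
    rcases le_or_gt j D.natDegree with hj | hj
    · obtain ⟨d, hd⟩ := Nat.exists_eq_add_of_le hj
      have h := Nat.div_lt_iff_lt_mul (x := (F i).natDegree) (y := d + 1) h0
      have e' : m * (D.natDegree + 1) = (d + 1) * m + m * j := by rw [hd]; ring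
      rw [e']
      omega
    · have h := Nat.mul_le_mul_left m (Nat.succ_le_of_lt hj)
      rw [Nat.succ_eq_add_one] at h
      generalize (F i).natDegree / m = z
      omega
  · rw [hmain, List.map_flatMap]
    refine List.rel_flatMap (R := Eq) (List.forall₂_refl _) ?_
    rintro i _ rfl
    dsimp only
    rw [List.map_map, List.forall₂_map_left_iff, List.forall₂_map_right_iff, List.forall₂_same]
    intro j _
    obtain ⟨hl, hv⟩ := hout i j
    refine ⟨fun k => ((out i j).getD k [], polyMul WB.2 WU.2), ?_, fun k => ⟨?_, ?_⟩⟩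
    · refine List.ext_getElem (by simp [hl]) fun k h1 h2 => ?_
      have h3 : k < (out i j).length := by simpa using h1
      simp [h3]
    · rw [toPoly_polyMul]
      exact hP0
    · have h3 : toPoly ((out i j).getD k []) = X ^ j * T i k := congrFun hv k
      rw [toPoly_polyMul, map_smul, Finsupp.smul_apply, hc, hc₀]
      dsimp only
      rw [repr_ofCoords, h3, map_mul _ (X ^ j) (T i k), map_pow, RatFunc.algebraMap_X, smul_eq_mul,
        mul_div_assoc]

end Correct

/-! ### Inputs and outputs -/

section Scaled

variable {α β : Type*} [Enc α] [Enc β] {M : ℕ}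

/-! If the weight of the entries is at most `M` times the size of the trees that store them, the
same is true for pairs and lists. -/

theorem wt_pair_le_mul_size (hM : 1 ≤ M) {x : α × β} (h1 : wt x.1 ≤ M * (enc x.1).size)
    (h2 : wt x.2 ≤ M * (enc x.2).size) : wt x ≤ M * (enc x).size := by
  obtain ⟨a, b⟩ := x
  have e : (enc (a, b)).size = (enc a).size + (enc b).size + 1 := rfl
  have e' : wt (a, b) = wt a + wt b + 1 := rfl
  rw [e', e, mul_add, mul_add]
  dsimp only at h1 h2
  omega

theorem wt_list_le_mul_size (hM : 1 ≤ M) {l : List α} (h : ∀ a ∈ l, wt a ≤ M * (enc a).size) :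
    wt l ≤ M * (enc l).size := by
  induction l with
  | nil => simpa [enc, Dat.ofList, Dat.size] using hM
  | cons a l ih =>
    have e : (enc (a :: l)).size = (enc a).size + (enc l).size + 1 := rfl
    have h1 := h a (by simp)
    have h2 := ih fun b hb => h b (by simp [hb])
    rw [wt_cons, e, mul_add, mul_add]
    omega

end Scaled

theorem size_ofList_ge (l : List Dat) : 2 * l.length + 1 ≤ (Dat.ofList l).size := by
  induction l with
  | nil => simp [Dat.ofList, Dat.size]
  | cons a l ih =>
    have := a.size_pos
    simp only [Dat.ofList, Dat.size, List.length_cons]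
    omega

namespace FieldData

variable {F : FieldData.{v}}

/-- Each of the coefficients of the modulus has the weight of the prime, which the description
contains only once; this is why the bound is quadratic. -/
theorem wt_desc_le (d : F.Desc) : wt d ≤ 100 * (enc d).size ^ 2 := by
  change wt (PrimeTag.mk (p := F.p), F.modulus) ≤ 100 * (encField F.pb).size ^ 2
  have h1 := size_ofList_ge ((Nat.bits F.p).map Dat.ofBool)
  have h2 := size_ofList_ge (List.ofFn fun i : Fin (F.pb.dim + 1) =>
    Dat.ofNat ((minpoly (ZMod F.p) F.pb.gen).coeff i).val)
  have h3 : (encField F.pb).size = (Dat.ofNat F.p).size + (Dat.ofList (List.ofFn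
    fun i : Fin (F.pb.dim + 1) => Dat.ofNat ((minpoly (ZMod F.p) F.pb.gen).coeff i).val)).size
      + 1 := rfl
  rw [List.length_map, Nat.size_eq_bits_len] at h1
  rw [List.length_ofFn] at h2
  change _ ≤ (Dat.ofNat F.p).size at h1
  rw [wt_pair, wt_zmod_list, length_modulus, wt_primeTag, wt_nat]
  set S := (encField F.pb).size
  have hs : F.p.size ≤ S := by omega
  have hd : F.pb.dim + 1 ≤ S := by omega
  have h4 : (F.pb.dim + 1) * (4 * F.p.size + 1 + 1) ≤ S * (4 * S + 2) :=
    Nat.mul_le_mul hd (by omega)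
  nlinarith

/-- The weight of an input, in terms of which running times are bounded, is polynomial in its size:
the weight of a field element is at most the weight of the description of the field. -/
theorem wt_input_le (x : F.Desc × (List (List (List F.K × List F.K)) ×
    List (List (List F.K × List F.K)))) : wt x ≤ 100 * (enc x).size ^ 3 := by
  have hM := wt_pos x.1
  have helt : ∀ k : F.K, wt k ≤ wt x.1 * (enc k).size := fun k => by
    have h1 := F.eltWt_le x.1
    have h2 := Nat.mul_le_mul_left (wt x.1) (Nat.succ_le_of_lt (enc k).size_pos)
    rw [wt_elt]
    omega
  have hmat : ∀ l : List (List (List F.K × List F.K)), wt l ≤ wt x.1 * (enc l).size := fun l =>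
    wt_list_le_mul_size hM fun c _ => wt_list_le_mul_size hM fun f _ => wt_pair_le_mul_size hM
      (wt_list_le_mul_size hM fun k _ => helt k) (wt_list_le_mul_size hM fun k _ => helt k)
  have h := wt_pair_le_mul_size (x := x) hM
    (Nat.le_mul_of_pos_right _ (enc x.1).size_pos)
    (wt_pair_le_mul_size hM (hmat _) (hmat _))
  have h1 : (enc x.1).size ≤ (enc x).size := by
    have e : (enc x).size = (enc x.1).size + (enc x.2).size + 1 := rfl
    omega
  calc wt x ≤ wt x.1 * (enc x).size := h
    _ ≤ 100 * (enc x.1).size ^ 2 * (enc x).size := Nat.mul_le_mul_right _ (wt_desc_le _)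
    _ ≤ 100 * (enc x).size ^ 2 * (enc x).size := by gcongr
    _ = _ := by ring

theorem repPoly_iff {f : F.K[X]} {d : Dat} :
    RepPoly F.pb f d ↔ ∃ l : List F.K, toPoly l = f ∧ d = enc l := by
  refine exists_congr fun l => and_congr ⟨fun h => ?_, fun h i => ?_⟩ Iff.rfl
  · ext i
    rw [coeff_toPoly, h]
  · rw [← h, coeff_toPoly]

variable {A : Type*} [Ring A] [Algebra (RatFunc F.K) A] {m : ℕ}

theorem repVec_iff {a : Module.Basis (Fin m) (RatFunc F.K) A} {y : A} {d : Dat} :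
    RepVec F.pb (fun i => a.repr y i) d ↔
      ∃ N : Fin m → List F.K × List F.K, d = enc (List.ofFn N) ∧ IsCoords a y N := by
  have henc : ∀ N : Fin m → List F.K × List F.K,
      enc (List.ofFn N) = Dat.ofList (List.ofFn fun k => enc (N k)) := fun N => by
    change Dat.ofList (List.map _ _) = _
    rw [List.map_ofFn]
    rfl
  constructor
  · rintro ⟨ds, h, rfl⟩
    have key : ∀ k, ∃ N : List F.K × List F.K, ds k = enc N ∧ toPoly N.2 ≠ 0 ∧
        a.repr y k = algebraMap F.K[X] (RatFunc F.K) (toPoly N.1) /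
          algebraMap F.K[X] (RatFunc F.K) (toPoly N.2) := by
      intro k
      obtain ⟨f, g, df, dg, hg, hf', hg', hy, hd⟩ := h k
      obtain ⟨lf, rfl, rfl⟩ := repPoly_iff.1 hf'
      obtain ⟨lg, rfl, rfl⟩ := repPoly_iff.1 hg'
      exact ⟨(lf, lg), hd, hg, hy⟩
    choose N hN1 hN2 using key
    exact ⟨N, by rw [henc, funext hN1], hN2⟩
  · rintro ⟨N, rfl, hN⟩
    exact ⟨fun k => enc (N k), fun k => ⟨_, _, _, _, (hN k).1, repPoly_iff.2 ⟨_, rfl, rfl⟩,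
      repPoly_iff.2 ⟨_, rfl, rfl⟩, (hN k).2, rfl⟩, henc N⟩

theorem exists_of_repElems {a : Module.Basis (Fin m) (RatFunc F.K) A} {b : Fin m → A} {d : Dat}
    (h : RepElems F.pb a (List.ofFn b) d) :
    ∃ N : Fin m → Fin m → List F.K × List F.K,
      d = enc (List.ofFn fun i => List.ofFn (N i)) ∧ ∀ i, IsCoords a (b i) (N i) := by
  obtain ⟨ds, h1, rfl⟩ := h
  obtain ⟨ds, rfl⟩ := exists_eq_ofFn (h1.length_eq.symm.trans List.length_ofFn)
  have h2 : ∀ i, RepVec F.pb (fun k => a.repr (b i) k) (ds i) := fun i => by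
    simpa using h1.get (i := i) (by simp) (by simp)
  choose N hN1 hN2 using fun i => repVec_iff.1 (h2 i)
  refine ⟨N, ?_, hN2⟩
  change _ = Dat.ofList (List.map _ _)
  rw [List.map_ofFn]
  congr 2
  funext i
  exact hN1 i

theorem repElems_of_forall₂ {a : Module.Basis (Fin m) (RatFunc F.K) A} {L : List A}
    {o : List (List (List F.K × List F.K))}
    (h : List.Forall₂ (fun w o => ∃ N : Fin m → List F.K × List F.K,
      o = List.ofFn N ∧ IsCoords a w N) L o) : RepElems F.pb a L (enc o) := by
  refine ⟨o.map enc, List.forall₂_map_right_iff.2 (h.imp ?_), rfl⟩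
  rintro w o ⟨N, rfl, hN⟩
  exact repVec_iff.2 ⟨N, rfl, hN⟩

end FieldData

theorem nodup_flatMap_range {m : ℕ} (k : Fin m → ℕ) {α : Type*} {f : Fin m × ℕ → α}
    (hf : Function.Injective f) :
    ((List.finRange m).flatMap fun i =>
      (List.range (k i)).reverse.map fun j => f (i, j)).Nodup := by
  have e : ((List.finRange m).flatMap fun i => (List.range (k i)).reverse.map fun j => f (i, j)) =
      ((List.finRange m).flatMap fun i =>
        (List.range (k i)).reverse.map fun j => (i, j)).map f := by
    rw [List.map_flatMap]
    simp only [List.map_map, Function.comp_def]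
  rw [e]
  refine List.Nodup.map hf (List.nodup_flatMap.2 ⟨fun i _ => ?_, ?_⟩)
  · exact (List.nodup_reverse.2 List.nodup_range).map (Prod.mk_right_injective i)
  · refine (List.nodup_finRange m).imp fun {i i'} hne => ?_
    intro x hx hx'
    simp only [List.mem_map] at hx hx'
    obtain ⟨j, -, rfl⟩ := hx
    obtain ⟨j', -, h⟩ := hx'
    exact hne (congrArg Prod.fst h).symm

/-- One program serves for all finite fields, all algebras and all lattices. -/
theorem exists_prog : ∃ (P : Prog) (T : ℕ[X]), ∀ (F : FieldData.{v}) (m : ℕ) (_ : 0 < m)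
    (A : Type w) [Ring A] [Algebra (RatFunc F.K) A] [Algebra F.K A]
    [IsScalarTower F.K (RatFunc F.K) A] (a b u : Module.Basis (Fin m) (RatFunc F.K) A)
    (Λ Δ : Subring A) (_ : IsLatticeBasis (polySubring F.K) b (Λ : Set A))
    (_ : IsLatticeBasis (degSubring F.K) u (Δ : Set A)) (x : Dat), RepInput F.pb a b u x →
    ∃ (y : Dat) (t : ℕ) (c : Module.Basis (Fin m) (RatFunc F.K) A) (L : List A),
      Run P x y t ∧ t ≤ T.eval x.size ∧ y.size ≤ T.eval x.size ∧
      RepElems F.pb a L y ∧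
      IsBasisOf F.K (fun i : Fin L.length => L.get i) ((Λ : Set A) ∩ (Δ : Set A)) ∧
      IsLatticeBasis (polySubring F.K) c (Λ : Set A) ∧
      IsReducedBasis (fun i k => u.repr (c i) k) ∧
      (∀ w : A, w ∈ L ↔ ∃ (i : Fin m) (j : ℕ),
        ((j : ℤ) : WithBot ℤ) + vecDeg (fun k => u.repr (c i) k) ≤ 0 ∧
          w = (RatFunc.X : RatFunc F.K) ^ j • c i) := by
  obtain ⟨C, hC⟩ := exists_mainAlg
  refine ⟨C.prog, C.bd.comp (100 * X ^ 3), ?_⟩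
  intro F m h0 A _ _ _ _ a b u Λ Δ hΛ hΔ x hx
  obtain ⟨db, du, hb, hu, rfl⟩ := hx
  obtain ⟨Nb, rfl, hNb⟩ := FieldData.exists_of_repElems hb
  obtain ⟨Nu, rfl, hNu⟩ := FieldData.exists_of_repElems hu
  obtain ⟨c, k, hcb, hred, hk, hout⟩ := mainAlg_spec h0 hNb hNu
  obtain ⟨t, ht, htle, hwt⟩ := hC F (FieldData.Desc.mk, (List.ofFn fun i => List.ofFn (Nb i),
    List.ofFn fun i => List.ofFn (Nu i)))
  have hle := eval_mono C.bd (FieldData.wt_input_le (FieldData.Desc.mk,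
    (List.ofFn fun i => List.ofFn (Nb i), List.ofFn fun i => List.ofFn (Nu i))))
  have heval : ∀ N : ℕ, (C.bd.comp (100 * X ^ 3)).eval N = C.bd.eval (100 * N ^ 3) := fun N => by
    simp
  set L : List A := (List.finRange m).flatMap fun i =>
    (List.range (k i)).reverse.map fun j => (RatFunc.X : RatFunc F.K) ^ j • c i with hL
  have hmem : ∀ w : A, w ∈ L ↔ ∃ (i : Fin m) (j : ℕ),
      ((j : ℤ) : WithBot ℤ) + vecDeg (fun k => u.repr (c i) k) ≤ 0 ∧
        w = (RatFunc.X : RatFunc F.K) ^ j • c i := fun w => by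
    simp only [hL, List.mem_flatMap, List.mem_finRange, true_and, List.mem_map, List.mem_reverse,
      List.mem_range, hk, eq_comm (a := w)]
  refine ⟨_, t, c, L, ht, ?_, ?_, FieldData.repElems_of_forall₂ hout, ?_, hcb _ hΛ, hred,
    hmem⟩
  · rw [heval]
    exact htle.trans hle
  · rw [heval]
    exact (Enc.size_le _).trans (hwt.trans hle)
  · refine isBasisOf_get (isBasisOf_inter (hcb _ hΛ) hΔ hred)
      (nodup_flatMap_range k (linearIndependent_X_pow_smul (K := F.K) c).injective) fun w => ?_
    rw [hmem]
    constructor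
    · rintro ⟨i, j, hij, rfl⟩
      exact ⟨⟨(i, j), hij⟩, rfl⟩
    · rintro ⟨⟨⟨i, j⟩, hij⟩, rfl⟩
      exact ⟨i, j, hij, rfl⟩

end
end ExplicitIso

theorem mainTheorem6 :
    -- one program and one polynomial, for all fields, all `n`, all algebras and all orders
    ∃ (P : Prog) (T : Polynomial ℕ),
      ∀ (p : ℕ) (_ : Fact p.Prime) (K : Type*) (_ : Field K) (_ : Algebra (ZMod p) K)
        (pb : PowerBasis (ZMod p) K)
        (n : ℕ) (_ : 0 < n)
        (A : Type*) (_ : Ring A) (_ : Algebra (RatFunc K) A) (_ : Algebra K A)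
        (_ : IsScalarTower K (RatFunc K) A)
        (_ : Nonempty (A ≃ₐ[RatFunc K] Matrix (Fin n) (Fin n) (RatFunc K)))
        -- the input basis of `A`, and the two maximal orders with their bases
        (a b u : Module.Basis (Fin (n ^ 2)) (RatFunc K) A) (Λ Δ : Subring A)
        (_ : IsMaximalOrder (polySubring K) Λ) (_ : IsMaximalOrder (degSubring K) Δ)
        (_ : IsLatticeBasis (polySubring K) b (Λ : Set A))
        (_ : IsLatticeBasis (degSubring K) u (Δ : Set A)),
        -- every reduced basis of `Λ`, in `Δ`-coordinates, yields a basis of `Λ ∩ Δ`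
        (∀ c : Module.Basis (Fin (n ^ 2)) (RatFunc K) A,
          IsLatticeBasis (polySubring K) c (Λ : Set A) →
          IsReducedBasis (fun i k => u.repr (c i) k) →
          IsBasisOf K
            (fun ij : {ij : Fin (n ^ 2) × ℕ //
                ((ij.2 : ℤ) : WithBot ℤ) + vecDeg (fun k => u.repr (c ij.1) k) ≤ 0} =>
              (RatFunc.X : RatFunc K) ^ ij.1.2 • c ij.1.1)
            ((Λ : Set A) ∩ (Δ : Set A))) ∧
        -- the program computes such a basis; its running time, and the size of its result as a
        -- fully written out tree, are polynomial in the size of the input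
        (∀ x : Dat, RepInput pb a b u x →
          ∃ (y : Dat) (t : ℕ) (c : Module.Basis (Fin (n ^ 2)) (RatFunc K) A) (L : List A),
            Run P x y t ∧ t ≤ T.eval x.size ∧ y.size ≤ T.eval x.size ∧
            RepElems pb a L y ∧
            IsBasisOf K (fun i : Fin L.length => L.get i) ((Λ : Set A) ∩ (Δ : Set A)) ∧
            IsLatticeBasis (polySubring K) c (Λ : Set A) ∧
            IsReducedBasis (fun i k => u.repr (c i) k) ∧
            (∀ w : A, w ∈ L ↔ ∃ (i : Fin (n ^ 2)) (j : ℕ),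
              ((j : ℤ) : WithBot ℤ) + vecDeg (fun k => u.repr (c i) k) ≤ 0 ∧
                w = (RatFunc.X : RatFunc K) ^ j • c i)) := by
  obtain ⟨P, T, h⟩ := exists_prog
  refine ⟨P, T, ?_⟩
  intro p hp K _ _ pb n hn A _ _ _ _ _ a b u Λ Δ _ _ hΛ hΔ
  exact ⟨fun c hc hred => isBasisOf_inter hc hΔ hred,
    h ⟨p, K, pb⟩ (n ^ 2) (pow_pos hn 2) A a b u Λ Δ hΛ hΔ⟩
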